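/- **Scenario.** All Hilbert spaces are finite-dimensional, of arbitrary dimension. In the line network C–A–B–D independent states $\varrho^{CA_0}$, $\varrho^{AB}$, $\varrho^{B_0D}$ are distributed; Charlie, Alice, Bob and Daisy perform measurements (POVMs) on $C$, $A_0A$, $BB_0$ and $D$, giving $$p(c,a,b,d|z,x,y,w)=\operatorname{tr}\big[M_{c|z}\otimes M_{a|x}\otimes M_{b|y}\otimes M_{d|w}\;\varrho^{CA_0}\otimes\varrho^{AB}\otimes\varrho^{B_0D}\big].$$ Fix $n\ge 1$ and $d=2^n$. Charlie and Daisy have inputs $\mathbf z,\mathbf w\in\{1,2,3\}^n$ and outputs $\mathbf c,\mathbf d\in\{\pm1\}^n$. Alice and Bob have inputs $\mathbf x,\mathbf y\in\{1,\dots,6\}^n$ with outputs in $\{\pm1\}^n$, and three additional inputs: $\lozenge$ and $\blacklozenge$ with outputs in $\{0,1,2,3\}^{\lfloor n/2\rfloor}$ and $\{0,1,2,3\}^{\lfloor (n-1)/2\rfloor}$, and $\star$ with output $\pm1$. **Self-test.** Put $E^i_{z,x}=\frac1{3^{n-1}6^{n-1}}\sum_{\mathbf z:z_i=z}\sum_{\mathbf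 x:x_i=x}\sum_{\mathbf c,\mathbf a}c_ia_i\,p(\mathbf c,\mathbf a|\mathbf z,\mathbf x)$ and $$\mathcal J_i=E^i_{1,1}+E^i_{1,2}+E^i_{2,1}-E^i_{2,2}+E^i_{1,3}+E^i_{1,4}-E^i_{3,3}+E^i_{3,4}+E^i_{2,5}+E^i_{2,6}-E^i_{3,5}+E^i_{3,6}.$$ The correlations pass the self-test if $p(\mathbf c,a|\mathbf z,x)$ satisfies the following two conditions and $p(\mathbf d,b|\mathbf w,y)$ satisfies the same conditions. (a) $\sum_{i=1}^n\mathcal J_i=n\cdot6\sqrt2$, the maximal quantum value. (b) The Bell-state-measurement correlations hold (no condition if $n=1$): for each $l\le\lfloor n/2\rfloor$, each $s\in\{0,1,2,3\}$ and input $x=\lozenge$, one has $\Pr(a_l=s)=\frac14$ for every $\mathbf z$; and for $t=1,2,3$ the expectation of $c_{2l-1}c_{2l}\mathbf 1[a_l=s]$, averaged over the $\mathbf z$ with $z_{2l-1}=z_{2l}=t$, is $\frac14\epsilon_{s,t}$, where $\epsilon_0=(+,+,-)$, $\epsilon_1=(+,-,+)$, $\epsilon_2=(-,+,+)$, $\epsilon_3=(-,-,-)$.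 The same holds for $\blacklozenge$ with the pairs $(2l,2l+1)$, $l\le\lfloor (n-1)/2\rfloor$. **Inequality.** Let $\sigma_1,\sigma_2,\sigma_3=\sigma_{\rm z},\sigma_{\rm x},\sigma_{\rm y}$ and $\pi_{\mathbf c|\mathbf z}=\bigotimes_i\frac12(1+c_i\sigma_{z_i})$. For real coefficients $\omega$ put $\mathcal W=\sum\omega^{\mathbf z\mathbf w}_{\mathbf c\mathbf d}\,\pi_{\mathbf c|\mathbf z}\otimes\pi_{\mathbf d|\mathbf w}$ and $\mathcal I=\sum\omega^{\mathbf z\mathbf w}_{\mathbf c\mathbf d}\,p(\mathbf c,+,+,\mathbf d|\mathbf z,\star,\star,\mathbf w)$. **Theorem.** For every $n\ge1$: 1. Every Hermitian operator on $\mathbb C^{2^n}\otimes\mathbb C^{2^n}$ is of the form $\mathcal W$ for some real $\omega$. 2. If a quantum experiment in the network passes the self-test, then there are unitaries $U_C$ on $C\otimes C''\otimes C'$ and $U_A$ on $A_0\otimes A''\otimes A'$ (with $C'',A''$ qubits and $C',A'$ systems of $n$ qubits) and a density operator $\xi$ on $CC''A_0A''$, supported on the span of $|00\rangle,|11\rangle$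 in $C''A''$, such that for all $\mathbf c,\mathbf z$, with $U=U_C\otimes U_A$, $$U\big(M_{\mathbf c|\mathbf z}\,\varrho^{CA_0}\otimes|0\rangle\langle0|^{C''C'A''A'}\big)U^\dagger=\Big(|0\rangle\langle0|^{C''}\otimes\pi_{\mathbf c|\mathbf z}^{C'}+|1\rangle\langle1|^{C''}\otimes(\pi_{\mathbf c|\mathbf z}^{T})^{C'}\Big)\,\big(\xi\otimes|\Phi^+\rangle\langle\Phi^+|^{C'A'}\big),$$ where $|\Phi^+\rangle=d^{-1/2}\sum_i|ii\rangle$; and likewise for $\varrho^{B_0D}$ and Daisy's measurements. So the auxiliary states contain maximally entangled states, and Charlie and Daisy perform Pauli measurements, up to one global transposition each. 3. If moreover $\varrho^{AB}$ is separable (with arbitrary local dimensions), then $\mathcal I\ge0$ for every $\omega$ for which $\operatorname{tr}[\mathcal W\sigma]\ge0$ for all separable states $\sigma$. 4. Let $\varrho$ be any bipartite state whose local spaces are embedded in $\mathbb C^{2^n}$ by isometries $V_A,V_B$, and let $\varrho'=(V_A\otimes V_B)\varrho(V_A\otimes V_B)^\dagger$. Consider the reference strategy in which $\varrho^{AB}=\varrho$;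 the auxiliary states are $|\Phi^+\rangle\langle\Phi^+|$; Charlie and Daisy measure $\pi_{\mathbf c|\mathbf z}$, $\pi_{\mathbf d|\mathbf w}$; for $\mathbf x$, Alice measures the tensor product of the observables $\frac{\sigma_{\rm z}\pm\sigma_{\rm x}}{\sqrt2},\frac{\sigma_{\rm z}\pm\sigma_{\rm y}}{\sqrt2},\frac{\sigma_{\rm x}\pm\sigma_{\rm y}}{\sqrt2}$ ($x_i=1,\dots,6$) on $A_0$; for $\lozenge$ (respectively $\blacklozenge$) she makes Bell measurements (outcomes $0,1,2,3$ for $\Phi^+,\Phi^-,\Psi^+,\Psi^-$) on the pairs $(2l-1,2l)$ (respectively $(2l,2l+1)$) of qubits of $A_0$; and for $\star$ the outcome $+$ is the projection onto $|\Phi^+\rangle$ of $A_0A$ after the embedding $V_A$. Bob acts analogously. This is a valid quantum experiment, it passes the self-test, and $\mathcal I=\operatorname{tr}[\mathcal W\varrho']/d^4$ for every $\omega$. If $\varrho$ is entangled, then for some $\omega$ the operator $\mathcal W$ is an entanglement witness for $\varrho'$ and $\mathcal I<0$; and the correlations of the reference strategy cannot be produced by any quantum experiment in the network with a separable $\varrho^{AB}$.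 Hence the entanglement of every bipartite entangled state, of any local dimensions, can be certified device-independently: for some $n\ge1$ some experiment in the network with $\varrho^{AB}$ equal to that state yields correlations that no experiment in the network with a separable $\varrho^{AB}$ can reproduce. -/

import Mathlib

open scoped Matrix Kronecker ComplexOrder

namespace DICert

/-! ## States, separability, measurements (finite-dimensional systems `ℂ^ι`) -/

/-- Density matrices. -/
def IsState {ι : Type} [Fintype ι] (ρ : Matrix ι ι ℂ) : Prop :=
  ρ.PosSemidef ∧ ρ.trace = 1

/-- Separable bipartite states: finite convex combinations of product states. -/
def IsSepState {α β : Type} [Fintype α] [Fintype β]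
    (ρ : Matrix (α × β) (α × β) ℂ) : Prop :=
  ∃ (k : ℕ) (p : Fin k → ℝ) (σ : Fin k → Matrix α α ℂ) (τ : Fin k → Matrix β β ℂ),
    (∀ i, 0 ≤ p i) ∧ ∑ i, p i = 1 ∧ (∀ i, IsState (σ i)) ∧ (∀ i, IsState (τ i)) ∧
      ρ = ∑ i, (p i : ℂ) • (σ i ⊗ₖ τ i)

/-- Entangled states: states which are not separable. -/
def IsEntangled {α β : Type} [Fintype α] [Fintype β]
    (ρ : Matrix (α × β) (α × β) ℂ) : Prop :=
  IsState ρ ∧ ¬ IsSepState ρ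

/-- Quantum measurements (POVMs) with outcome set `O`. -/
def IsPOVM {ι O : Type} [Fintype ι] [DecidableEq ι] [Fintype O]
    (M : O → Matrix ι ι ℂ) : Prop :=
  (∀ a, (M a).PosSemidef) ∧ ∑ a, M a = 1

/-! ## Inputs and outputs -/

/-- Charlie's (and Daisy's) inputs `z ∈ {1,2,3}^n`; the values `0, 1, 2` of `Fin 3` stand for
`1, 2, 3`, that is, for the directions z, x, y. -/
abbrev PauliInput (n : ℕ) : Type := Fin n → Fin 3

/-- Strings of `n` signs `±1`. -/
abbrev Signs (n : ℕ) : Type := Fin n → ℤˣ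

/-- Alice's (and Bob's) inputs: a vector `x ∈ {1,…,6}^n` (here `0,…,5`) or one of the three
additional inputs `◊`, `⧫`, `⋆`. -/
inductive NodeInput (n : ℕ) : Type
  | vec (x : Fin n → Fin 6)
  | lozenge
  | blacklozenge
  | star

/-- The outcomes of Alice (and Bob) for each input. For `n = 1` the inputs `◊` and `⧫` have a
single outcome (and for `n = 2` the input `⧫` has), so that they are trivial. -/
@[reducible]
def NodeOutput (n : ℕ) : NodeInput n → Type
  | .vec _ => Signs n
  | .lozenge => Fin (n / 2) → Fin 4
  | .blacklozenge => Fin ((n - 1) / 2) → Fin 4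
  | .star => ℤˣ

instance instFintypeNodeOutput (n : ℕ) : (x : NodeInput n) → Fintype (NodeOutput n x)
  | .vec _ => inferInstanceAs (Fintype (Signs n))
  | .lozenge => inferInstanceAs (Fintype (Fin (n / 2) → Fin 4))
  | .blacklozenge => inferInstanceAs (Fintype (Fin ((n - 1) / 2) → Fin 4))
  | .star => inferInstanceAs (Fintype ℤˣ)

/-- Two-party correlations `P(c, a | z, x)`, written `P z x c a`. -/
abbrev PairBehaviour (n : ℕ) : Type :=
  (z : PauliInput n) → (x : NodeInput n) → Signs n → NodeOutput n x → ℝ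

/-- Four-party correlations `p(c, a, b, d | z, x, y, w)`, written `p z x y w c a b d`. -/
abbrev Behaviour (n : ℕ) : Type :=
  (z : PauliInput n) → (x y : NodeInput n) → (w : PauliInput n) →
    Signs n → NodeOutput n x → NodeOutput n y → Signs n → ℝ

/-! ## The line network C – A – B – D -/

/-- The data of an experiment in the line network: the states `ρ^{CA₀}`, `ρ^{AB}`, `ρ^{B₀D}` and
the local measurement operators of Charlie (on `C`), Alice (on `A₀A`), Bob (on `BB₀`) and
Daisy (on `D`). -/
structure LineNetwork (n : ℕ) (C A₀ A B B₀ D : Type) where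
  ρCA : Matrix (C × A₀) (C × A₀) ℂ
  ρAB : Matrix (A × B) (A × B) ℂ
  ρBD : Matrix (B₀ × D) (B₀ × D) ℂ
  MC : PauliInput n → Signs n → Matrix C C ℂ
  MA : (x : NodeInput n) → NodeOutput n x → Matrix (A₀ × A) (A₀ × A) ℂ
  MB : (y : NodeInput n) → NodeOutput n y → Matrix (B × B₀) (B × B₀) ℂ
  MD : PauliInput n → Signs n → Matrix D D ℂ

namespace LineNetwork

variable {n : ℕ} {C A₀ A B B₀ D : Type}
  [Fintype C] [Fintype A₀] [Fintype A] [Fintype B] [Fintype B₀] [Fintype D]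

/-- The laws of quantum mechanics: the states are density matrices and the measurements POVMs. -/
def IsQuantum [DecidableEq C] [DecidableEq A₀] [DecidableEq A] [DecidableEq B] [DecidableEq B₀]
    [DecidableEq D] (N : LineNetwork n C A₀ A B B₀ D) : Prop :=
  IsState N.ρCA ∧ IsState N.ρAB ∧ IsState N.ρBD ∧
    (∀ z, IsPOVM (N.MC z)) ∧ (∀ x, IsPOVM (N.MA x)) ∧
    (∀ y, IsPOVM (N.MB y)) ∧ (∀ w, IsPOVM (N.MD w))

/-- The global state `ρ^{CA₀} ⊗ ρ^{AB} ⊗ ρ^{B₀D}`, its tensor factors being grouped by party. -/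
def globalState (N : LineNetwork n C A₀ A B B₀ D) :
    Matrix (C × (A₀ × A) × (B × B₀) × D) (C × (A₀ × A) × (B × B₀) × D) ℂ :=
  (N.ρCA ⊗ₖ (N.ρAB ⊗ₖ N.ρBD)).submatrix
    (fun i => ((i.1, i.2.1.1), (i.2.1.2, i.2.2.1.1), (i.2.2.1.2, i.2.2.2)))
    (fun i => ((i.1, i.2.1.1), (i.2.1.2, i.2.2.1.1), (i.2.2.1.2, i.2.2.2)))

/-- The Born rule: `p(c,a,b,d|z,x,y,w)` is the trace of
`(M_{c|z} ⊗ M_{a|x} ⊗ M_{b|y} ⊗ M_{d|w}) (ρ^{CA₀} ⊗ ρ^{AB} ⊗ ρ^{B₀D})`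
(a real number for a quantum network). -/
noncomputable def behaviour (N : LineNetwork n C A₀ A B B₀ D) : Behaviour n :=
  fun z x y w c a b d =>
    ((N.MC z c ⊗ₖ (N.MA x a ⊗ₖ (N.MB y b ⊗ₖ N.MD w d))) * N.globalState).trace.re

end LineNetwork

/-! ## The self-testing part of the protocol: a condition on the observed correlations -/

/-- The average correlation `E^i_{z,x}` of the signs `c_i` and `a_i` over all inputs with
`z_i = t` and `x_i = s`. -/
noncomputable def avgCorr {n : ℕ} (P : PairBehaviour n) (i : Fin n) (t : Fin 3) (s : Fin 6) : ℝ :=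
  1 / (3 ^ (n - 1) * 6 ^ (n - 1)) *
    ∑ z : PauliInput n with z i = t, ∑ x : Fin n → Fin 6 with x i = s,
      ∑ c : Signs n, ∑ a : Signs n, (((c i * a i : ℤˣ) : ℤ) : ℝ) * P z (.vec x) c a

/-- The triple CHSH expression `J_i`. -/
noncomputable def tripleCHSH {n : ℕ} (P : PairBehaviour n) (i : Fin n) : ℝ :=
  (avgCorr P i 0 0 + avgCorr P i 0 1 + avgCorr P i 1 0 - avgCorr P i 1 1) +
  (avgCorr P i 0 2 + avgCorr P i 0 3 - avgCorr P i 2 2 + avgCorr P i 2 3) +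
  (avgCorr P i 1 4 + avgCorr P i 1 5 - avgCorr P i 2 4 + avgCorr P i 2 5)

/-- The table of Bell state measurement correlations: the row is the outcome
(`Φ⁺, Φ⁻, Ψ⁺, Ψ⁻`), the column is the pair of observables (`ZZ, XX, YY`). -/
noncomputable def bellTable (s : Fin 4) (t : Fin 3) : ℝ :=
  !![1/4, 1/4, -1/4;
     1/4, -1/4, 1/4;
     -1/4, 1/4, 1/4;
     -1/4, -1/4, -1/4] s t

/-- First and second qubit (counted from `0`) of the `l`-th pair measured for the input `◊`. -/
def lozPair (n : ℕ) (l : Fin (n / 2)) : Fin n × Fin n :=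
  (⟨2 * l, by omega⟩, ⟨2 * l + 1, by omega⟩)

/-- First and second qubit (counted from `0`) of the `l`-th pair measured for the input `⧫`. -/
def blackPair (n : ℕ) (l : Fin ((n - 1) / 2)) : Fin n × Fin n :=
  (⟨2 * l + 1, by omega⟩, ⟨2 * l + 2, by omega⟩)

/-- For an input `x` whose outcomes are strings `a` of Bell outcomes for the pairs of qubits
`pair l`: every marginal outcome probability of `a_l` is `1/4`, and the correlations of the event
`a_l = s` with `c_i c_j`, `(i, j) = pair l`, averaged over the inputs with `z_i = z_j = t`, are
those of the table. -/
def BellCorrelations {n m : ℕ} (pair : Fin m → Fin n × Fin n)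
    (P : PauliInput n → Signs n → (Fin m → Fin 4) → ℝ) : Prop :=
  ∀ (l : Fin m) (s : Fin 4),
    (∀ z, ∑ c, ∑ a : Fin m → Fin 4 with a l = s, P z c a = 1 / 4) ∧
    ∀ t : Fin 3,
      1 / 3 ^ (n - 2) *
        ∑ z : PauliInput n with z (pair l).1 = t ∧ z (pair l).2 = t,
          ∑ c : Signs n, ∑ a : Fin m → Fin 4 with a l = s,
            (((c (pair l).1 * c (pair l).2 : ℤˣ) : ℤ) : ℝ) * P z c a = bellTable s t

/-- The self-test for one pair of parties: maximal violation of all the triple CHSH inequalities,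
and the Bell state measurement correlations (no condition if `n = 1`). -/
def PairSelfTest {n : ℕ} (P : PairBehaviour n) : Prop :=
  ∑ i, tripleCHSH P i = n * (6 * √2) ∧
  BellCorrelations (lozPair n) (fun z => P z .lozenge) ∧
  BellCorrelations (blackPair n) (fun z => P z .blacklozenge)

/-- The self-testing step: the marginals `p(c,a|z,x)` and `p(d,b|w,y)` pass the self-test. -/
def PassesSelfTest {n : ℕ} (p : Behaviour n) : Prop :=
  (∀ y w, PairSelfTest (fun z x c a => ∑ b, ∑ d, p z x y w c a b d)) ∧
  (∀ z x, PairSelfTest (fun w y d b => ∑ c, ∑ a, p z x y w c a b d))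

/-! ## Pauli projectors, witnesses, the certification inequality -/

/-- `n` qubits: `ℂ^(Qubits n) = (ℂ²)^{⊗ n}`, of dimension `2^n`. -/
abbrev Qubits (n : ℕ) : Type := Fin n → Fin 2

/-- The tensor product of `n` one-qubit operators. -/
def tensorOp {n : ℕ} (f : Fin n → Matrix (Fin 2) (Fin 2) ℂ) : Matrix (Qubits n) (Qubits n) ℂ :=
  Matrix.of fun u v => ∏ i, f i (u i) (v i)

/-- The Pauli matrices `σ_z, σ_x, σ_y`, in this order. -/
def pauli : Fin 3 → Matrix (Fin 2) (Fin 2) ℂ :=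
  ![!![1, 0; 0, -1], !![0, 1; 1, 0], !![0, -Complex.I; Complex.I, 0]]

/-- The projector `(1 + c S)/2` onto the `c`-eigenspace of a `±1`-valued qubit observable `S`. -/
noncomputable def signProj (S : Matrix (Fin 2) (Fin 2) ℂ) (c : ℤˣ) : Matrix (Fin 2) (Fin 2) ℂ :=
  (1 / 2 : ℂ) • (1 + ((c : ℤ) : ℂ) • S)

/-- The product Pauli projectors `π_{c|z} = ⊗_i π_{c_i|z_i}`. -/
noncomputable def pauliProj {n : ℕ} (z : PauliInput n) (c : Signs n) :
    Matrix (Qubits n) (Qubits n) ℂ :=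
  tensorOp fun i => signProj (pauli (z i)) (c i)

/-- Real coefficients `ω_{cd}^{zw}`, written `ω z w c d`. -/
abbrev Coefficients (n : ℕ) : Type := PauliInput n → PauliInput n → Signs n → Signs n → ℝ

/-- The operator `W = ∑ ω_{cd}^{zw} π_{c|z} ⊗ π_{d|w}`. -/
noncomputable def witnessOp {n : ℕ} (ω : Coefficients n) :
    Matrix (Qubits n × Qubits n) (Qubits n × Qubits n) ℂ :=
  ∑ z, ∑ w, ∑ c, ∑ d, (ω z w c d : ℂ) • (pauliProj z c ⊗ₖ pauliProj w d)

/-- `W` is nonnegative on separable states: `tr[W σ] ≥ 0` for every separable state `σ`. -/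
def NonnegOnSeparable {α β : Type} [Fintype α] [Fintype β]
    (W : Matrix (α × β) (α × β) ℂ) : Prop :=
  W.IsHermitian ∧ ∀ σ : Matrix (α × β) (α × β) ℂ, IsSepState σ → 0 ≤ (W * σ).trace.re

/-- `W` is an entanglement witness for the state `ρ`. -/
def IsWitnessFor {α β : Type} [Fintype α] [Fintype β]
    (W ρ : Matrix (α × β) (α × β) ℂ) : Prop :=
  NonnegOnSeparable W ∧ (W * ρ).trace.re < 0

/-- The certification quantity `I = ∑ ω_{cd}^{zw} p(c,+,+,d|z,⋆,⋆,w)`. -/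
noncomputable def certValue {n : ℕ} (ω : Coefficients n) (p : Behaviour n) : ℝ :=
  ∑ z, ∑ w, ∑ c, ∑ d, ω z w c d * p z .star .star w c (1 : ℤˣ) (1 : ℤˣ) d

/-! ## What the self-test certifies -/

/-- The projector onto the maximally entangled vector `d^{-1/2} ∑_i |ii⟩` of `ℂ^ι ⊗ ℂ^ι`. For
`ι = Qubits n` it is the `n`-fold tensor power of the two-qubit projector `|Φ⁺⟩⟨Φ⁺|`. -/
noncomputable def maxEnt (ι : Type) [Fintype ι] [DecidableEq ι] : Matrix (ι × ι) (ι × ι) ℂ :=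
  Matrix.of fun p q => if p.1 = p.2 ∧ q.1 = q.2 then (Fintype.card ι : ℂ)⁻¹ else 0

/-- The map `ψ ↦ U (ψ ⊗ |0⟩ ⊗ |0…0⟩)`: a control qubit and `n` further qubits are adjoined. -/
def onAncilla {n : ℕ} {C : Type} (U : Matrix (C × Fin 2 × Qubits n) (C × Fin 2 × Qubits n) ℂ) :
    Matrix (C × Fin 2 × Qubits n) C ℂ :=
  U.submatrix id (fun c => (c, 0, 0))

/-- The measurement operator `1 ⊗ (|0⟩⟨0| ⊗ π + |1⟩⟨1| ⊗ πᵀ)`: the control qubit decides between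
`π` and its transpose. -/
def controlledTranspose {n : ℕ} (C : Type) [DecidableEq C]
    (π : Matrix (Qubits n) (Qubits n) ℂ) :
    Matrix (C × Fin 2 × Qubits n) (C × Fin 2 × Qubits n) ℂ :=
  (1 : Matrix C C ℂ) ⊗ₖ
    (Matrix.single (0 : Fin 2) (0 : Fin 2) (1 : ℂ) ⊗ₖ π +
      Matrix.single (1 : Fin 2) (1 : Fin 2) (1 : ℂ) ⊗ₖ πᵀ)

/-- Up to local unitaries `U_C`, `U_A` acting on the systems with ancillas in the state `|00⟩`, the
state `ρ` of `C ⊗ A` is a junk state `ξ` tensor a maximally entangled state of `n + n` qubits, and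
the measurement `M z` acts as the `n`-qubit Pauli measurement given by `z`, or as its transpose
(for all `z` together) according to a control qubit. The control qubits of the two parties are
perfectly correlated in `ξ` (for pure `ξ`: the vector is `ξ₀ ⊗ |00⟩ + ξ₁ ⊗ |11⟩`). -/
def SelfTestsPauli {n : ℕ} {C A : Type} [Fintype C] [Fintype A] [DecidableEq C] [DecidableEq A]
    (ρ : Matrix (C × A) (C × A) ℂ) (M : PauliInput n → Signs n → Matrix C C ℂ) : Prop :=
  ∃ UC ∈ Matrix.unitaryGroup (C × Fin 2 × Qubits n) ℂ,
  ∃ UA ∈ Matrix.unitaryGroup (A × Fin 2 × Qubits n) ℂ,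
  ∃ ξ : Matrix ((C × Fin 2) × (A × Fin 2)) ((C × Fin 2) × (A × Fin 2)) ℂ,
    IsState ξ ∧ (∀ i j, i.1.2 ≠ i.2.2 → ξ i j = 0) ∧
    ∀ z c,
      (onAncilla UC ⊗ₖ onAncilla UA) * ((M z c ⊗ₖ (1 : Matrix A A ℂ)) * ρ) *
          (onAncilla UC ⊗ₖ onAncilla UA)ᴴ =
        (controlledTranspose C (pauliProj z c) ⊗ₖ
            (1 : Matrix (A × Fin 2 × Qubits n) (A × Fin 2 × Qubits n) ℂ)) *
          (ξ ⊗ₖ maxEnt (Qubits n)).submatrix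
            (fun i => (((i.1.1, i.1.2.1), (i.2.1, i.2.2.1)), (i.1.2.2, i.2.2.2)))
            (fun i => (((i.1.1, i.1.2.1), (i.2.1, i.2.2.1)), (i.1.2.2, i.2.2.2)))

/-! ## The reference strategy -/

/-- The six qubit observables `(σ_z ± σ_x)/√2, (σ_z ± σ_y)/√2, (σ_x ± σ_y)/√2`. -/
noncomputable def nodeObs : Fin 6 → Matrix (Fin 2) (Fin 2) ℂ :=
  ![((√2 : ℝ) : ℂ)⁻¹ • (pauli 0 + pauli 1), ((√2 : ℝ) : ℂ)⁻¹ • (pauli 0 - pauli 1),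
    ((√2 : ℝ) : ℂ)⁻¹ • (pauli 0 + pauli 2), ((√2 : ℝ) : ℂ)⁻¹ • (pauli 0 - pauli 2),
    ((√2 : ℝ) : ℂ)⁻¹ • (pauli 1 + pauli 2), ((√2 : ℝ) : ℂ)⁻¹ • (pauli 1 - pauli 2)]

/-- The Bell vectors `Φ⁺, Φ⁻, Ψ⁺, Ψ⁻`, as matrices of coefficients (real numbers). -/
noncomputable def bellVec (s : Fin 4) : Matrix (Fin 2) (Fin 2) ℂ :=
  ((√2 : ℝ) : ℂ)⁻¹ •
    (![!![1, 0; 0, 1], !![1, 0; 0, -1], !![0, 1; 1, 0], !![0, 1; -1, 0]] s)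

/-- The projector `⊗_l |Ψ_{a_l}⟩⟨Ψ_{a_l}|` for the disjoint pairs of qubits `pair l`, tensor the
identity on the remaining qubits. -/
noncomputable def bellMeas {n m : ℕ} (pair : Fin m → Fin n × Fin n) (a : Fin m → Fin 4) :
    Matrix (Qubits n) (Qubits n) ℂ :=
  Matrix.of fun u v =>
    (∏ l, bellVec (a l) (u (pair l).1) (u (pair l).2) *
      bellVec (a l) (v (pair l).1) (v (pair l).2)) *
    (if ∀ k, (∀ l, k ≠ (pair l).1 ∧ k ≠ (pair l).2) → u k = v k then 1 else 0)

/-- The measurements on the `n` auxiliary qubits for the inputs `x`, `◊`, `⧫`, and, for the input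
`⋆`, the measurement with outcomes `+1, -1` given by the effects `F`, `1 - F` on the whole
system `ι`, in which the auxiliary qubits are included by `emb`. -/
noncomputable def nodeMeas {n : ℕ} {ι : Type} [DecidableEq ι]
    (emb : Matrix (Qubits n) (Qubits n) ℂ → Matrix ι ι ℂ) (F : Matrix ι ι ℂ) :
    (x : NodeInput n) → NodeOutput n x → Matrix ι ι ℂ
  | .vec x, a => emb (tensorOp fun i => signProj (nodeObs (x i)) (a i))
  | .lozenge, a => emb (bellMeas (lozPair n) a)
  | .blacklozenge, a => emb (bellMeas (blackPair n) a)
  | .star, a => if a = (1 : ℤˣ) then F else 1 - F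

/-- The reference strategy for a state `ρ` of systems `α`, `β`, which are embedded in `n` qubits
each by isometries `VA`, `VB`: both auxiliary states are maximally entangled, Charlie and Daisy
measure products of Pauli matrices, Alice and Bob measure as above, the outcome `+` of the input
`⋆` being the projection onto the maximally entangled state of `A₀A` (respectively of `BB₀`) after
the embedding. -/
noncomputable def referenceNetwork (n : ℕ) {α β : Type} [Fintype α] [Fintype β]
    [DecidableEq α] [DecidableEq β]
    (VA : Matrix (Qubits n) α ℂ) (VB : Matrix (Qubits n) β ℂ)
    (ρ : Matrix (α × β) (α × β) ℂ) :
    LineNetwork n (Qubits n) (Qubits n) α β (Qubits n) (Qubits n) where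
  ρCA := maxEnt (Qubits n)
  ρAB := ρ
  ρBD := maxEnt (Qubits n)
  MC := pauliProj
  MA := nodeMeas (fun T => T ⊗ₖ (1 : Matrix α α ℂ))
    (((1 : Matrix (Qubits n) (Qubits n) ℂ) ⊗ₖ VA)ᴴ * maxEnt (Qubits n) *
      ((1 : Matrix (Qubits n) (Qubits n) ℂ) ⊗ₖ VA))
  MB := nodeMeas (fun T => (1 : Matrix β β ℂ) ⊗ₖ T)
    ((VB ⊗ₖ (1 : Matrix (Qubits n) (Qubits n) ℂ))ᴴ * maxEnt (Qubits n) *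
      (VB ⊗ₖ (1 : Matrix (Qubits n) (Qubits n) ℂ)))
  MD := pauliProj

/-- The embedded state `(VA ⊗ VB) ρ (VA ⊗ VB)†` of `n + n` qubits. -/
def embedState {n : ℕ} {α β : Type} [Fintype α] [Fintype β]
    (VA : Matrix (Qubits n) α ℂ) (VB : Matrix (Qubits n) β ℂ)
    (ρ : Matrix (α × β) (α × β) ℂ) :
    Matrix (Qubits n × Qubits n) (Qubits n × Qubits n) ℂ :=
  (VA ⊗ₖ VB) * ρ * (VA ⊗ₖ VB)ᴴ

/-! ## Device-independent certification -/

/-- No quantum experiment in the line network with a separable state `ρ^{AB}` (with auxiliary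
states, measurements and dimensions of all systems arbitrary) has the correlations `p`. -/
def NotFromSeparable {n : ℕ} (p : Behaviour n) : Prop :=
  ∀ (C A₀ A B B₀ D : Type)
    [Fintype C] [Fintype A₀] [Fintype A] [Fintype B] [Fintype B₀] [Fintype D]
    [DecidableEq C] [DecidableEq A₀] [DecidableEq A] [DecidableEq B] [DecidableEq B₀]
    [DecidableEq D] (N : LineNetwork n C A₀ A B B₀ D),
    N.IsQuantum → IsSepState N.ρAB → N.behaviour ≠ p

/-- The entanglement of `ρ` can be certified device-independently in the line network: in some
quantum experiment with `ρ^{AB} = ρ`, the correlations cannot be reproduced with any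
separable state. -/
def DICertifiable {α β : Type} [Fintype α] [Fintype β] [DecidableEq α] [DecidableEq β]
    (ρ : Matrix (α × β) (α × β) ℂ) : Prop :=
  ∃ (n : ℕ) (C A₀ B₀ D : Type) (_ : Fintype C) (_ : Fintype A₀) (_ : Fintype B₀) (_ : Fintype D)
    (_ : DecidableEq C) (_ : DecidableEq A₀) (_ : DecidableEq B₀) (_ : DecidableEq D)
    (N : LineNetwork n C A₀ α β B₀ D),
    1 ≤ n ∧ N.IsQuantum ∧ N.ρAB = ρ ∧ NotFromSeparable N.behaviour

end DICert

open DICert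

namespace DICert

/-! ## Matrix preliminaries -/

section Matrices

variable {ι κ μ : Type} [Fintype ι] [Fintype κ] [Fintype μ]

/-! The self-test makes Charlie's and Daisy's devices as good as trusted Pauli measurements on
maximally entangled states. A witness for the state of `AB`, expanded in Pauli projectors, can then
be evaluated by entanglement swapping.

Self-test. `∑ J_i` is a sum of averages of CHSH expressions, so attaining its maximum forces each of
them to attain Tsirelson's bound (`tripleValue_eq_of_sum_eq`). Every term of the sum-of-squares
decomposition `chsh_sum_of_squares` then annihilates the state `ρ`. After Charlie's system is cut
down to the support of its reduced state, an operator on it is determined by its action on `ρ`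
(`Faithful`), and these equations become algebra: his sign observables are involutions that depend
only on the local input, anticommute at one site and commute between sites, and each acts on `ρ`
like an operator of Alice. This leaves one freedom per site: with Z, X, Y for the three observables,
ZXY is `i` times a Hermitian involution, the chirality, whose sign distinguishes the Pauli matrices
from their transposes. In every Bell outcome the signs of ZZ, XX and YY multiply to -1, which
equates the chiralities of the two sites measured (`chirality_eq_of_bell`); the pairs of `◊` and `⧫`
link all sites. So there is one chirality operator, and it commutes with all observables
(`isPauliFamily_of_selfTest`).

Extraction. Let `Q_k` be the projections of the chirality, `P_0` the all-plus outcome of the Z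
measurement and `X^u` the products of X observables. The blocks `W_(k,u) = P_0 X^u Q_k` form an
isometry that intertwines the observables with Pauli matrices (`k = 0`) or their transposes (`k =
1`). The adjoints of the blocks can be moved to operators `R_j` of Alice, and `(W_j ⊗ R_l) ρ`
vanishes for `j ≠ l`, while for `j = l = (k,u)` it does not depend on `u`. This is a maximally
entangled state of the string registers times a junk state with perfectly correlated control qubits
(`selfTestsPauli_of_family`).

Inequality. For a product state of `AB` the outcome `+` of Alice prepares a positive operator `G`
for Charlie's Pauli measurement, the part with `k = 1` being absorbed by a transposition; likewise
`H` for Daisy. Transposition preserves positivity, so `I` is a nonnegative combination of numbers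
`tr[W (G ⊗ H)] ≥ 0` (`LineNetwork.certValue_nonneg`).

Certification. In the reference strategy the projection onto `Φ⁺` turns Charlie's effect into its
compression `d⁻² V† π V` on Alice's system (`nodeEffect_maxEnt`), whence `I = tr[W ρ']/d⁴`. The
product states form a compact set, hence so is its convex hull, and Hahn–Banach gives a witness for
every entangled state (`IsEntangled.exists_isWitnessFor`); the Pauli projectors span all operators,
so the witness has coefficients `ω` (`exists_witnessOp_eq`). -/

open scoped MatrixOrder in
theorem exists_conjTranspose_mul_self {X : Matrix ι ι ℂ} (hX : X.PosSemidef) :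
    ∃ B : Matrix ι ι ℂ, X = Bᴴ * B := by
  classical
  obtain ⟨B, hB⟩ := CStarAlgebra.nonneg_iff_eq_star_mul_self.mp hX.nonneg
  exact ⟨B, hB⟩

theorem trace_mul_nonneg {X ρ : Matrix ι ι ℂ} (hX : X.PosSemidef) (hρ : ρ.PosSemidef) :
    0 ≤ (X * ρ).trace := by
  obtain ⟨B, rfl⟩ := exists_conjTranspose_mul_self hX
  rw [Matrix.mul_assoc, Matrix.trace_mul_comm]
  exact (hρ.mul_mul_conjTranspose_same B).trace_nonneg

/-- For `X = B†B` and `ρ = D†D` the trace is the squared Hilbert–Schmidt norm of `B D†`. This is the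
step by which a saturated bound on an expectation value becomes an operator equation on the state.
-/
theorem mul_eq_zero_of_trace_re_eq_zero {X ρ : Matrix ι ι ℂ} (hX : X.PosSemidef)
    (hρ : ρ.PosSemidef) (h : (X * ρ).trace.re = 0) : X * ρ = 0 := by
  have h0 : (X * ρ).trace = 0 := by
    have := trace_mul_nonneg hX hρ
    rw [Complex.le_def] at this
    exact Complex.ext h this.2.symm
  obtain ⟨B, rfl⟩ := exists_conjTranspose_mul_self hX
  obtain ⟨D, rfl⟩ := exists_conjTranspose_mul_self hρ
  have h1 : (B * Dᴴ)  = 0 := by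
    rw [← Matrix.trace_conjTranspose_mul_self_eq_zero_iff, ← h0]
    rw [Matrix.conjTranspose_mul, Matrix.conjTranspose_conjTranspose, Matrix.trace_mul_comm,
      Matrix.trace_mul_comm (Bᴴ * B)]
    simp only [Matrix.mul_assoc]
    rw [Matrix.trace_mul_comm B]
    simp only [Matrix.mul_assoc]
  rw [Matrix.mul_assoc, ← Matrix.mul_assoc B, h1]
  simp

/-- An effect `P` and its complement satisfy `P (1 - P) ≥ 0`. -/
theorem posSemidef_mul_of_add_eq_one [DecidableEq ι] {P Q : Matrix ι ι ℂ} (hP : P.PosSemidef)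
    (hQ : Q.PosSemidef) (h : P + Q = 1) : (P * Q).PosSemidef := by
  obtain rfl : Q = 1 - P := by rw [← h]; simp
  -- `P(1-P) = P(1-P)P + (1-P)P(1-P)`, a sum of two positive compressions.
  have h1 := hQ.mul_mul_conjTranspose_same P
  have h2 := hP.mul_mul_conjTranspose_same (1 - P)
  rw [hP.1.eq] at h1
  rw [hQ.1.eq] at h2
  convert h1.add h2 using 1
  noncomm_ring

/-- The operator equals `4PQ`. It supplies the bound `S² ≤ 1` for the ±1 observable `S = P - Q` of a
measurement that need not be projective. -/
theorem posSemidef_one_sub_sq [DecidableEq ι] {P Q : Matrix ι ι ℂ} (hP : P.PosSemidef)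
    (hQ : Q.PosSemidef) (h : P + Q = 1) : (1 - (P - Q) * (P - Q)).PosSemidef := by
  have h4 := (posSemidef_mul_of_add_eq_one hP hQ h).smul (show (0 : ℂ) ≤ 4 by norm_num)
  obtain rfl : Q = 1 - P := by rw [← h]; simp
  convert h4 using 1
  have : (4 : ℂ) • (P * (1 - P)) = P * (1 - P) + P * (1 - P) + P * (1 - P) + P * (1 - P) := by
    module
  rw [this]
  noncomm_ring

/-- Positive operators dominated by orthogonal projectors have product zero. -/
theorem mul_eq_zero_of_le [DecidableEq ι] {P Q X Y : Matrix ι ι ℂ}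
    (hX : X.PosSemidef) (hY : Y.PosSemidef) (hP : P.PosSemidef) (hQ : Q.PosSemidef)
    (h : P + Q = 1) (hPQ : P * Q = 0) (hXP : (P - X).PosSemidef) (hYQ : (Q - Y).PosSemidef) :
    X * Y = 0 := by
  have hQP : Q * P = 0 := by
    have := congrArg Matrix.conjTranspose hPQ
    simpa [hP.1.eq, hQ.1.eq] using this
  -- `0 ≤ tr XQ ≤ tr PQ = 0`, and a product of positive operators with zero trace vanishes.
  have key : ∀ {X Q P : Matrix ι ι ℂ}, X.PosSemidef → Q.PosSemidef → (P - X).PosSemidef →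
      P * Q = 0 → X * Q = 0 := by
    intro X Q P hX hQ hXP hPQ
    apply mul_eq_zero_of_trace_re_eq_zero hX hQ
    have h1 := trace_mul_nonneg hX hQ
    have h2 := trace_mul_nonneg hXP hQ
    rw [Matrix.sub_mul, hPQ, zero_sub, Matrix.trace_neg] at h2
    rw [Complex.le_def] at h1 h2
    simp at h1 h2
    linarith [h1.1, h2.1]
  have hXQ := key hX hQ hXP hPQ
  have hYP := key hY hP hYQ hQP
  have hPY : P * Y = 0 := by
    have := congrArg Matrix.conjTranspose hYP
    simpa [hP.1.eq, hY.1.eq] using this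
  calc X * Y = X * (P + Q) * Y := by rw [h, Matrix.mul_one]
    _ = 0 := by rw [Matrix.mul_add, hXQ, add_zero, Matrix.mul_assoc, hPY, Matrix.mul_zero]

theorem kron_mul_kron {l m n l' m' n' : Type} [Fintype m] [Fintype m']
    (A : Matrix l m ℂ) (B : Matrix m n ℂ) (A' : Matrix l' m' ℂ) (B' : Matrix m' n' ℂ) :
    (A ⊗ₖ A') * (B ⊗ₖ B') = (A * B) ⊗ₖ (A' * B') :=
  (Matrix.mul_kronecker_mul A B A' B').symm

theorem sum_kronecker {O l m n p : Type} [Fintype O] (f : O → Matrix l m ℂ) (B : Matrix n p ℂ) :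
    ∑ o, f o ⊗ₖ B = (∑ o, f o) ⊗ₖ B := by
  ext i j
  simp [Matrix.sum_apply, Finset.sum_mul]

theorem kronecker_sum {O l m n p : Type} [Fintype O] (A : Matrix l m ℂ) (f : O → Matrix n p ℂ) :
    ∑ o, A ⊗ₖ f o = A ⊗ₖ (∑ o, f o) := by
  ext i j
  simp [Matrix.sum_apply, Finset.mul_sum]

theorem sub_kronecker {l m n p : Type} (A A' : Matrix l m ℂ) (B : Matrix n p ℂ) :
    (A - A') ⊗ₖ B = A ⊗ₖ B - A' ⊗ₖ B := by
  ext i j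
  simp [sub_mul]

theorem kronecker_sub {l m n p : Type} (A : Matrix l m ℂ) (B B' : Matrix n p ℂ) :
    A ⊗ₖ (B - B') = A ⊗ₖ B - A ⊗ₖ B' := by
  ext i j
  simp [mul_sub]

/-- Two matrices with the same Gram matrix differ by a unitary. -/
theorem exists_unitary_mul_eq {H : Type} [Fintype H] [DecidableEq H] (F G : Matrix H κ ℂ)
    (h : Fᴴ * F = Gᴴ * G) : ∃ U ∈ Matrix.unitaryGroup H ℂ, U * F = G := by
  classical
  let f : EuclideanSpace ℂ κ →ₗ[ℂ] EuclideanSpace ℂ H := Matrix.toEuclideanLin F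
  let g : EuclideanSpace ℂ κ →ₗ[ℂ] EuclideanSpace ℂ H := Matrix.toEuclideanLin G
  have hin : ∀ (K : Matrix H κ ℂ) (x y : EuclideanSpace ℂ κ),
      inner ℂ (Matrix.toEuclideanLin K x) (Matrix.toEuclideanLin K y)
        = inner ℂ x (Matrix.toEuclideanLin (Kᴴ * K) y) := by
    intro K x y
    have : Matrix.toEuclideanLin (Kᴴ * K) y
        = Matrix.toEuclideanLin Kᴴ (Matrix.toEuclideanLin K y) := by
      ext i
      simp [Matrix.toLpLin_apply, Matrix.mulVec_mulVec]
    rw [this, Matrix.toEuclideanLin_conjTranspose_eq_adjoint, LinearMap.adjoint_inner_right]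
  have hfg : ∀ x, ‖f x‖ = ‖g x‖ := by
    intro x
    have h1 := hin F x x
    rw [h, ← hin G x x, inner_self_eq_norm_sq_to_K, inner_self_eq_norm_sq_to_K] at h1
    have h2 : ‖f x‖ ^ 2 = ‖g x‖ ^ 2 := by exact_mod_cast h1
    exact (sq_eq_sq₀ (norm_nonneg _) (norm_nonneg _)).mp h2
  have hker : LinearMap.ker f ≤ LinearMap.ker g := by
    intro x hx
    rw [LinearMap.mem_ker] at hx ⊢
    rw [← norm_eq_zero, ← hfg, hx, norm_zero]
  -- Equal Gram matrices give `‖Fx‖ = ‖Gx‖`, so `Fx ↦ Gx` is a well-defined isometry on the range of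
  -- `F`. It extends to a unitary because both ranges lie in the same finite-dimensional space.
  obtain ⟨l, hl⟩ : ∃ l : LinearMap.range f →ₗ[ℂ] EuclideanSpace ℂ H,
      ∀ x, l ⟨f x, x, rfl⟩ = g x := by
    refine ⟨((LinearMap.ker f).liftQ g hker).comp f.quotKerEquivRange.symm.toLinearMap, ?_⟩
    intro x
    have : f.quotKerEquivRange.symm ⟨f x, x, rfl⟩ = (LinearMap.ker f).mkQ x := by
      rw [LinearEquiv.symm_apply_eq]
      rfl
    simp [this]
  let L : LinearMap.range f →ₗᵢ[ℂ] EuclideanSpace ℂ H :=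
    ⟨l, by
      rintro ⟨_, x, rfl⟩
      rw [hl x, ← hfg]
      rfl⟩
  let U : Matrix H H ℂ := Matrix.toEuclideanLin.symm L.extend.toLinearMap
  have hU : Matrix.toEuclideanLin U = L.extend.toLinearMap := by simp [U]
  refine ⟨U, ?_, ?_⟩
  · rw [Matrix.mem_unitaryGroup_iff']
    apply Matrix.toEuclideanLin.injective
    apply LinearMap.ext
    intro y
    refine ext_inner_left ℂ fun x => ?_
    rw [Matrix.star_eq_conjTranspose]
    have : inner ℂ (Matrix.toEuclideanLin U x) (Matrix.toEuclideanLin U y)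
        = inner ℂ x (Matrix.toEuclideanLin (Uᴴ * U) y) := by
      have : Matrix.toEuclideanLin (Uᴴ * U) y
          = Matrix.toEuclideanLin Uᴴ (Matrix.toEuclideanLin U y) := by
        ext i
        simp [Matrix.toLpLin_apply, Matrix.mulVec_mulVec]
      rw [this, Matrix.toEuclideanLin_conjTranspose_eq_adjoint, LinearMap.adjoint_inner_right]
    rw [← this, hU]
    simp
  · apply Matrix.toEuclideanLin.injective
    apply LinearMap.ext
    intro x
    have h1 : Matrix.toEuclideanLin (U * F) x = Matrix.toEuclideanLin U (f x) := by
      ext i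
      simp [f, Matrix.toLpLin_apply, Matrix.mulVec_mulVec]
    rw [h1, hU]
    have h2 := L.extend_apply ⟨f x, x, rfl⟩
    exact h2.trans (hl x)

/-- A positive semidefinite matrix is supported on the range of an isometry, on which it is
invertible. -/
theorem exists_support_isometry {S : Matrix ι ι ℂ} (hS : S.PosSemidef) :
    ∃ (r : Type) (_ : Fintype r) (_ : DecidableEq r) (J : Matrix ι r ℂ),
      Jᴴ * J = 1 ∧ J * Jᴴ * S = S ∧ IsUnit (Jᴴ * S * J) := by
  classical
  let ev := hS.1.eigenvalues
  let V : Matrix ι ι ℂ := hS.1.eigenvectorUnitary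
  have hVV : Vᴴ * V = 1 := Matrix.mem_unitaryGroup_iff'.mp hS.1.eigenvectorUnitary.2
  have hVV' : V * Vᴴ = 1 := Matrix.mem_unitaryGroup_iff.mp hS.1.eigenvectorUnitary.2
  have hspec : S = V * Matrix.diagonal (fun i => (ev i : ℂ)) * Vᴴ := by
    have := hS.1.spectral_theorem
    rwa [Unitary.conjStarAlgAut_apply] at this
  -- The columns are the eigenvectors with nonzero eigenvalue, so the compression of `S` is diagonal
  -- without zeros.
  let J : Matrix ι {i // ev i ≠ 0} ℂ := V.submatrix id Subtype.val
  have hJV : Jᴴ * V = ((1 : Matrix ι ι ℂ).submatrix Subtype.val id : Matrix {i // ev i ≠ 0} ι ℂ) := by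
    rw [← hVV]
    rfl
  have hJJ : Jᴴ * J = 1 := by
    have : Jᴴ * J = (Vᴴ * V).submatrix Subtype.val Subtype.val := rfl
    rw [this, hVV]
    ext i j
    simp [Matrix.one_apply, Subtype.ext_iff]
  refine ⟨{i // ev i ≠ 0}, inferInstance, inferInstance, J, hJJ, ?_, ?_⟩
  · have h1 : J * ((1 : Matrix ι ι ℂ).submatrix Subtype.val id : Matrix {i // ev i ≠ 0} ι ℂ) *
        Matrix.diagonal (fun i => (ev i : ℂ)) = V * Matrix.diagonal (fun i => (ev i : ℂ)) := by
      ext i j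
      rw [Matrix.mul_diagonal, Matrix.mul_diagonal]
      by_cases hj : ev j = 0
      · simp [hj]
      · congr 1
        rw [Matrix.mul_apply, Finset.sum_eq_single ⟨j, hj⟩]
        · show V i j * (1 : Matrix ι ι ℂ) j j = V i j
          simp
        · rintro ⟨b, hb⟩ - hne
          have : b ≠ j := fun h => hne (Subtype.ext h)
          simp [this]
        · simp
    calc J * Jᴴ * S = J * (Jᴴ * V) * Matrix.diagonal (fun i => (ev i : ℂ)) * Vᴴ := by
          rw [hspec]; simp only [Matrix.mul_assoc]
      _ = S := by rw [hJV, h1, ← hspec]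
  · have h2 : Jᴴ * S * J = Matrix.diagonal (fun i : {i // ev i ≠ 0} => (ev i.1 : ℂ)) := by
      have h3 : Vᴴ * J = ((1 : Matrix ι ι ℂ).submatrix id Subtype.val : Matrix ι {i // ev i ≠ 0} ℂ) := by
        rw [← hVV]; rfl
      calc Jᴴ * S * J = (Jᴴ * V) * Matrix.diagonal (fun i => (ev i : ℂ)) * (Vᴴ * J) := by
            rw [hspec]; simp only [Matrix.mul_assoc]
        _ = _ := by
            rw [hJV, h3]
            ext i j
            by_cases h : i = j
            · simp [Matrix.mul_apply, Matrix.one_apply, Matrix.diagonal_apply, h]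
            · simp [Matrix.mul_apply, Matrix.one_apply, Matrix.diagonal_apply, h,
                mt Subtype.ext h]
    rw [h2, Matrix.isUnit_iff_isUnit_det, Matrix.det_diagonal, isUnit_iff_ne_zero,
      Finset.prod_ne_zero_iff]
    intro i _
    exact_mod_cast i.2

/-- The contraction `tr₂[G (1 ⊗ σ)]`. -/
def partialContract (G : Matrix (ι × κ) (ι × κ) ℂ) (σ : Matrix κ κ ℂ) : Matrix ι ι ℂ :=
  Matrix.of fun i j => ∑ k, ∑ l, G (i, k) (j, l) * σ l k

/-- The contraction serves in two ways: with `Y = 1` it gives reduced states, and with `Y` a state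
of the second system it gives the effect that remains on the first. -/
theorem trace_kronecker_mul (X : Matrix ι ι ℂ) (Y : Matrix κ κ ℂ)
    (G : Matrix (ι × κ) (ι × κ) ℂ) :
    ((X ⊗ₖ Y) * G).trace = (X * partialContract G Y).trace := by
  simp only [Matrix.trace, Matrix.diag, Matrix.mul_apply, Fintype.sum_prod_type,
    Matrix.kroneckerMap_apply, partialContract, Matrix.of_apply, Finset.mul_sum]
  refine Finset.sum_congr rfl fun i _ => ?_
  rw [Finset.sum_comm]
  refine Finset.sum_congr rfl fun j _ => ?_
  rw [Finset.sum_comm]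
  exact Finset.sum_congr rfl fun k _ => Finset.sum_congr rfl fun l _ => by ring

/-- For `σ = B†B` the contraction is `∑_m K_m† G K_m`, where `K_m` adjoins the conjugate of the
`m`-th row of `B` as a vector of the second system. -/
theorem partialContract_posSemidef {G : Matrix (ι × κ) (ι × κ) ℂ} {σ : Matrix κ κ ℂ}
    (hG : G.PosSemidef) (hσ : σ.PosSemidef) : (partialContract G σ).PosSemidef := by
  classical
  obtain ⟨B, rfl⟩ := exists_conjTranspose_mul_self hσ
  have : partialContract G (Bᴴ * B) = ∑ m : κ,
      (Matrix.of fun (p : ι × κ) (j : ι) => if p.1 = j then star (B m p.2) else 0)ᴴ * G *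
        (Matrix.of fun (p : ι × κ) (j : ι) => if p.1 = j then star (B m p.2) else 0) := by
    ext i j
    simp only [partialContract, Matrix.of_apply, Matrix.sum_apply, Matrix.mul_apply,
      Matrix.conjTranspose_apply, Fintype.sum_prod_type, Finset.mul_sum, Finset.sum_mul]
    rw [Finset.sum_comm' (t' := Finset.univ) (s' := fun _ => Finset.univ) (by simp)]
    rw [Finset.sum_comm]
    simp only [apply_ite star, star_star, star_zero, ite_mul, mul_ite, zero_mul, mul_zero]
    simp only [Finset.sum_ite_irrel, Finset.sum_const_zero, Finset.sum_ite_eq',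
      Finset.mem_univ, if_true]
    have e : ∀ k l m, G (i, k) (j, l) * (star (B m l) * B m k) =
        B m k * G (i, k) (j, l) * star (B m l) := fun k l m => by ring
    simp only [e]
    calc _ = ∑ m, ∑ k, ∑ l, B m k * G (i, k) (j, l) * star (B m l) := by
          rw [Finset.sum_comm]
          rw [Finset.sum_congr rfl fun k _ => Finset.sum_comm]
          rw [Finset.sum_comm]
          exact Finset.sum_congr rfl fun m _ => Finset.sum_comm
      _ = _ := Finset.sum_congr rfl fun m _ => by rw [Finset.sum_comm]
  rw [this]
  exact Matrix.posSemidef_sum _ fun m _ => hG.conjTranspose_mul_mul_same _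

omit [Fintype ι] in
theorem partialContract_sum {O : Type} [Fintype O] (G : O → Matrix (ι × κ) (ι × κ) ℂ)
    (σ : Matrix κ κ ℂ) : ∑ o, partialContract (G o) σ = partialContract (∑ o, G o) σ := by
  ext i j
  simp only [partialContract, Matrix.sum_apply, Matrix.of_apply, Finset.sum_mul]
  rw [Finset.sum_comm]
  exact Finset.sum_congr rfl fun k _ => Finset.sum_comm

omit [Fintype ι] in
theorem partialContract_one [DecidableEq ι] [DecidableEq κ] (σ : Matrix κ κ ℂ) :
    partialContract (1 : Matrix (ι × κ) (ι × κ) ℂ) σ = σ.trace • (1 : Matrix ι ι ℂ) := by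
  ext i j
  by_cases h : i = j <;>
    simp [partialContract, Matrix.one_apply, Prod.ext_iff, h, Matrix.trace]

end Matrices

end DICert

namespace DICert

/-! ## The CHSH inequality and its maximal violation -/

section CHSH

variable {C A : Type} [Fintype C] [Fintype A] [DecidableEq C] [DecidableEq A]

theorem invSqrtTwo_mul_self : ((√2 : ℝ) : ℂ)⁻¹ * ((√2 : ℝ) : ℂ)⁻¹ = 1 / 2 := by
  rw [← mul_inv, ← Complex.ofReal_mul, Real.mul_self_sqrt (by norm_num)]
  norm_num

/-- The sum-of-squares decomposition of the CHSH operator. -/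
theorem chsh_sum_of_squares {ι : Type} [Fintype ι] [DecidableEq ι] (c₀ c₁ a₀ a₁ : Matrix ι ι ℂ)
    (h₀₀ : Commute c₀ a₀) (h₀₁ : Commute c₀ a₁) (h₁₀ : Commute c₁ a₀) (h₁₁ : Commute c₁ a₁)
    (s : ℂ) (hs : s * s = 1 / 2) :
    (c₀ - s • (a₀ + a₁)) * (c₀ - s • (a₀ + a₁)) + (c₁ - s • (a₀ - a₁)) * (c₁ - s • (a₀ - a₁)) +
      (1 - c₀ * c₀) + (1 - c₁ * c₁) + (1 - a₀ * a₀) + (1 - a₁ * a₁) =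
    (4 : ℂ) • 1 - (2 * s) • (c₀ * (a₀ + a₁) + c₁ * (a₀ - a₁)) := by
  have e₀ := h₀₀.eq
  have e₁ := h₀₁.eq
  have e₂ := h₁₀.eq
  have e₃ := h₁₁.eq
  simp only [mul_sub, sub_mul, mul_add, add_mul, smul_mul_assoc, mul_smul_comm, smul_smul,
    smul_add, smul_sub, hs]
  rw [← e₀, ← e₁, ← e₂, ← e₃]
  module

theorem kron_one_commute (X : Matrix C C ℂ) (Y : Matrix A A ℂ) :
    Commute (X ⊗ₖ (1 : Matrix A A ℂ)) ((1 : Matrix C C ℂ) ⊗ₖ Y) := by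
  rw [commute_iff_eq, kron_mul_kron, kron_mul_kron]
  simp

theorem kron_one_mul_one_kron (X : Matrix C C ℂ) (Y : Matrix A A ℂ) :
    (X ⊗ₖ (1 : Matrix A A ℂ)) * ((1 : Matrix C C ℂ) ⊗ₖ Y) = X ⊗ₖ Y := by
  rw [kron_mul_kron]; simp

theorem one_kron_mul_kron_one (X : Matrix C C ℂ) (Y : Matrix A A ℂ) :
    ((1 : Matrix C C ℂ) ⊗ₖ Y) * (X ⊗ₖ (1 : Matrix A A ℂ)) = X ⊗ₖ Y := by
  rw [kron_mul_kron]; simp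

omit [DecidableEq C] in
theorem kron_one_mul_kron_one (X X' : Matrix C C ℂ) :
    (X ⊗ₖ (1 : Matrix A A ℂ)) * (X' ⊗ₖ (1 : Matrix A A ℂ)) = (X * X') ⊗ₖ 1 := by
  rw [kron_mul_kron]; simp

omit [DecidableEq A] in
theorem one_kron_mul_one_kron (Y Y' : Matrix A A ℂ) :
    ((1 : Matrix C C ℂ) ⊗ₖ Y) * ((1 : Matrix C C ℂ) ⊗ₖ Y') = 1 ⊗ₖ (Y * Y') := by
  rw [kron_mul_kron]; simp

/-- The CHSH expression of the observables `C₀, C₁` and `A₀, A₁`. -/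
noncomputable def chshValue (ρ : Matrix (C × A) (C × A) ℂ) (C₀ C₁ : Matrix C C ℂ)
    (A₀ A₁ : Matrix A A ℂ) : ℝ :=
  ((C₀ ⊗ₖ (A₀ + A₁) + C₁ ⊗ₖ (A₀ - A₁)) * ρ).trace.re

/-- Taking expectations in the sum-of-squares identity gives `4 - √2 · value` as a sum of six
nonnegative numbers, since `2s = √2`. If the bound is attained, all six vanish, and by positivity
each of the six operators annihilates `ρ`. The observables are only assumed to satisfy `S² ≤ 1`;
that they square to one on `ρ` is part of the conclusion. -/
theorem chsh_bound_and_rigidity {ρ : Matrix (C × A) (C × A) ℂ} (hρ : IsState ρ)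
    {C₀ C₁ : Matrix C C ℂ} {A₀ A₁ : Matrix A A ℂ}
    (hC₀ : C₀.IsHermitian) (hC₁ : C₁.IsHermitian) (hA₀ : A₀.IsHermitian) (hA₁ : A₁.IsHermitian)
    (sC₀ : (1 - C₀ * C₀).PosSemidef) (sC₁ : (1 - C₁ * C₁).PosSemidef)
    (sA₀ : (1 - A₀ * A₀).PosSemidef) (sA₁ : (1 - A₁ * A₁).PosSemidef) :
    chshValue ρ C₀ C₁ A₀ A₁ ≤ 2 * √2 ∧ (chshValue ρ C₀ C₁ A₀ A₁ = 2 * √2 →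
      ((C₀ * C₀) ⊗ₖ (1 : Matrix A A ℂ)) * ρ = ρ ∧ ((C₁ * C₁) ⊗ₖ (1 : Matrix A A ℂ)) * ρ = ρ ∧
      ((1 : Matrix C C ℂ) ⊗ₖ (A₀ * A₀)) * ρ = ρ ∧ ((1 : Matrix C C ℂ) ⊗ₖ (A₁ * A₁)) * ρ = ρ ∧
      (C₀ ⊗ₖ (1 : Matrix A A ℂ)) * ρ =
        ((1 : Matrix C C ℂ) ⊗ₖ (((√2 : ℝ) : ℂ)⁻¹ • (A₀ + A₁))) * ρ ∧
      (C₁ ⊗ₖ (1 : Matrix A A ℂ)) * ρ =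
        ((1 : Matrix C C ℂ) ⊗ₖ (((√2 : ℝ) : ℂ)⁻¹ • (A₀ - A₁))) * ρ) := by
  set s : ℂ := ((√2 : ℝ) : ℂ)⁻¹ with hs
  have hss : star s = s := by simp [hs]
  have sos := chsh_sum_of_squares (C₀ ⊗ₖ (1 : Matrix A A ℂ)) (C₁ ⊗ₖ (1 : Matrix A A ℂ))
    ((1 : Matrix C C ℂ) ⊗ₖ A₀) ((1 : Matrix C C ℂ) ⊗ₖ A₁) (kron_one_commute _ _)
    (kron_one_commute _ _) (kron_one_commute _ _) (kron_one_commute _ _) s invSqrtTwo_mul_self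
  have hD : ∀ X : Matrix C C ℂ, ∀ Y : Matrix A A ℂ, X.IsHermitian → Y.IsHermitian →
      (X ⊗ₖ (1 : Matrix A A ℂ) - s • ((1 : Matrix C C ℂ) ⊗ₖ Y)).IsHermitian := by
    intro X Y hX hY
    refine Matrix.IsHermitian.sub ?_ ?_
    · rw [Matrix.IsHermitian, Matrix.conjTranspose_kronecker, hX.eq, Matrix.conjTranspose_one]
    · rw [Matrix.IsHermitian, Matrix.conjTranspose_smul, Matrix.conjTranspose_kronecker, hY.eq,
        Matrix.conjTranspose_one, hss]
  have hsq : ∀ D : Matrix (C × A) (C × A) ℂ, D.IsHermitian → (D * D).PosSemidef := by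
    intro D h
    conv => arg 1; arg 1; rw [← h.eq]
    exact Matrix.posSemidef_conjTranspose_mul_self D
  have k₁ : ∀ X : Matrix C C ℂ, (1 - X * X).PosSemidef →
      (1 - (X ⊗ₖ (1 : Matrix A A ℂ)) * (X ⊗ₖ (1 : Matrix A A ℂ))).PosSemidef := by
    intro X hX
    have := hX.kronecker (Matrix.PosSemidef.one (n := A) (R := ℂ))
    rwa [sub_kronecker, Matrix.one_kronecker_one, ← kron_one_mul_kron_one] at this
  have k₂ : ∀ Y : Matrix A A ℂ, (1 - Y * Y).PosSemidef →
      (1 - ((1 : Matrix C C ℂ) ⊗ₖ Y) * ((1 : Matrix C C ℂ) ⊗ₖ Y)).PosSemidef := by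
    intro X hX
    have := (Matrix.PosSemidef.one (n := C) (R := ℂ)).kronecker hX
    rwa [kronecker_sub, Matrix.one_kronecker_one, ← one_kron_mul_one_kron] at this
  rw [← Matrix.kronecker_add, ← kronecker_sub, kron_one_mul_one_kron, kron_one_mul_one_kron] at sos
  have p₁ := hsq _ (hD C₀ (A₀ + A₁) hC₀ (hA₀.add hA₁))
  have p₂ := hsq _ (hD C₁ (A₀ - A₁) hC₁ (hA₀.sub hA₁))
  have p₃ := k₁ C₀ sC₀
  have p₄ := k₁ C₁ sC₁
  have p₅ := k₂ A₀ sA₀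
  have p₆ := k₂ A₁ sA₁
  have tr := congrArg (fun X => (X * ρ).trace.re) sos
  simp only [Matrix.add_mul _ _ ρ, Matrix.trace_add, Complex.add_re] at tr
  have hrhs : ∀ X : Matrix (C × A) (C × A) ℂ, (((4 : ℂ) • 1 - (2 * s) • X) * ρ).trace =
      4 • 1 - (2 * s) • (X * ρ).trace := by
    intro X
    rw [Matrix.sub_mul, Matrix.smul_mul, Matrix.smul_mul, Matrix.one_mul, Matrix.trace_sub,
      Matrix.trace_smul, Matrix.trace_smul, hρ.2]
    simp
  rw [hrhs] at tr
  have hs2 : (2 * s) = ((2 * (√2)⁻¹ : ℝ) : ℂ) := by simp [hs]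
  rw [hs2, smul_eq_mul, nsmul_eq_mul, Complex.sub_re, Complex.re_ofReal_mul, mul_one] at tr
  have hval : ((C₀ ⊗ₖ (A₀ + A₁) + C₁ ⊗ₖ (A₀ - A₁)) * ρ).trace.re = chshValue ρ C₀ C₁ A₀ A₁ := rfl
  rw [hval] at tr
  have nn : ∀ {X : Matrix (C × A) (C × A) ℂ}, X.PosSemidef → 0 ≤ (X * ρ).trace.re := fun hX =>
    (Complex.le_def.mp (trace_mul_nonneg hX hρ.1)).1
  have n₁ := nn p₁
  have n₂ := nn p₂
  have n₃ := nn p₃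
  have n₄ := nn p₄
  have n₅ := nn p₅
  have n₆ := nn p₆
  have h4 : ((4 : ℕ) : ℂ).re = 4 := rfl
  rw [h4] at tr
  have hr : √2 * (√2)⁻¹ = 1 := mul_inv_cancel₀ (by positivity)
  have hr2 : √2 * √2 = 2 := Real.mul_self_sqrt (by norm_num)
  have hrp : 0 < √2 := by positivity
  have hmul : √2 * (2 * (√2)⁻¹ * chshValue ρ C₀ C₁ A₀ A₁) = 2 * chshValue ρ C₀ C₁ A₀ A₁ := by
    linear_combination (2 * chshValue ρ C₀ C₁ A₀ A₁) * hr
  refine ⟨?_, fun heq => ?_⟩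
  · have h5 : 2 * (√2)⁻¹ * chshValue ρ C₀ C₁ A₀ A₁ ≤ 4 := by linarith
    have := mul_le_mul_of_nonneg_left h5 hrp.le
    linarith
  · have h5 : 2 * (√2)⁻¹ * chshValue ρ C₀ C₁ A₀ A₁ = 4 := by
      rw [heq]; linear_combination 4 * hr
    rw [h5, sub_self] at tr
    have fin : ∀ X : Matrix (C × A) (C × A) ℂ, (1 - X) * ρ = 0 → X * ρ = ρ := by
      intro X h
      rw [Matrix.sub_mul, Matrix.one_mul, sub_eq_zero] at h
      exact h.symm
    have fin' : ∀ X : Matrix C C ℂ, ∀ Y : Matrix A A ℂ, X.IsHermitian → Y.IsHermitian →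
        (X ⊗ₖ (1 : Matrix A A ℂ) - s • ((1 : Matrix C C ℂ) ⊗ₖ Y)) *
          (X ⊗ₖ (1 : Matrix A A ℂ) - s • ((1 : Matrix C C ℂ) ⊗ₖ Y)) * ρ = 0 →
        (X ⊗ₖ (1 : Matrix A A ℂ)) * ρ = ((1 : Matrix C C ℂ) ⊗ₖ (s • Y)) * ρ := by
      intro X Y hX hY h
      have hD' := hD X Y hX hY
      set D := X ⊗ₖ (1 : Matrix A A ℂ) - s • ((1 : Matrix C C ℂ) ⊗ₖ Y) with hDdef
      have h0 : D * ρ = 0 := by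
        rw [← Matrix.conjTranspose_mul_self_mul_eq_zero, hD'.eq]
        exact h
      rw [hDdef, Matrix.sub_mul, sub_eq_zero] at h0
      rw [h0, Matrix.kronecker_smul]
    refine ⟨?_, ?_, ?_, ?_, ?_, ?_⟩
    · rw [← kron_one_mul_kron_one]
      exact fin _ (mul_eq_zero_of_trace_re_eq_zero p₃ hρ.1 (by linarith))
    · rw [← kron_one_mul_kron_one]
      exact fin _ (mul_eq_zero_of_trace_re_eq_zero p₄ hρ.1 (by linarith))
    · rw [← one_kron_mul_one_kron]
      exact fin _ (mul_eq_zero_of_trace_re_eq_zero p₅ hρ.1 (by linarith))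
    · rw [← one_kron_mul_one_kron]
      exact fin _ (mul_eq_zero_of_trace_re_eq_zero p₆ hρ.1 (by linarith))
    · exact fin' _ _ hC₀ (hA₀.add hA₁) (mul_eq_zero_of_trace_re_eq_zero p₁ hρ.1 (by linarith))
    · exact fin' _ _ hC₁ (hA₀.sub hA₁) (mul_eq_zero_of_trace_re_eq_zero p₂ hρ.1 (by linarith))

/-- No operator on the first system annihilates `ρ`, that is, the reduced state is invertible. -/
def Faithful (ρ : Matrix (C × A) (C × A) ℂ) : Prop :=
  ∀ X : Matrix C C ℂ, (X ⊗ₖ (1 : Matrix A A ℂ)) * ρ = 0 → X = 0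

omit [DecidableEq C] in
theorem Faithful.eq_of_mul_eq {ρ : Matrix (C × A) (C × A) ℂ} (h : Faithful ρ) {X Y : Matrix C C ℂ}
    (e : (X ⊗ₖ (1 : Matrix A A ℂ)) * ρ = (Y ⊗ₖ (1 : Matrix A A ℂ)) * ρ) : X = Y := by
  rw [← sub_eq_zero]
  apply h
  rw [sub_kronecker, Matrix.sub_mul, e, sub_self]

/-- For a faithful state, the two observables of a maximal CHSH violation are anticommuting
involutions. -/
theorem chsh_rigidity_of_faithful {ρ : Matrix (C × A) (C × A) ℂ} (hρ : IsState ρ)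
    (hf : Faithful ρ) {C₀ C₁ : Matrix C C ℂ} {A₀ A₁ : Matrix A A ℂ}
    (hC₀ : C₀.IsHermitian) (hC₁ : C₁.IsHermitian) (hA₀ : A₀.IsHermitian) (hA₁ : A₁.IsHermitian)
    (sC₀ : (1 - C₀ * C₀).PosSemidef) (sC₁ : (1 - C₁ * C₁).PosSemidef)
    (sA₀ : (1 - A₀ * A₀).PosSemidef) (sA₁ : (1 - A₁ * A₁).PosSemidef)
    (heq : chshValue ρ C₀ C₁ A₀ A₁ = 2 * √2) :
    C₀ * C₀ = 1 ∧ C₁ * C₁ = 1 ∧ C₀ * C₁ = - (C₁ * C₀) ∧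
      (C₀ ⊗ₖ (1 : Matrix A A ℂ)) * ρ =
        ((1 : Matrix C C ℂ) ⊗ₖ (((√2 : ℝ) : ℂ)⁻¹ • (A₀ + A₁))) * ρ ∧
      (C₁ ⊗ₖ (1 : Matrix A A ℂ)) * ρ =
        ((1 : Matrix C C ℂ) ⊗ₖ (((√2 : ℝ) : ℂ)⁻¹ • (A₀ - A₁))) * ρ := by
  obtain ⟨h₁, h₂, h₃, h₄, h₅, h₆⟩ :=
    (chsh_bound_and_rigidity hρ hC₀ hC₁ hA₀ hA₁ sC₀ sC₁ sA₀ sA₁).2 heq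
  refine ⟨?_, ?_, ?_, h₅, h₆⟩
  · apply hf.eq_of_mul_eq
    rw [h₁, Matrix.one_kronecker_one, Matrix.one_mul]
  · apply hf.eq_of_mul_eq
    rw [h₂, Matrix.one_kronecker_one, Matrix.one_mul]
  · rw [eq_neg_iff_add_eq_zero]
    apply hf
    set s : ℂ := ((√2 : ℝ) : ℂ)⁻¹ with hs
    -- Moving a product to the other system reverses the order of its factors.
    have e : ∀ (X X' : Matrix C C ℂ) (Y Y' : Matrix A A ℂ),
        (X ⊗ₖ (1 : Matrix A A ℂ)) * ρ = ((1 : Matrix C C ℂ) ⊗ₖ Y) * ρ →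
        (X' ⊗ₖ (1 : Matrix A A ℂ)) * ρ = ((1 : Matrix C C ℂ) ⊗ₖ Y') * ρ →
        ((X * X') ⊗ₖ (1 : Matrix A A ℂ)) * ρ = ((1 : Matrix C C ℂ) ⊗ₖ (Y' * Y)) * ρ := by
      intro X X' Y Y' hX hX'
      rw [← kron_one_mul_kron_one, Matrix.mul_assoc, hX', ← Matrix.mul_assoc,
        (kron_one_commute X Y').eq, Matrix.mul_assoc, hX, ← Matrix.mul_assoc,
        one_kron_mul_one_kron]
    rw [Matrix.add_kronecker, Matrix.add_mul, e _ _ _ _ h₅ h₆, e _ _ _ _ h₆ h₅, ← Matrix.add_mul,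
      ← Matrix.kronecker_add]
    -- The anticommutator of `C₀` and `C₁` is moved to `A₀² - A₁²`, and both squares act on `ρ` as
    -- the identity.
    have : s • (A₀ - A₁) * s • (A₀ + A₁) + s • (A₀ + A₁) * s • (A₀ - A₁) =
        A₀ * A₀ - A₁ * A₁ := by
      have hss : s * s = 1 / 2 := invSqrtTwo_mul_self
      simp only [smul_mul_assoc, mul_smul_comm, smul_smul, smul_add, smul_sub, hss, mul_sub, sub_mul, mul_add,
        add_mul]
      module
    rw [this, kronecker_sub, Matrix.sub_mul, h₃, h₄, sub_self]

end CHSH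

end DICert

namespace DICert

/-! ## Measurements with outcomes in the sign cube -/

section SignMeasurements

variable {n : ℕ} {C A : Type} [Fintype C] [Fintype A] [DecidableEq C] [DecidableEq A]

theorem IsPOVM.sum_posSemidef {ι O : Type} [Fintype ι] [DecidableEq ι] [Fintype O]
    {M : O → Matrix ι ι ℂ} (hM : IsPOVM M) (s : Finset O) : (∑ a ∈ s, M a).PosSemidef :=
  Matrix.posSemidef_sum _ fun a _ => hM.1 a

/-- The operator `∑ f(c) M_c`. -/
def signSum (M : Signs n → Matrix C C ℂ) (f : Signs n → ℂ) : Matrix C C ℂ := ∑ c, f c • M c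

/-- The observable of the `i`-th sign. -/
def signObs (M : Signs n → Matrix C C ℂ) (i : Fin n) : Matrix C C ℂ :=
  signSum M fun c => ((c i : ℤ) : ℂ)

theorem filter_ne_one_eq (i : Fin n) :
    (Finset.univ.filter fun c : Signs n => ¬ c i = 1) = Finset.univ.filter fun c => c i = -1 := by
  ext c
  simp only [Finset.mem_filter, Finset.mem_univ, true_and]
  rcases Int.units_eq_one_or (c i) with h | h <;> simp [h]

theorem sum_sign_add (M : Signs n → Matrix C C ℂ) (hM : IsPOVM M) (i : Fin n) :
    (∑ c : Signs n with c i = 1, M c) + (∑ c : Signs n with c i = -1, M c) = 1 := by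
  rw [← hM.2, ← Finset.sum_filter_add_sum_filter_not Finset.univ (fun c : Signs n => c i = 1),
    filter_ne_one_eq]

omit [Fintype C] [DecidableEq C] in
theorem signObs_eq_sub (M : Signs n → Matrix C C ℂ) (i : Fin n) :
    signObs M i = (∑ c : Signs n with c i = 1, M c) - ∑ c : Signs n with c i = -1, M c := by
  rw [signObs, signSum,
    ← Finset.sum_filter_add_sum_filter_not Finset.univ (fun c : Signs n => c i = 1),
    filter_ne_one_eq, sub_eq_add_neg, ← Finset.sum_neg_distrib]
  congr 1
  · refine Finset.sum_congr rfl fun c hc => ?_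
    rw [(Finset.mem_filter.mp hc).2]; simp
  · refine Finset.sum_congr rfl fun c hc => ?_
    rw [(Finset.mem_filter.mp hc).2]; simp

theorem signObs_isHermitian {M : Signs n → Matrix C C ℂ} (hM : IsPOVM M) (i : Fin n) :
    (signObs M i).IsHermitian := by
  rw [signObs_eq_sub]
  exact (hM.sum_posSemidef _).1.sub (hM.sum_posSemidef _).1

theorem signObs_sq_le {M : Signs n → Matrix C C ℂ} (hM : IsPOVM M) (i : Fin n) :
    (1 - signObs M i * signObs M i).PosSemidef := by
  rw [signObs_eq_sub]
  exact posSemidef_one_sub_sq (hM.sum_posSemidef _) (hM.sum_posSemidef _) (sum_sign_add M hM i)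

/-- If all the sign observables are involutions, the measurement is projective. -/
theorem mul_eq_of_signObs_sq {M : Signs n → Matrix C C ℂ} (hM : IsPOVM M)
    (h : ∀ i, signObs M i * signObs M i = 1) (c c' : Signs n) :
    M c * M c' = if c = c' then M c else 0 := by
  have hne : ∀ c c', c ≠ c' → M c * M c' = 0 := by
    intro c c' hcc
    -- At a position where the strings differ, the two operators lie below `P` and `Q`, the effects
    -- of the two values of that sign. These are orthogonal, since `4PQ = 1 - (P - Q)² = 0`.
    obtain ⟨i, hi⟩ := Function.ne_iff.mp hcc
    set P := ∑ c : Signs n with c i = 1, M c with hP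
    set Q := ∑ c : Signs n with c i = -1, M c with hQ
    have hPp : P.PosSemidef := hM.sum_posSemidef _
    have hQp : Q.PosSemidef := hM.sum_posSemidef _
    have hPQ : P + Q = 1 := sum_sign_add M hM i
    have hz : P * Q = 0 := by
      have h1 := h i
      rw [signObs_eq_sub, ← hP, ← hQ] at h1
      obtain hq : Q = 1 - P := by rw [← hPQ]; simp
      rw [hq] at h1 ⊢
      have h2 : (4 : ℂ) • (P * (1 - P)) = 1 - (P - (1 - P)) * (P - (1 - P)) := by
        have : (4 : ℂ) • (P * (1 - P)) = P * (1 - P) + P * (1 - P) + P * (1 - P) + P * (1 - P) := by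
          module
        rw [this]; noncomm_ring
      rw [h1, sub_self] at h2
      exact (smul_eq_zero.mp h2).resolve_left (by norm_num)
    have hz' : Q * P = 0 := by
      have := congrArg Matrix.conjTranspose hz
      simpa [hPp.1.eq, hQp.1.eq] using this
    have dom : ∀ (u : ℤˣ) (d : Signs n), d i = u →
        ((∑ c : Signs n with c i = u, M c) - M d).PosSemidef := by
      intro u d hd
      rw [← Finset.sum_erase_add _ _ (show d ∈ Finset.univ.filter fun c : Signs n => c i = u by
        simp [hd]), add_sub_cancel_right]
      exact hM.sum_posSemidef _
    rcases Int.units_eq_one_or (c i) with h1 | h1 <;>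
      rcases Int.units_eq_one_or (c' i) with h2 | h2
    · exact absurd (h1.trans h2.symm) hi
    · exact mul_eq_zero_of_le (hM.1 c) (hM.1 c') hPp hQp hPQ hz (dom 1 c h1) (dom (-1) c' h2)
    · exact mul_eq_zero_of_le (hM.1 c) (hM.1 c') hQp hPp ((add_comm _ _).trans hPQ) hz'
        (dom (-1) c h1) (dom 1 c' h2)
    · exact absurd (h1.trans h2.symm) hi
  split_ifs with hcc
  · subst hcc
    have : M c * ∑ c', M c' = M c := by rw [hM.2, Matrix.mul_one]
    rw [Finset.mul_sum, Finset.sum_eq_single c (fun b _ hb => hne c b hb.symm) (by simp)] at this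
    exact this
  · exact hne c c' hcc

/-- Orthogonality of the operators of a projective measurement. -/
def IsOrthogonal (M : Signs n → Matrix C C ℂ) : Prop :=
  ∀ c c', M c * M c' = if c = c' then M c else 0

omit [DecidableEq C] in
theorem IsOrthogonal.signSum_mul {M : Signs n → Matrix C C ℂ} (hM : IsOrthogonal M)
    (f g : Signs n → ℂ) : signSum M f * signSum M g = signSum M (f * g) := by
  simp only [signSum, Finset.sum_mul, Finset.mul_sum, smul_mul_assoc, mul_smul_comm, hM _ _,
    smul_ite, smul_zero, Finset.sum_ite_eq', Finset.mem_univ, if_true,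
    smul_smul, Pi.mul_apply]
  exact Finset.sum_congr rfl fun c _ => by rw [mul_comm]

omit [DecidableEq C] in
theorem IsOrthogonal.signSum_mul_apply {M : Signs n → Matrix C C ℂ} (hM : IsOrthogonal M)
    (f : Signs n → ℂ) (c : Signs n) : signSum M f * M c = f c • M c := by
  simp [signSum, Finset.sum_mul, hM _ _]

omit [DecidableEq C] in
theorem IsOrthogonal.apply_mul_signSum {M : Signs n → Matrix C C ℂ} (hM : IsOrthogonal M)
    (f : Signs n → ℂ) (c : Signs n) : M c * signSum M f = f c • M c := by
  simp [signSum, Finset.mul_sum, hM _ _]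

omit [DecidableEq C] in
theorem IsOrthogonal.signSum_commute {M : Signs n → Matrix C C ℂ} (hM : IsOrthogonal M)
    (f g : Signs n → ℂ) : Commute (signSum M f) (signSum M g) := by
  rw [commute_iff_eq, hM.signSum_mul, hM.signSum_mul, mul_comm]

omit [Fintype C] [DecidableEq C] in
theorem signSum_single (M : Signs n → Matrix C C ℂ) (c : Signs n) :
    signSum M (fun d => if d = c then 1 else 0) = M c := by
  simp [signSum]

/-- Sums over the inputs with a prescribed entry. -/
theorem sum_update {K : Type} [Fintype K] [DecidableEq K] (i : Fin n) (t : K)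
    (f : (Fin n → K) → ℝ) :
    ∑ z : Fin n → K, f (Function.update z i t) =
      Fintype.card K * ∑ z : Fin n → K with z i = t, f z := by
  rw [← Finset.sum_fiberwise Finset.univ (fun z : Fin n → K => z i)]
  have : ∀ s : K, ∑ z : Fin n → K with z i = s, f (Function.update z i t) =
      ∑ z : Fin n → K with z i = t, f z := by
    intro s
    refine Finset.sum_nbij' (fun z => Function.update z i t) (fun z => Function.update z i s)
      ?_ ?_ ?_ ?_ ?_
    · intro z _; simp
    · intro z _; simp
    · intro z hz
      simp only [Finset.mem_filter, Finset.mem_univ, true_and] at hz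
      simp [← hz]
    · intro z hz
      simp only [Finset.mem_filter, Finset.mem_univ, true_and] at hz
      simp [← hz]
    · intro z _; rfl
  rw [Finset.sum_congr rfl fun s _ => this s]
  simp

/-- The correlations of measurements on a bipartite state. -/
noncomputable def pairBehaviour (ρ : Matrix (C × A) (C × A) ℂ)
    (M : PauliInput n → Signs n → Matrix C C ℂ)
    (N : (x : NodeInput n) → NodeOutput n x → Matrix A A ℂ) : PairBehaviour n :=
  fun z x c a => ((M z c ⊗ₖ N x a) * ρ).trace.re

omit [DecidableEq C] [DecidableEq A] in
theorem sum_sum_trace {O O' : Type} [Fintype O] [Fintype O'] (ρ : Matrix (C × A) (C × A) ℂ)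
    (M : O → Matrix C C ℂ) (N : O' → Matrix A A ℂ) (f : O → ℝ) (g : O' → ℝ) :
    ∑ c, ∑ a, f c * g a * ((M c ⊗ₖ N a) * ρ).trace.re =
      (((∑ c, (f c : ℂ) • M c) ⊗ₖ (∑ a, (g a : ℂ) • N a)) * ρ).trace.re := by
  rw [← sum_kronecker, Finset.sum_mul, Matrix.trace_sum, Complex.re_sum]
  refine Finset.sum_congr rfl fun c _ => ?_
  rw [← kronecker_sum, Finset.sum_mul, Matrix.trace_sum, Complex.re_sum]
  refine Finset.sum_congr rfl fun a _ => ?_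
  rw [Matrix.smul_kronecker, Matrix.kronecker_smul, smul_smul, Matrix.smul_mul,
    Matrix.trace_smul, smul_eq_mul, ← Complex.ofReal_mul, Complex.re_ofReal_mul]

omit [DecidableEq C] [DecidableEq A] in
theorem sum_sign_trace (ρ : Matrix (C × A) (C × A) ℂ) (M : Signs n → Matrix C C ℂ)
    (N : Signs n → Matrix A A ℂ) (i : Fin n) :
    ∑ c : Signs n, ∑ a : Signs n, (((c i * a i : ℤˣ) : ℤ) : ℝ) * ((M c ⊗ₖ N a) * ρ).trace.re =
      ((signObs M i ⊗ₖ signObs N i) * ρ).trace.re := by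
  have := sum_sum_trace ρ M N (fun c => ((c i : ℤ) : ℝ)) (fun c => ((c i : ℤ) : ℝ))
  simpa [signObs, signSum] using this

/-- The triple CHSH expression for given inputs at the other positions. -/
noncomputable def tripleValue (ρ : Matrix (C × A) (C × A) ℂ)
    (M : PauliInput n → Signs n → Matrix C C ℂ)
    (N : (x : NodeInput n) → NodeOutput n x → Matrix A A ℂ) (i : Fin n) (z : PauliInput n)
    (x : Fin n → Fin 6) : ℝ :=
  let K : Fin 3 → Matrix C C ℂ := fun t => signObs (M (Function.update z i t)) i
  let L : Fin 6 → Matrix A A ℂ := fun s => signObs (N (.vec (Function.update x i s))) i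
  chshValue ρ (K 0) (K 1) (L 0) (L 1) + chshValue ρ (K 0) (K 2) (L 3) (L 2) +
    chshValue ρ (K 1) (K 2) (L 5) (L 4)

omit [DecidableEq C] [DecidableEq A] in
-- Sums over strings with a prescribed entry become sums over all strings with that entry
-- overwritten. Each term is then counted 3 · 6 times, which turns the normalisation into `3^n 6^n`,
-- and all twelve correlations of `J_i` are indexed by the same pair `(z, x)`.
theorem avgCorr_pairBehaviour (ρ : Matrix (C × A) (C × A) ℂ)
    (M : PauliInput n → Signs n → Matrix C C ℂ)
    (N : (x : NodeInput n) → NodeOutput n x → Matrix A A ℂ) (i : Fin n) (t : Fin 3) (s : Fin 6) :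
    avgCorr (pairBehaviour ρ M N) i t s = 1 / (3 ^ n * 6 ^ n) *
      ∑ z : PauliInput n, ∑ x : Fin n → Fin 6, ((signObs (M (Function.update z i t)) i ⊗ₖ
        signObs (N (.vec (Function.update x i s))) i) * ρ).trace.re := by
  have h1 : ∀ z : PauliInput n, ∑ x : Fin n → Fin 6, ((signObs (M z) i ⊗ₖ
        signObs (N (.vec (Function.update x i s))) i) * ρ).trace.re =
      6 * ∑ x : Fin n → Fin 6 with x i = s,
        ((signObs (M z) i ⊗ₖ signObs (N (.vec x)) i) * ρ).trace.re := fun z => by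
    simpa using sum_update i s
      (fun x => ((signObs (M z) i ⊗ₖ signObs (N (.vec x)) i) * ρ).trace.re)
  have h2 := sum_update i t (fun z => ∑ x : Fin n → Fin 6, ((signObs (M z) i ⊗ₖ
        signObs (N (.vec (Function.update x i s))) i) * ρ).trace.re)
  rw [h2]
  simp only [h1, ← Finset.mul_sum, avgCorr, pairBehaviour, sum_sign_trace, Fintype.card_fin]
  obtain ⟨m, rfl⟩ : ∃ m, n = m + 1 := ⟨n - 1, by have := i.2; omega⟩
  rw [Nat.add_sub_cancel]
  push_cast
  field_simp
  ring

omit [DecidableEq C] [DecidableEq A] in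
-- In the second and third groups of `J_i` the minus sign stands at the first of Alice's two
-- observables, which is why `tripleValue` takes these pairs in the reversed orders `L 3, L 2` and
-- `L 5, L 4`.
theorem tripleCHSH_pairBehaviour (ρ : Matrix (C × A) (C × A) ℂ)
    (M : PauliInput n → Signs n → Matrix C C ℂ)
    (N : (x : NodeInput n) → NodeOutput n x → Matrix A A ℂ) (i : Fin n) :
    tripleCHSH (pairBehaviour ρ M N) i = 1 / (3 ^ n * 6 ^ n) *
      ∑ z : PauliInput n, ∑ x : Fin n → Fin 6, tripleValue ρ M N i z x := by
  simp only [tripleCHSH, avgCorr_pairBehaviour, ← mul_add, ← mul_sub, ← Finset.sum_add_distrib,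
    ← Finset.sum_sub_distrib]
  congr 1
  refine Finset.sum_congr rfl fun z _ => Finset.sum_congr rfl fun x _ => ?_
  simp only [tripleValue, chshValue, Matrix.kronecker_add, kronecker_sub, Matrix.add_mul,
    Matrix.sub_mul, Matrix.trace_add, Matrix.trace_sub, Complex.add_re, Complex.sub_re]
  ring

/-- An average reaches an upper bound of its terms only if every term does. Tsirelson's bound holds
for all inputs at the other positions, so equality holds for each position, each pair of input
strings and each of the three CHSH expressions. -/
theorem tripleValue_eq_of_sum_eq {ρ : Matrix (C × A) (C × A) ℂ} (hρ : IsState ρ)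
    {M : PauliInput n → Signs n → Matrix C C ℂ}
    {N : (x : NodeInput n) → NodeOutput n x → Matrix A A ℂ}
    (hM : ∀ z, IsPOVM (M z)) (hN : ∀ x, IsPOVM (N x))
    (h : ∑ i, tripleCHSH (pairBehaviour ρ M N) i = n * (6 * √2))
    (i : Fin n) (z : PauliInput n) (x : Fin n → Fin 6) :
    let K : Fin 3 → Matrix C C ℂ := fun t => signObs (M (Function.update z i t)) i
    let L : Fin 6 → Matrix A A ℂ := fun s => signObs (N (.vec (Function.update x i s))) i
    chshValue ρ (K 0) (K 1) (L 0) (L 1) = 2 * √2 ∧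
      chshValue ρ (K 0) (K 2) (L 3) (L 2) = 2 * √2 ∧
      chshValue ρ (K 1) (K 2) (L 5) (L 4) = 2 * √2 := by
  have bd : ∀ (z z' : PauliInput n) (x x' : Fin n → Fin 6) (i : Fin n),
      chshValue ρ (signObs (M z) i) (signObs (M z') i)
        (signObs (N (.vec x)) i) (signObs (N (.vec x')) i) ≤ 2 * √2 := fun z z' x x' i =>
    (chsh_bound_and_rigidity hρ (signObs_isHermitian (hM z) i) (signObs_isHermitian (hM z') i)
      (signObs_isHermitian (hN (.vec x)) i) (signObs_isHermitian (hN (.vec x')) i)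
      (signObs_sq_le (hM z) i) (signObs_sq_le (hM z') i)
      (signObs_sq_le (hN (.vec x)) i) (signObs_sq_le (hN (.vec x')) i)).1
  have le : ∀ i z x, tripleValue ρ M N i z x ≤ 6 * √2 := by
    intro i z x
    have h1 := bd (Function.update z i 0) (Function.update z i 1) (Function.update x i 0)
      (Function.update x i 1) i
    have h2 := bd (Function.update z i 0) (Function.update z i 2) (Function.update x i 3)
      (Function.update x i 2) i
    have h3 := bd (Function.update z i 1) (Function.update z i 2) (Function.update x i 5)
      (Function.update x i 4) i
    simp only [tripleValue]
    linarith
  have hsum : ∑ i : Fin n, ∑ z : PauliInput n, ∑ x : Fin n → Fin 6, tripleValue ρ M N i z x =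
      ∑ i : Fin n, ∑ z : PauliInput n, ∑ x : Fin n → Fin 6, 6 * √2 := by
    simp only [tripleCHSH_pairBehaviour, ← Finset.mul_sum] at h
    have h3 : (3 ^ n * 6 ^ n : ℝ) ≠ 0 := by positivity
    rw [one_div, inv_mul_eq_iff_eq_mul₀ h3] at h
    rw [h]
    simp
    ring
  have hi := (Finset.sum_eq_sum_iff_of_le fun i _ => Finset.sum_le_sum fun z _ =>
    Finset.sum_le_sum fun x _ => le i z x).mp hsum i (Finset.mem_univ i)
  have hz := (Finset.sum_eq_sum_iff_of_le fun z _ =>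
    Finset.sum_le_sum fun x _ => le i z x).mp hi z (Finset.mem_univ z)
  have hx := (Finset.sum_eq_sum_iff_of_le fun x _ => le i z x).mp hz x (Finset.mem_univ x)
  have h1 := bd (Function.update z i 0) (Function.update z i 1) (Function.update x i 0)
    (Function.update x i 1) i
  have h2 := bd (Function.update z i 0) (Function.update z i 2) (Function.update x i 3)
    (Function.update x i 2) i
  have h3 := bd (Function.update z i 1) (Function.update z i 2) (Function.update x i 5)
    (Function.update x i 4) i
  simp only [tripleValue] at hx
  intro K L
  refine ⟨?_, ?_, ?_⟩ <;> simp only [K, L] <;> linarith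

end SignMeasurements

end DICert

namespace DICert

/-! ## The Pauli relations certified by the self-test -/

section PauliRelations

variable {n : ℕ} {C A : Type} [Fintype C] [Fintype A] [DecidableEq C] [DecidableEq A]

/-- Projective measurements `M z` whose sign observables `T i (z i)` obey the relations of the
Pauli matrices, with the same chirality at all positions, and act on `ρ` like Hermitian
operators of the other system. -/
structure IsPauliFamily (ρ : Matrix (C × A) (C × A) ℂ) (M : PauliInput n → Signs n → Matrix C C ℂ)
    (T : Fin n → Fin 3 → Matrix C C ℂ) : Prop where
  povm : ∀ z, IsPOVM (M z)
  orth : ∀ z, IsOrthogonal (M z)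
  obs : ∀ z i, signObs (M z) i = T i (z i)
  sq : ∀ i t, T i t * T i t = 1
  anti : ∀ i s t, s ≠ t → T i s * T i t = -(T i t * T i s)
  chir : ∀ i j, T i 0 * T i 1 * T i 2 = T j 0 * T j 1 * T j 2
  transfer : ∀ i t, ∃ R : Matrix A A ℂ, R.IsHermitian ∧
    (T i t ⊗ₖ (1 : Matrix A A ℂ)) * ρ = ((1 : Matrix C C ℂ) ⊗ₖ R) * ρ

omit [DecidableEq C] in
-- The input that is `s` everywhere except for `t` at position `j` has both operators among the sign
-- observables of one projective measurement.
theorem commute_of_obs {M : PauliInput n → Signs n → Matrix C C ℂ}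
    {T : Fin n → Fin 3 → Matrix C C ℂ} (orth : ∀ z, IsOrthogonal (M z))
    (obs : ∀ z i, signObs (M z) i = T i (z i)) {i j : Fin n} (hij : i ≠ j) (s t : Fin 3) :
    Commute (T i s) (T j t) := by
  have h1 := obs (Function.update (fun _ => s) j t) i
  have h2 := obs (Function.update (fun _ => s) j t) j
  rw [Function.update_of_ne hij] at h1
  rw [Function.update_self] at h2
  rw [← h1, ← h2]
  exact (orth _).signSum_commute _ _

theorem card_filter_eq_eq {i j : Fin n} (hij : i ≠ j) (t : Fin 3) :
    (Finset.univ.filter fun z : PauliInput n => z i = t ∧ z j = t).card = 3 ^ (n - 2) := by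
  have : (Finset.univ.filter fun z : PauliInput n => z i = t ∧ z j = t) =
      Fintype.piFinset fun k => if k = i ∨ k = j then {t} else Finset.univ := by
    ext z
    simp only [Finset.mem_filter, Finset.mem_univ, true_and, Fintype.mem_piFinset]
    constructor
    · rintro ⟨h1, h2⟩ k
      split_ifs with h
      · rcases h with rfl | rfl <;> simp [h1, h2]
      · simp
    · intro h
      have h1 := h i
      have h2 := h j
      simp at h1 h2
      exact ⟨h1, h2⟩
  rw [this, Fintype.card_piFinset]
  have h2 : ∀ k, (if k = i ∨ k = j then ({t} : Finset (Fin 3)) else Finset.univ).card =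
      if k ∈ ({i, j} : Finset (Fin n)) then 1 else 3 := by
    intro k
    by_cases h : k = i ∨ k = j <;> simp [h]
  rw [Finset.prod_congr rfl fun k _ => h2 k, Finset.prod_ite]
  simp only [Finset.prod_const, one_pow, one_mul]
  congr 1
  have : (Finset.univ.filter fun k => k ∉ ({i, j} : Finset (Fin n))) = ({i, j} : Finset (Fin n))ᶜ := by
    ext k; simp
  rw [this, Finset.card_compl, Finset.card_pair hij, Fintype.card_fin]

/-- The sign -1 reflects `(ZZ)(XX)(YY) = -1` for Pauli matrices; it is what makes the table
sensitive to the relative chirality of two sites. -/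
theorem bellTable_prod (s : Fin 4) :
    (4 * bellTable s 0) * (4 * bellTable s 1) * (4 * bellTable s 2) = -1 ∧
      ∀ t, 4 * bellTable s t = 1 ∨ 4 * bellTable s t = -1 := by
  fin_cases s
  all_goals
    refine ⟨by simp [bellTable]; norm_num, fun t => ?_⟩
    fin_cases t <;> simp [bellTable] <;> norm_num

/-- The Bell state measurement correlations imply that two sites have the same chirality. -/
theorem chirality_eq_of_bell {ρ : Matrix (C × A) (C × A) ℂ} (hρ : IsState ρ) (hf : Faithful ρ)
    {X Y : Fin 3 → Matrix C C ℂ} (hX : ∀ t, (X t).IsHermitian) (hY : ∀ t, (Y t).IsHermitian)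
    (sX : ∀ t, X t * X t = 1) (sY : ∀ t, Y t * Y t = 1) (comm : ∀ s t, Commute (X s) (Y t))
    (aY : ∀ s t, s ≠ t → Y s * Y t = -(Y t * Y s))
    {B : Fin 4 → Matrix A A ℂ} (hB : ∀ s, (B s).PosSemidef) (hB1 : ∑ s, B s = 1)
    (h1 : ∀ s, (((1 : Matrix C C ℂ) ⊗ₖ B s) * ρ).trace.re = 1 / 4)
    (h2 : ∀ s t, (((X t * Y t) ⊗ₖ B s) * ρ).trace.re = bellTable s t) :
    X 0 * X 1 * X 2 = Y 0 * Y 1 * Y 2 := by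
  have hD : ∀ t, (X t * Y t).IsHermitian := fun t => by
    rw [Matrix.IsHermitian, Matrix.conjTranspose_mul, (hX t).eq, (hY t).eq, (comm t t).eq]
  have sD : ∀ t, (X t * Y t) * (X t * Y t) = 1 := fun t => by
    calc (X t * Y t) * (X t * Y t) = X t * (Y t * X t) * Y t := by noncomm_ring
      _ = (X t * X t) * (Y t * Y t) := by rw [← (comm t t).eq]; noncomm_ring
      _ = 1 := by rw [sX, sY, one_mul]
  have key : ∀ s t, ((X t * Y t) ⊗ₖ B s) * ρ =
      ((4 * bellTable s t : ℝ) : ℂ) • (((1 : Matrix C C ℂ) ⊗ₖ B s) * ρ) := by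
    intro s t
    set e : ℝ := 4 * bellTable s t with he
    have hee : e * e = 1 := by
      rcases (bellTable_prod s).2 t with h | h <;> rw [← he] at h <;> rw [h] <;> norm_num
    have hps : (1 - (e : ℂ) • (X t * Y t)).PosSemidef := by
      have hh : (1 - (e : ℂ) • (X t * Y t)).IsHermitian := by
        rw [Matrix.IsHermitian, Matrix.conjTranspose_sub, Matrix.conjTranspose_one,
          Matrix.conjTranspose_smul, (hD t).eq]
        simp
      -- Since `X_t Y_t` is an involution and `e = ±1`, one has `1 - e X_t Y_t = ½ (1 - e X_t
      -- Y_t)²`.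
      have := (Matrix.posSemidef_conjTranspose_mul_self (1 - (e : ℂ) • (X t * Y t))).smul
        (show (0 : ℂ) ≤ 1 / 2 by rw [Complex.le_def]; norm_num)
      rw [hh.eq] at this
      convert this using 1
      have hee' : (e : ℂ) * e = 1 := by exact_mod_cast hee
      simp only [sub_mul, mul_sub, one_mul, mul_one, smul_mul_assoc, mul_smul_comm, sD, smul_smul,
        hee', smul_sub]
      module
    -- The trace is `1/4 - e · e/4 = 0`: given the outcome `s`, the product `X_t Y_t` has the value
    -- `e` with certainty.
    have hz : (1 - (e : ℂ) • (X t * Y t)) ⊗ₖ B s * ρ = 0 := by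
      apply mul_eq_zero_of_trace_re_eq_zero (hps.kronecker (hB s)) hρ.1
      rw [sub_kronecker, Matrix.smul_kronecker, Matrix.sub_mul, Matrix.smul_mul, Matrix.trace_sub,
        Matrix.trace_smul, smul_eq_mul, Complex.sub_re, Complex.re_ofReal_mul, h1, h2]
      have : bellTable s t = e / 4 := by rw [he]; ring
      rw [this]
      linear_combination (-1 / 4) * hee
    rw [sub_kronecker, Matrix.smul_kronecker, Matrix.sub_mul, Matrix.smul_mul, sub_eq_zero] at hz
    rw [hz, smul_smul, ← Complex.ofReal_mul, hee, Complex.ofReal_one, one_smul]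
  have key' : ∀ (Z : Matrix C C ℂ) s t, ((Z * (X t * Y t)) ⊗ₖ B s) * ρ =
      ((4 * bellTable s t : ℝ) : ℂ) • ((Z ⊗ₖ B s) * ρ) := by
    intro Z s t
    have h3 : (Z * (X t * Y t)) ⊗ₖ B s = (Z ⊗ₖ (1 : Matrix A A ℂ)) * ((X t * Y t) ⊗ₖ B s) := by
      rw [kron_mul_kron, Matrix.one_mul]
    have h4 : (Z ⊗ₖ B s) = (Z ⊗ₖ (1 : Matrix A A ℂ)) * ((1 : Matrix C C ℂ) ⊗ₖ B s) := by
      rw [kron_mul_kron, Matrix.one_mul, Matrix.mul_one]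
    rw [h3, Matrix.mul_assoc, key, h4, Matrix.mul_smul, Matrix.mul_assoc]
  -- Each outcome `s` yields the product of its three signs, always -1. Summation over `s` removes
  -- the effects, and faithfulness removes `ρ`.
  have hprod : (X 0 * Y 0) * (X 1 * Y 1) * (X 2 * Y 2) = -1 := by
    apply hf.eq_of_mul_eq
    have hs : ∀ s, (((X 0 * Y 0) * (X 1 * Y 1) * (X 2 * Y 2)) ⊗ₖ B s) * ρ =
        (-1 : ℂ) • (((1 : Matrix C C ℂ) ⊗ₖ B s) * ρ) := by
      intro s
      rw [key', key', key, smul_smul, smul_smul, ← Complex.ofReal_mul, ← Complex.ofReal_mul]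
      have := (bellTable_prod s).1
      rw [show (4 * bellTable s 2) * (4 * bellTable s 1) * (4 * bellTable s 0) = -1 by
        rw [← this]; ring]
      simp
    have h5 := Finset.sum_congr (rfl : (Finset.univ : Finset (Fin 4)) = _) fun s _ => hs s
    rw [← Finset.sum_mul, kronecker_sum, hB1, ← Finset.smul_sum, ← Finset.sum_mul, kronecker_sum,
      hB1] at h5
    rw [h5]
    rw [← Matrix.smul_mul, ← Matrix.smul_kronecker, neg_one_smul]
  have hYinv : (Y 0 * Y 1 * Y 2) * (Y 0 * Y 1 * Y 2) = -1 := by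
    calc (Y 0 * Y 1 * Y 2) * (Y 0 * Y 1 * Y 2)
        = Y 0 * Y 1 * (Y 2 * Y 0) * Y 1 * Y 2 := by noncomm_ring
      _ = -(Y 0 * (Y 1 * Y 0) * (Y 2 * Y 1) * Y 2) := by
          rw [aY 2 0 (by decide)]; noncomm_ring
      _ = -((Y 0 * Y 0) * (Y 1 * Y 1) * (Y 2 * Y 2)) := by
          rw [aY 1 0 (by decide), aY 2 1 (by decide)]; noncomm_ring
      _ = -1 := by rw [sY, sY, sY]; simp
  -- Hence `(X₀X₁X₂)(Y₀Y₁Y₂) = -1 = (Y₀Y₁Y₂)²`, and the invertible factor `Y₀Y₁Y₂` cancels.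
  have h6 : (X 0 * Y 0) * (X 1 * Y 1) * (X 2 * Y 2) = (X 0 * X 1 * X 2) * (Y 0 * Y 1 * Y 2) := by
    calc (X 0 * Y 0) * (X 1 * Y 1) * (X 2 * Y 2)
        = X 0 * (Y 0 * X 1) * (Y 1 * X 2) * Y 2 := by noncomm_ring
      _ = X 0 * X 1 * (Y 0 * X 2) * Y 1 * Y 2 := by
          rw [← (comm 1 0).eq, ← (comm 2 1).eq]; noncomm_ring
      _ = _ := by rw [← (comm 2 0).eq]; noncomm_ring
  rw [h6] at hprod
  calc X 0 * X 1 * X 2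
      = -((X 0 * X 1 * X 2) * ((Y 0 * Y 1 * Y 2) * (Y 0 * Y 1 * Y 2))) := by rw [hYinv]; simp
    _ = -((X 0 * X 1 * X 2) * (Y 0 * Y 1 * Y 2) * (Y 0 * Y 1 * Y 2)) := by
        simp only [Matrix.mul_assoc]
    _ = Y 0 * Y 1 * Y 2 := by rw [hprod]; simp

/-- The observables depend only on the local input, so all `3^(n-2)` terms of the average coincide
and the average is a single correlation with the marginal effect of `a_l = s`. -/
theorem chirality_eq_of_bellCorrelations {m : ℕ} {ρ : Matrix (C × A) (C × A) ℂ} (hρ : IsState ρ)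
    (hf : Faithful ρ) {M : PauliInput n → Signs n → Matrix C C ℂ}
    {T : Fin n → Fin 3 → Matrix C C ℂ} (povm : ∀ z, IsPOVM (M z))
    (orth : ∀ z, IsOrthogonal (M z)) (obs : ∀ z i, signObs (M z) i = T i (z i))
    (sq : ∀ i t, T i t * T i t = 1) (anti : ∀ i s t, s ≠ t → T i s * T i t = -(T i t * T i s))
    {pair : Fin m → Fin n × Fin n} (l : Fin m) (hl : (pair l).1 ≠ (pair l).2)
    {N : (Fin m → Fin 4) → Matrix A A ℂ} (hN : IsPOVM N)
    (h : BellCorrelations pair fun z c a => ((M z c ⊗ₖ N a) * ρ).trace.re) :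
    T (pair l).1 0 * T (pair l).1 1 * T (pair l).1 2 =
      T (pair l).2 0 * T (pair l).2 1 * T (pair l).2 2 := by
  have herm : ∀ i t, (T i t).IsHermitian := fun i t => by
    have := signObs_isHermitian (povm fun _ => t) i
    rwa [obs] at this
  have hsum : ∀ (z : PauliInput n) (f : Signs n → ℝ) (s : Fin 4),
      ∑ c : Signs n, ∑ a : Fin m → Fin 4 with a l = s, f c * ((M z c ⊗ₖ N a) * ρ).trace.re =
      ((signSum (M z) (fun c => (f c : ℂ)) ⊗ₖ ∑ a : Fin m → Fin 4 with a l = s, N a) *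
        ρ).trace.re := by
    intro z f s
    have := sum_sum_trace ρ (M z) N f (fun a => if a l = s then 1 else 0)
    simp only [mul_ite, mul_one, mul_zero, ite_mul, zero_mul, ← Finset.sum_filter,
      apply_ite Complex.ofReal, Complex.ofReal_one, Complex.ofReal_zero, ite_smul, one_smul,
      zero_smul] at this
    exact this
  refine chirality_eq_of_bell hρ hf (herm _) (herm _) (sq _) (sq _)
    (commute_of_obs orth obs hl) (anti _)
    (B := fun s => ∑ a : Fin m → Fin 4 with a l = s, N a) (fun s => hN.sum_posSemidef _) ?_ ?_ ?_
  · rw [← hN.2]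
    exact Finset.sum_fiberwise Finset.univ (fun a : Fin m → Fin 4 => a l) N
  · intro s
    have h1 := (h l s).1 (fun _ => 0)
    have h2 := hsum (fun _ => 0) (fun _ => 1) s
    simp only [one_mul] at h2
    rw [h2] at h1
    have h3 : signSum (M fun _ => 0) (fun _ => ((1 : ℝ) : ℂ)) = 1 := by
      simp [signSum, (povm _).2]
    rwa [h3] at h1
  · intro s t
    have h1 := (h l s).2 t
    rw [← h1]
    have h2 : ∀ z ∈ Finset.univ.filter
        (fun z : PauliInput n => z (pair l).1 = t ∧ z (pair l).2 = t),
        ∑ c : Signs n, ∑ a : Fin m → Fin 4 with a l = s,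
          (((c (pair l).1 * c (pair l).2 : ℤˣ) : ℤ) : ℝ) * ((M z c ⊗ₖ N a) * ρ).trace.re =
        (((T (pair l).1 t * T (pair l).2 t) ⊗ₖ ∑ a : Fin m → Fin 4 with a l = s, N a) *
          ρ).trace.re := by
      intro z hz
      simp only [Finset.mem_filter, Finset.mem_univ, true_and] at hz
      rw [hsum z (fun c => (((c (pair l).1 * c (pair l).2 : ℤˣ) : ℤ) : ℝ)) s]
      have e1 := obs z (pair l).1
      have e2 := obs z (pair l).2
      rw [hz.1] at e1
      rw [hz.2] at e2
      rw [← e1, ← e2, signObs, signObs, (orth z).signSum_mul]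
      congr 5
      funext c
      simp
    rw [Finset.sum_congr rfl h2, Finset.sum_const, card_filter_eq_eq hl, nsmul_eq_mul]
    push_cast
    rw [← mul_assoc, one_div_mul_cancel (by positivity), one_mul]

/-- The self-test certifies the Pauli relations if the state is faithful. -/
theorem isPauliFamily_of_selfTest {ρ : Matrix (C × A) (C × A) ℂ} (hρ : IsState ρ)
    (hf : Faithful ρ) {M : PauliInput n → Signs n → Matrix C C ℂ}
    {N : (x : NodeInput n) → NodeOutput n x → Matrix A A ℂ}
    (hM : ∀ z, IsPOVM (M z)) (hN : ∀ x, IsPOVM (N x))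
    (h : PairSelfTest (pairBehaviour ρ M N)) :
    IsPauliFamily ρ M fun i t => signObs (M fun _ => t) i := by
  obtain ⟨hJ, hloz, hblack⟩ := h
  let L : Fin n → Fin 6 → Matrix A A ℂ :=
    fun i s => signObs (N (.vec (Function.update (fun _ => 0) i s))) i
  have hL : ∀ i s, (L i s).IsHermitian := fun i s => signObs_isHermitian (hN _) i
  have rig : ∀ (z : PauliInput n) (i : Fin n) (s t : Fin 3) (a b : Fin 6),
      chshValue ρ (signObs (M (Function.update z i s)) i) (signObs (M (Function.update z i t)) i)
        (L i a) (L i b) = 2 * √2 → _ := fun z i s t a b heq =>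
    chsh_rigidity_of_faithful hρ hf (signObs_isHermitian (hM (Function.update z i s)) i)
      (signObs_isHermitian (hM (Function.update z i t)) i) (hL i a) (hL i b)
      (signObs_sq_le (hM _) i) (signObs_sq_le (hM _) i)
      (signObs_sq_le (hN (.vec (Function.update (fun _ => 0) i a))) i)
      (signObs_sq_le (hN (.vec (Function.update (fun _ => 0) i b))) i) heq
  let K : PauliInput n → Fin n → Fin 3 → Matrix C C ℂ :=
    fun z i t => signObs (M (Function.update z i t)) i
  have r01 := fun z i => rig z i 0 1 0 1 (tripleValue_eq_of_sum_eq hρ hM hN hJ i z fun _ => 0).1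
  have r02 := fun z i => rig z i 0 2 3 2 (tripleValue_eq_of_sum_eq hρ hM hN hJ i z fun _ => 0).2.1
  have r12 := fun z i => rig z i 1 2 5 4 (tripleValue_eq_of_sum_eq hρ hM hN hJ i z fun _ => 0).2.2
  -- Alice's partners of Z and X come from the first CHSH expression, that of Y from the second.
  -- They do not involve Charlie's inputs.
  let R : Fin n → Fin 3 → Matrix A A ℂ := fun i => ![((√2 : ℝ) : ℂ)⁻¹ • (L i 0 + L i 1),
    ((√2 : ℝ) : ℂ)⁻¹ • (L i 0 - L i 1), ((√2 : ℝ) : ℂ)⁻¹ • (L i 3 - L i 2)]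
  have tr : ∀ z i t, (K z i t ⊗ₖ (1 : Matrix A A ℂ)) * ρ = ((1 : Matrix C C ℂ) ⊗ₖ R i t) * ρ := by
    intro z i t
    fin_cases t
    · exact (r01 z i).2.2.2.1
    · exact (r01 z i).2.2.2.2
    · exact (r02 z i).2.2.2.2
  have hR : ∀ i t, (R i t).IsHermitian := by
    have hsm : ∀ X : Matrix A A ℂ, X.IsHermitian → (((√2 : ℝ) : ℂ)⁻¹ • X).IsHermitian := by
      intro X hX
      rw [Matrix.IsHermitian, Matrix.conjTranspose_smul, hX.eq]
      simp
    intro i t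
    fin_cases t
    · exact hsm _ ((hL i 0).add (hL i 1))
    · exact hsm _ ((hL i 0).sub (hL i 1))
    · exact hsm _ ((hL i 3).sub (hL i 2))
  -- Observables for inputs that agree at position `i` have the same partner `R`, hence the same
  -- action on `ρ`, and are equal by faithfulness.
  have hobs : ∀ z i, signObs (M z) i = signObs (M fun _ => z i) i := by
    intro z i
    apply hf.eq_of_mul_eq
    have h1 := tr z i (z i)
    have h2 := tr (fun _ => z i) i (z i)
    simp only [K, Function.update_eq_self] at h1
    have h3 : Function.update (fun _ : Fin n => z i) i (z i) = fun _ => z i := by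
      simp
    simp only [K, h3] at h2
    rw [h1, h2]
  have hK : ∀ i t, K (fun _ => t) i t = signObs (M fun _ => t) i := by
    intro i t
    have h3 : Function.update (fun _ : Fin n => t) i t = fun _ => t := by
      simp
    simp only [K, h3]
  have hK' : ∀ z i t, K z i t = signObs (M fun _ => t) i := by
    intro z i t
    simp only [K]
    rw [hobs, Function.update_self]
  have hsq : ∀ i t, signObs (M fun _ => t) i * signObs (M fun _ => t) i = 1 := by
    intro i t
    rw [← hK' (fun _ => 0)]
    fin_cases t
    · exact (r01 _ i).1
    · exact (r01 _ i).2.1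
    · exact (r02 _ i).2.1
  have hanti : ∀ i s t, s ≠ t → signObs (M fun _ => s) i * signObs (M fun _ => t) i =
      -(signObs (M fun _ => t) i * signObs (M fun _ => s) i) := by
    intro i s t hst
    rw [← hK' (fun _ => 0), ← hK' (fun _ => 0)]
    have a01 := (r01 (fun _ => 0) i).2.2.1
    have a02 := (r02 (fun _ => 0) i).2.2.1
    have a12 := (r12 (fun _ => 0) i).2.2.1
    fin_cases s <;> fin_cases t
    · exact absurd rfl hst
    · exact a01
    · exact a02
    · exact neg_eq_iff_eq_neg.mp a01.symm
    · exact absurd rfl hst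
    · exact a12
    · exact neg_eq_iff_eq_neg.mp a02.symm
    · exact neg_eq_iff_eq_neg.mp a12.symm
    · exact absurd rfl hst
  have horth : ∀ z, IsOrthogonal (M z) := fun z =>
    mul_eq_of_signObs_sq (hM z) fun i => by rw [hobs]; exact hsq i (z i)
  refine ⟨hM, horth, hobs, hsq, hanti, ?_, fun i t => ⟨R i t, hR i t, ?_⟩⟩
  · set T : Fin n → Fin 3 → Matrix C C ℂ := fun i t => signObs (M fun _ => t) i with hT
    -- Counted from 0, `lozPair` joins the positions `2l, 2l+1` and `blackPair` joins `2l+1, 2l+2`;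
    -- together they link all neighbours.
    have step : ∀ k : ℕ, ∀ hk : k + 1 < n, T ⟨k, by omega⟩ 0 * T ⟨k, by omega⟩ 1 *
        T ⟨k, by omega⟩ 2 = T ⟨k + 1, hk⟩ 0 * T ⟨k + 1, hk⟩ 1 * T ⟨k + 1, hk⟩ 2 := by
      intro k hk
      rcases Nat.even_or_odd' k with ⟨l, rfl | rfl⟩
      · exact chirality_eq_of_bellCorrelations hρ hf hM horth hobs hsq hanti
          (pair := lozPair n) ⟨l, by omega⟩ (by simp [lozPair, Fin.ext_iff]) (hN .lozenge) hloz
      · exact chirality_eq_of_bellCorrelations hρ hf hM horth hobs hsq hanti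
          (pair := blackPair n) ⟨l, by omega⟩ (by simp [blackPair, Fin.ext_iff])
          (hN .blacklozenge) hblack
    have all : ∀ k : ℕ, ∀ hk : k < n, T ⟨k, hk⟩ 0 * T ⟨k, hk⟩ 1 * T ⟨k, hk⟩ 2 =
        T ⟨0, by omega⟩ 0 * T ⟨0, by omega⟩ 1 * T ⟨0, by omega⟩ 2 := by
      intro k
      induction k with
      | zero => intro hk; rfl
      | succ k ih => intro hk; rw [← step k hk]; exact ih (by omega)
    intro i j
    exact (all i i.2).trans (all j j.2).symm
  · rw [← hK i t]
    exact tr _ i t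

end PauliRelations

end DICert

namespace DICert

/-! ## Tensor products of one-qubit operators -/

section TensorOp

variable {n : ℕ}

theorem tensorOp_mul (f g : Fin n → Matrix (Fin 2) (Fin 2) ℂ) :
    tensorOp f * tensorOp g = tensorOp fun i => f i * g i := by
  ext u v
  simp only [tensorOp, Matrix.mul_apply, Matrix.of_apply, ← Finset.prod_mul_distrib]
  rw [Finset.prod_univ_sum]
  simp

theorem tensorOp_one : tensorOp (fun _ : Fin n => (1 : Matrix (Fin 2) (Fin 2) ℂ)) = 1 := by
  ext u v
  simp only [tensorOp, Matrix.of_apply, Matrix.one_apply]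
  rw [Finset.prod_ite_zero]
  simp [funext_iff]

theorem trace_tensorOp (f : Fin n → Matrix (Fin 2) (Fin 2) ℂ) :
    (tensorOp f).trace = ∏ i, (f i).trace := by
  simp only [tensorOp, Matrix.trace, Matrix.diag, Matrix.of_apply]
  rw [Finset.prod_univ_sum]
  simp

theorem tensorOp_conjTranspose (f : Fin n → Matrix (Fin 2) (Fin 2) ℂ) :
    (tensorOp f)ᴴ = tensorOp fun i => (f i)ᴴ := by
  ext u v
  simp [tensorOp, Matrix.conjTranspose_apply]

theorem tensorOp_transpose (f : Fin n → Matrix (Fin 2) (Fin 2) ℂ) :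
    (tensorOp f)ᵀ = tensorOp fun i => (f i)ᵀ := by
  ext u v
  simp [tensorOp]

theorem sum_tensorOp {S : Type} [Fintype S] (f : Fin n → S → Matrix (Fin 2) (Fin 2) ℂ) :
    ∑ c : Fin n → S, tensorOp (fun i => f i (c i)) = tensorOp fun i => ∑ s, f i s := by
  classical
  ext u v
  simp only [tensorOp, Matrix.sum_apply, Matrix.of_apply]
  rw [Finset.prod_univ_sum]
  simp

theorem tensorOp_smul (a : Fin n → ℂ) (f : Fin n → Matrix (Fin 2) (Fin 2) ℂ) :
    tensorOp (fun i => a i • f i) = (∏ i, a i) • tensorOp f := by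
  ext u v
  simp [tensorOp, Finset.prod_mul_distrib]

theorem tensorOp_posSemidef {f : Fin n → Matrix (Fin 2) (Fin 2) ℂ}
    (hf : ∀ i, (f i).PosSemidef) : (tensorOp f).PosSemidef := by
  choose B hB using fun i => exists_conjTranspose_mul_self (hf i)
  have : tensorOp f = (tensorOp B)ᴴ * tensorOp B := by
    rw [tensorOp_conjTranspose, tensorOp_mul]
    exact congrArg _ (funext hB)
  rw [this]
  exact Matrix.posSemidef_conjTranspose_mul_self _

theorem isPOVM_tensorOp {S : Type} [Fintype S] {f : Fin n → S → Matrix (Fin 2) (Fin 2) ℂ}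
    (hf : ∀ i, IsPOVM (f i)) : IsPOVM fun c : Fin n → S => tensorOp fun i => f i (c i) := by
  refine ⟨fun c => tensorOp_posSemidef fun i => (hf i).1 _, ?_⟩
  rw [sum_tensorOp, ← tensorOp_one]
  exact congrArg _ (funext fun i => (hf i).2)

/-- A one-qubit operator at site `i`. -/
def siteOp (i : Fin n) (S : Matrix (Fin 2) (Fin 2) ℂ) : Matrix (Qubits n) (Qubits n) ℂ :=
  tensorOp (Function.update (fun _ => 1) i S)

theorem siteOp_mul (i : Fin n) (S S' : Matrix (Fin 2) (Fin 2) ℂ) :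
    siteOp i S * siteOp i S' = siteOp i (S * S') := by
  rw [siteOp, siteOp, tensorOp_mul, siteOp]
  congr 1
  funext j
  by_cases h : j = i
  · subst h; simp
  · simp [h]

theorem siteOp_smul (i : Fin n) (a : ℂ) (S : Matrix (Fin 2) (Fin 2) ℂ) :
    siteOp i (a • S) = a • siteOp i S := by
  have := tensorOp_smul (Function.update (fun _ => 1) i a) (Function.update (fun _ => 1) i S)
  rw [Finset.prod_update_of_mem (Finset.mem_univ i)] at this
  simp only [Finset.prod_const_one, mul_one] at this
  rw [siteOp, siteOp, ← this]
  congr 1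
  funext j
  by_cases h : j = i
  · subst h; simp
  · simp [h]

theorem siteOp_apply (i : Fin n) (S : Matrix (Fin 2) (Fin 2) ℂ) (u v : Qubits n) :
    siteOp i S u v = if ∀ j, j ≠ i → u j = v j then S (u i) (v i) else 0 := by
  rw [siteOp, tensorOp, Matrix.of_apply]
  rw [← Finset.mul_prod_erase _ _ (Finset.mem_univ i), Function.update_self]
  have : ∀ j ∈ Finset.univ.erase i, Function.update (fun _ => (1 : Matrix (Fin 2) (Fin 2) ℂ)) i S j
      (u j) (v j) = if u j = v j then 1 else 0 := by
    intro j hj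
    rw [Function.update_of_ne (Finset.ne_of_mem_erase hj), Matrix.one_apply]
  rw [Finset.prod_congr rfl this, Finset.prod_ite_zero]
  simp

/-! ### Pauli matrices -/

theorem pauli_isHermitian (t : Fin 3) : (pauli t).IsHermitian := by
  ext i j
  fin_cases t <;> fin_cases i <;> fin_cases j <;> simp [pauli]

theorem pauli_mul_self (t : Fin 3) : pauli t * pauli t = 1 := by
  fin_cases t <;> ext i j <;> fin_cases i <;> fin_cases j <;> simp [pauli]

theorem pauli_two_eq : pauli 2 = Complex.I • (pauli 1 * pauli 0) := by
  ext i j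
  fin_cases i <;> fin_cases j <;> simp [pauli]

theorem signProj_sum (S : Matrix (Fin 2) (Fin 2) ℂ) : ∑ c : ℤˣ, signProj S c = 1 := by
  rw [UnitsInt.univ, Finset.sum_pair (by decide), signProj, signProj]
  push_cast
  module

theorem signProj_mul_self {S : Matrix (Fin 2) (Fin 2) ℂ} (hS : S * S = 1) (c : ℤˣ) :
    signProj S c * S = ((c : ℤ) : ℂ) • signProj S c := by
  rcases Int.units_eq_one_or c with rfl | rfl <;>
  · simp only [signProj, smul_mul_assoc, add_mul, one_mul, hS, smul_smul]
    push_cast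
    module

theorem signProj_posSemidef {S : Matrix (Fin 2) (Fin 2) ℂ} (hS : S * S = 1)
    (hh : S.IsHermitian) (c : ℤˣ) : (signProj S c).PosSemidef := by
  have h1 : (signProj S c)ᴴ = signProj S c := by
    rw [signProj, Matrix.conjTranspose_smul, Matrix.conjTranspose_add, Matrix.conjTranspose_one,
      Matrix.conjTranspose_smul, hh.eq]
    simp
  have h2 : signProj S c = (signProj S c)ᴴ * signProj S c := by
    rw [h1]
    conv_rhs => arg 2; rw [signProj]
    rw [mul_smul_comm, mul_add, mul_one, mul_smul_comm, signProj_mul_self hS, smul_smul]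
    have : ((c : ℤ) : ℂ) * ((c : ℤ) : ℂ) = 1 := by
      rcases Int.units_eq_one_or c with rfl | rfl <;> simp
    rw [this]
    module
  rw [h2]
  exact Matrix.posSemidef_conjTranspose_mul_self _

theorem isPOVM_signProj {S : Matrix (Fin 2) (Fin 2) ℂ} (hS : S * S = 1)
    (hh : S.IsHermitian) : IsPOVM (signProj S) :=
  ⟨signProj_posSemidef hS hh, signProj_sum S⟩

theorem isPOVM_pauliProj (z : PauliInput n) : IsPOVM (pauliProj z) :=
  isPOVM_tensorOp fun i => isPOVM_signProj (pauli_mul_self (z i)) (pauli_isHermitian (z i))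

theorem pauliProj_mul_siteOp (z : PauliInput n) (c : Signs n) (i : Fin n) :
    pauliProj z c * siteOp i (pauli (z i)) = ((c i : ℤ) : ℂ) • pauliProj z c := by
  have h := tensorOp_smul (Function.update (fun _ => 1) i ((c i : ℤ) : ℂ))
    fun i => signProj (pauli (z i)) (c i)
  rw [Finset.prod_update_of_mem (Finset.mem_univ i)] at h
  simp only [Finset.prod_const_one, mul_one] at h
  rw [pauliProj, ← h, siteOp, tensorOp_mul]
  congr 1
  funext j
  by_cases hj : j = i
  · subst hj; simp [signProj_mul_self (pauli_mul_self (z j))]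
  · simp [hj]

theorem transpose_signProj (S : Matrix (Fin 2) (Fin 2) ℂ) (c : ℤˣ) :
    (signProj S c)ᵀ = signProj Sᵀ c := by
  simp [signProj, Matrix.transpose_smul, Matrix.transpose_add]

theorem transpose_pauliProj_mul_siteOp (z : PauliInput n) (c : Signs n) (i : Fin n) :
    (pauliProj z c)ᵀ * siteOp i (pauli (z i))ᵀ = ((c i : ℤ) : ℂ) • (pauliProj z c)ᵀ := by
  have h := tensorOp_smul (Function.update (fun _ => 1) i ((c i : ℤ) : ℂ))
    fun i => signProj (pauli (z i))ᵀ (c i)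
  rw [Finset.prod_update_of_mem (Finset.mem_univ i)] at h
  simp only [Finset.prod_const_one, mul_one] at h
  have hT : (pauli (z i))ᵀ * (pauli (z i))ᵀ = 1 := by
    rw [← Matrix.transpose_mul, pauli_mul_self, Matrix.transpose_one]
  rw [pauliProj, tensorOp_transpose]
  simp only [transpose_signProj]
  rw [← h, siteOp, tensorOp_mul]
  congr 1
  funext j
  by_cases hj : j = i
  · subst hj; simp [signProj_mul_self hT]
  · simp [hj]

theorem sum_transpose_pauliProj (z : PauliInput n) : ∑ c, (pauliProj z c)ᵀ = 1 := by
  rw [← Matrix.transpose_sum, (isPOVM_pauliProj z).2, Matrix.transpose_one]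

end TensorOp

/-- Measurements with the same sign observables up to `L` are intertwined by `L`. -/
theorem intertwine_of_signs {n : ℕ} {ι κ : Type} [Fintype ι] [Fintype κ] [DecidableEq ι]
    [DecidableEq κ] {M : Signs n → Matrix ι ι ℂ} {M' : Signs n → Matrix κ κ ℂ}
    {S : Fin n → Matrix ι ι ℂ} {S' : Fin n → Matrix κ κ ℂ} {L : Matrix κ ι ℂ}
    (hM : ∑ c, M c = 1) (hM' : ∑ c, M' c = 1) (hS : ∀ i c, S i * M c = ((c i : ℤ) : ℂ) • M c)
    (hS' : ∀ i c, M' c * S' i = ((c i : ℤ) : ℂ) • M' c) (hL : ∀ i, S' i * L = L * S i)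
    (c : Signs n) : M' c * L = L * M c := by
  -- Inserting the observable at a position where the strings differ multiplies the same product by
  -- `c_i` or by `c'_i`, depending on the side on which it is absorbed.
  have key : ∀ c c', c ≠ c' → M' c * L * M c' = 0 := by
    intro c c' hcc
    obtain ⟨i, hi⟩ := Function.ne_iff.mp hcc
    have h1 : M' c * S' i * L * M c' = ((c i : ℤ) : ℂ) • (M' c * L * M c') := by
      rw [hS', Matrix.smul_mul, Matrix.smul_mul]
    have h2 : M' c * S' i * L * M c' = ((c' i : ℤ) : ℂ) • (M' c * L * M c') := by
      rw [Matrix.mul_assoc (M' c), hL, ← Matrix.mul_assoc, Matrix.mul_assoc, hS, Matrix.mul_smul]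
    have h3 : (((c i : ℤ) : ℂ) - ((c' i : ℤ) : ℂ)) • (M' c * L * M c') = 0 := by
      rw [sub_smul, ← h1, ← h2, sub_self]
    refine (smul_eq_zero.mp h3).resolve_left fun h => hi ?_
    rw [sub_eq_zero] at h
    exact Units.ext (by exact_mod_cast h)
  calc M' c * L = M' c * L * ∑ c', M c' := by rw [hM, Matrix.mul_one]
    _ = M' c * L * M c := by
      rw [Matrix.mul_sum, Finset.sum_eq_single c (fun b _ hb => key c b hb.symm) (by simp)]
    _ = (∑ c', M' c') * L * M c := by
      rw [Matrix.sum_mul, Matrix.sum_mul, Finset.sum_eq_single c (fun b _ hb => key b c hb)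
        (by simp)]
    _ = L * M c := by rw [hM', Matrix.one_mul]

end DICert

namespace DICert

/-! ## Operators that can be moved to the other system -/

section Transfer

variable {n : ℕ} {C A : Type} [Fintype C] [Fintype A] [DecidableEq C] [DecidableEq A]

/-- `X` on the first and `Y` on the second system have the same effect on `ρ`, and so have their
adjoints. -/
def Transfers (ρ : Matrix (C × A) (C × A) ℂ) (X : Matrix C C ℂ) (Y : Matrix A A ℂ) : Prop :=
  (X ⊗ₖ (1 : Matrix A A ℂ)) * ρ = ((1 : Matrix C C ℂ) ⊗ₖ Y) * ρ ∧
    (Xᴴ ⊗ₖ (1 : Matrix A A ℂ)) * ρ = ((1 : Matrix C C ℂ) ⊗ₖ Yᴴ) * ρ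

theorem transfers_one (ρ : Matrix (C × A) (C × A) ℂ) : Transfers ρ 1 1 := by
  simp [Transfers]

theorem mul_kron_one_of_transfer {ρ : Matrix (C × A) (C × A) ℂ} {X X' : Matrix C C ℂ}
    {Y Y' : Matrix A A ℂ}
    (hX : (X ⊗ₖ (1 : Matrix A A ℂ)) * ρ = ((1 : Matrix C C ℂ) ⊗ₖ Y) * ρ)
    (hX' : (X' ⊗ₖ (1 : Matrix A A ℂ)) * ρ = ((1 : Matrix C C ℂ) ⊗ₖ Y') * ρ) :
    ((X * X') ⊗ₖ (1 : Matrix A A ℂ)) * ρ = ((1 : Matrix C C ℂ) ⊗ₖ (Y' * Y)) * ρ := by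
  rw [← kron_one_mul_kron_one, Matrix.mul_assoc, hX', ← Matrix.mul_assoc,
    (kron_one_commute X Y').eq, Matrix.mul_assoc, hX, ← Matrix.mul_assoc,
    one_kron_mul_one_kron]

/-- With the rules that follow, the operators that can be moved form a ∗-algebra, so all polynomials
in the observables can be moved once the observables can. -/
theorem Transfers.mul {ρ : Matrix (C × A) (C × A) ℂ} {X X' : Matrix C C ℂ}
    {Y Y' : Matrix A A ℂ} (h : Transfers ρ X Y) (h' : Transfers ρ X' Y') :
    Transfers ρ (X * X') (Y' * Y) := by
  refine ⟨mul_kron_one_of_transfer h.1 h'.1, ?_⟩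
  rw [Matrix.conjTranspose_mul, Matrix.conjTranspose_mul]
  exact mul_kron_one_of_transfer h'.2 h.2

theorem Transfers.add {ρ : Matrix (C × A) (C × A) ℂ} {X X' : Matrix C C ℂ}
    {Y Y' : Matrix A A ℂ} (h : Transfers ρ X Y) (h' : Transfers ρ X' Y') :
    Transfers ρ (X + X') (Y + Y') := by
  constructor
  · rw [Matrix.add_kronecker, Matrix.kronecker_add, Matrix.add_mul, Matrix.add_mul, h.1, h'.1]
  · rw [Matrix.conjTranspose_add, Matrix.conjTranspose_add, Matrix.add_kronecker,
      Matrix.kronecker_add, Matrix.add_mul, Matrix.add_mul, h.2, h'.2]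

theorem Transfers.smul {ρ : Matrix (C × A) (C × A) ℂ} {X : Matrix C C ℂ}
    {Y : Matrix A A ℂ} (h : Transfers ρ X Y) (a : ℂ) : Transfers ρ (a • X) (a • Y) := by
  constructor
  · rw [Matrix.smul_kronecker, Matrix.kronecker_smul, Matrix.smul_mul, Matrix.smul_mul, h.1]
  · rw [Matrix.conjTranspose_smul, Matrix.conjTranspose_smul, Matrix.smul_kronecker,
      Matrix.kronecker_smul, Matrix.smul_mul, Matrix.smul_mul, h.2]

theorem Transfers.conjTranspose {ρ : Matrix (C × A) (C × A) ℂ} {X : Matrix C C ℂ}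
    {Y : Matrix A A ℂ} (h : Transfers ρ X Y) : Transfers ρ Xᴴ Yᴴ :=
  ⟨h.2, by simpa using h.1⟩

/-- A projective measurement with values in the sign cube generates the same algebra as its sign
observables. -/
theorem signSum_induction {M : Signs n → Matrix C C ℂ} (hM : ∑ c, M c = 1) (ho : IsOrthogonal M)
    (p : Matrix C C ℂ → Prop) (one : p 1) (mul : ∀ X Y, p X → p Y → p (X * Y))
    (add : ∀ X Y, p X → p Y → p (X + Y)) (smul : ∀ (a : ℂ) X, p X → p (a • X))
    (obs : ∀ i, p (signObs M i)) (f : Signs n → ℂ) : p (signSum M f) := by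
  have hone : signSum M 1 = 1 := by simpa [signSum] using hM
  have hc : ∀ c, p (M c) := by
    intro c
    -- The indicator function of `c` is `∏_i (1 + c_i d_i)/2`, so `M c` is a polynomial in the sign
    -- observables.
    have h1 : (fun d : Signs n => if d = c then (1 : ℂ) else 0) =
        ∏ i, fun d : Signs n => (1 / 2 : ℂ) * (1 + ((c i : ℤ) : ℂ) * ((d i : ℤ) : ℂ)) := by
      funext d
      rw [Finset.prod_apply]
      have : ∀ i, (1 / 2 : ℂ) * (1 + ((c i : ℤ) : ℂ) * ((d i : ℤ) : ℂ)) =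
          if d i = c i then 1 else 0 := by
        intro i
        rcases Int.units_eq_one_or (c i) with h | h <;>
          rcases Int.units_eq_one_or (d i) with h' | h' <;> rw [h, h'] <;> norm_num
      simp only [this]
      rw [Finset.prod_ite_zero]
      simp [funext_iff]
    rw [← signSum_single M c, h1]
    refine Finset.prod_induction _ (fun f => p (signSum M f)) ?_ ?_ ?_
    · intro f g hf hg
      rw [← ho.signSum_mul]
      exact mul _ _ hf hg
    · rw [hone]; exact one
    · intro i _
      have : signSum M (fun d : Signs n => (1 / 2 : ℂ) * (1 + ((c i : ℤ) : ℂ) * ((d i : ℤ) : ℂ))) =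
          (1 / 2 : ℂ) • (1 + ((c i : ℤ) : ℂ) • signObs M i) := by
        rw [← hone]
        simp only [signObs, signSum, Finset.smul_sum, ← Finset.sum_add_distrib, Pi.one_apply]
        refine Finset.sum_congr rfl fun d _ => ?_
        module
      rw [this]
      exact smul _ _ (add _ _ one (smul _ _ (obs i)))
  rw [signSum]
  have hzero : p 0 := by simpa using smul 0 _ one
  exact Finset.sum_induction _ p add hzero fun c _ => smul _ _ (hc c)

end Transfer

/-! ## Qubit strings and signs -/

section QubitSigns

variable {n : ℕ}

/-- The sign `(-1)^b`. -/
def bitSign (b : Fin 2) : ℤˣ := if b = 0 then 1 else -1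

theorem bitSign_add (a b : Fin 2) : bitSign (a + b) = bitSign a * bitSign b := by
  revert a b; decide

theorem bitSign_injective : Function.Injective bitSign := by decide

theorem bitSign_bijective : Function.Bijective (fun (u : Qubits n) (i : Fin n) => bitSign (u i)) := by
  rw [Fintype.bijective_iff_injective_and_card]
  refine ⟨fun u v h => funext fun i => bitSign_injective (congrFun h i), ?_⟩
  simp

/-- The character `c ↦ ∏ c_i^{u_i}` of the sign cube. -/
def signChar (u : Qubits n) (c : Signs n) : ℂ := ∏ i, if u i = 0 then 1 else ((c i : ℤ) : ℂ)

theorem signChar_zero : signChar (0 : Qubits n) = 1 := by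
  funext c; simp [signChar]

theorem signChar_add (u v : Qubits n) : signChar (u + v) = signChar u * signChar v := by
  funext c
  rw [Pi.mul_apply, signChar, signChar, signChar, ← Finset.prod_mul_distrib]
  refine Finset.prod_congr rfl fun i _ => ?_
  have hc : ((c i : ℤ) : ℂ) * ((c i : ℤ) : ℂ) = 1 := by
    rcases Int.units_eq_one_or (c i) with h | h <;> rw [h] <;> simp
  rw [Pi.add_apply]
  generalize u i = a
  generalize v i = b
  have key : ∀ a b : Fin 2, (a = 0 ∧ b = 0 ∧ a + b = 0) ∨ (a = 0 ∧ b ≠ 0 ∧ a + b ≠ 0) ∨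
      (a ≠ 0 ∧ b = 0 ∧ a + b ≠ 0) ∨ (a ≠ 0 ∧ b ≠ 0 ∧ a + b = 0) := by decide
  rcases key a b with ⟨h1, h2, h3⟩ | ⟨h1, h2, h3⟩ | ⟨h1, h2, h3⟩ | ⟨h1, h2, h3⟩ <;>
    simp [h1, h2, h3, hc]

theorem signChar_single (i : Fin n) :
    signChar (Pi.single i 1 : Qubits n) = fun c => ((c i : ℤ) : ℂ) := by
  funext c
  rw [signChar, Finset.prod_eq_single i]
  · simp
  · intro j _ hj; simp [hj]
  · simp

theorem qubits_add_self (u : Qubits n) : u + u = 0 := by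
  funext i
  exact (show ∀ a : Fin 2, a + a = 0 by decide) (u i)

theorem qubits_induction (p : Qubits n → Prop) (zero : p 0) (add : ∀ u v, p u → p v → p (u + v))
    (single : ∀ i, p (Pi.single i 1)) (u : Qubits n) : p u := by
  rw [← Finset.univ_sum_single u]
  refine Finset.sum_induction _ p add zero fun i _ => ?_
  rcases (show ∀ a : Fin 2, a = 0 ∨ a = 1 by decide) (u i) with h | h <;> rw [h]
  · rw [Pi.single_zero]; exact zero
  · exact single i

theorem siteOp_pauli_zero_apply (i : Fin n) (u v : Qubits n) :
    siteOp i (pauli 0) u v = if v = u then ((bitSign (u i) : ℤ) : ℂ) else 0 := by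
  rw [siteOp_apply]
  by_cases h : v = u
  · subst h
    simp only [ne_eq, implies_true, if_true]
    generalize v i = a
    fin_cases a <;> simp [pauli, bitSign]
  · rw [if_neg h]
    split_ifs with h'
    · have hne : u i ≠ v i := fun he => h (funext fun j => by
        by_cases hj : j = i
        · subst hj; exact he.symm
        · exact (h' j hj).symm)
      revert hne
      generalize u i = a
      generalize v i = b
      intro hne
      fin_cases a <;> fin_cases b <;> simp_all [pauli]
    · rfl

theorem siteOp_pauli_one_apply (i : Fin n) (u v : Qubits n) :
    siteOp i (pauli 1) u v = if v = u + Pi.single i 1 then 1 else 0 := by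
  rw [siteOp_apply]
  by_cases h : v = u + Pi.single i 1
  · subst h
    have h1 : ∀ j, j ≠ i → u j = (u + Pi.single i 1 : Qubits n) j := by
      intro j hj; simp [hj]
    rw [if_pos h1]
    simp only [Pi.add_apply, Pi.single_eq_same, if_true]
    generalize u i = a
    fin_cases a <;> simp [pauli]
  · rw [if_neg h]
    split_ifs with h'
    · have hne : v i ≠ u i + 1 := fun he => h (funext fun j => by
        by_cases hj : j = i
        · subst hj; simpa using he
        · simpa [hj] using (h' j hj).symm)
      revert hne
      generalize u i = a
      generalize v i = b
      intro hne
      fin_cases a <;> fin_cases b <;> simp_all [pauli]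
    · rfl

end QubitSigns

end DICert

namespace DICert

/-! ## The swap isometry -/

namespace IsPauliFamily

variable {n : ℕ} {C A : Type} [Fintype C] [Fintype A] [DecidableEq C] [DecidableEq A]
  {ρ : Matrix (C × A) (C × A) ℂ} {M : PauliInput n → Signs n → Matrix C C ℂ}
  {T : Fin n → Fin 3 → Matrix C C ℂ}

theorem isHermitian (h : IsPauliFamily ρ M T) (i : Fin n) (t : Fin 3) : (T i t).IsHermitian := by
  have := signObs_isHermitian (h.povm fun _ => t) i
  rwa [h.obs] at this

theorem commute (h : IsPauliFamily ρ M T) {i j : Fin n} (hij : i ≠ j) (s t : Fin 3) :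
    Commute (T i s) (T j t) := commute_of_obs h.orth h.obs hij s t

theorem obs_mul (h : IsPauliFamily ρ M T) (z : PauliInput n) (i : Fin n) (c : Signs n) :
    T i (z i) * M z c = ((c i : ℤ) : ℂ) • M z c := by
  rw [← h.obs z, signObs, (h.orth z).signSum_mul_apply]

theorem mul_obs (h : IsPauliFamily ρ M T) (z : PauliInput n) (i : Fin n) (c : Signs n) :
    M z c * T i (z i) = ((c i : ℤ) : ℂ) • M z c := by
  rw [← h.obs z, signObs, (h.orth z).apply_mul_signSum]

/-- The product `∏ X_i^{u_i}`. -/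
noncomputable def flip (M : PauliInput n → Signs n → Matrix C C ℂ) (u : Qubits n) :
    Matrix C C ℂ := signSum (M fun _ => 1) (signChar u)

theorem flip_zero (h : IsPauliFamily ρ M T) : flip M 0 = 1 := by
  rw [flip, signChar_zero]
  simpa [signSum] using (h.povm fun _ => 1).2

theorem flip_add (h : IsPauliFamily ρ M T) (u v : Qubits n) :
    flip M (u + v) = flip M u * flip M v := by
  rw [flip, flip, flip, (h.orth _).signSum_mul, signChar_add]

theorem flip_single (h : IsPauliFamily ρ M T) (i : Fin n) :
    flip M (Pi.single i 1) = T i 1 := by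
  rw [flip, signChar_single]
  exact h.obs (fun _ => 1) i

theorem flip_isHermitian (h : IsPauliFamily ρ M T) (u : Qubits n) : (flip M u).IsHermitian := by
  refine qubits_induction (fun u => (flip M u).IsHermitian) ?_ ?_ ?_ u
  · rw [h.flip_zero]; exact Matrix.isHermitian_one
  · intro u v hu hv
    rw [Matrix.IsHermitian, h.flip_add, Matrix.conjTranspose_mul, hu.eq, hv.eq, ← h.flip_add,
      ← h.flip_add, add_comm]
  · intro i
    rw [h.flip_single]
    exact h.isHermitian i 1

theorem zObs_mul_flip (h : IsPauliFamily ρ M T) (i : Fin n) (u : Qubits n) :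
    T i 0 * flip M u = ((bitSign (u i) : ℤ) : ℂ) • (flip M u * T i 0) := by
  refine qubits_induction
    (fun u => T i 0 * flip M u = ((bitSign (u i) : ℤ) : ℂ) • (flip M u * T i 0)) ?_ ?_ ?_ u
  · simp [h.flip_zero, bitSign]
  · intro u v hu hv
    rw [h.flip_add, ← Matrix.mul_assoc, hu, Matrix.smul_mul, Matrix.mul_assoc, hv, Matrix.mul_smul,
      smul_smul, Pi.add_apply, bitSign_add, Matrix.mul_assoc]
    push_cast
    rfl
  · intro j
    rw [h.flip_single]
    by_cases hj : i = j
    · subst hj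
      rw [h.anti i 0 1 (by decide)]
      simp [bitSign]
    · rw [(h.commute hj 0 1).eq]
      simp [hj, bitSign]

/-- Conjugation by `X^u` changes the sign of `Z_i` exactly where `u_i = 1`, so it permutes the
outcomes of the Z measurement. This follows from the intertwining lemma with relabelled outcomes,
read at the all-plus string. -/
theorem ground_mul_flip (h : IsPauliFamily ρ M T) (u : Qubits n) :
    M (fun _ => 0) 1 * flip M u = flip M u * M (fun _ => 0) fun i => bitSign (u i) := by
  have hcast : ∀ a : ℤˣ, ((a : ℤ) : ℂ) * ((a : ℤ) : ℂ) = 1 := by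
    intro a
    rcases Int.units_eq_one_or a with h | h <;> rw [h] <;> simp
  have key := intertwine_of_signs (M := fun c => M (fun _ => 0) (c * fun i => bitSign (u i)))
    (M' := M fun _ => 0) (S := fun i => ((bitSign (u i) : ℤ) : ℂ) • T i 0) (S' := fun i => T i 0)
    (L := flip M u) ?_ (h.povm _).2 ?_ (fun i c => h.mul_obs (fun _ => 0) i c) ?_ 1
  · simpa using key
  · rw [← (h.povm fun _ => 0).2]
    exact Fintype.sum_equiv (Equiv.mulRight fun i => bitSign (u i)) _ _ fun c => rfl
  · intro i c
    rw [Matrix.smul_mul, h.obs_mul (fun _ => 0) i, smul_smul]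
    congr 1
    rw [Pi.mul_apply, Units.val_mul, Int.cast_mul, mul_left_comm, hcast, mul_one]
  · intro i
    rw [h.zObs_mul_flip, Matrix.mul_smul]

/-- The chirality: it is `1` where the observables act as Pauli matrices, and `-1` where they act
as the transposed Pauli matrices. -/
noncomputable def chirality (T : Fin n → Fin 3 → Matrix C C ℂ) (i : Fin n) : Matrix C C ℂ :=
  (-Complex.I) • (T i 0 * T i 1 * T i 2)

theorem chirality_eq (h : IsPauliFamily ρ M T) (i j : Fin n) : chirality T i = chirality T j := by
  rw [chirality, h.chir i j, chirality]

theorem chirality_isHermitian (h : IsPauliFamily ρ M T) (i : Fin n) :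
    (chirality T i).IsHermitian := by
  rw [Matrix.IsHermitian, chirality, Matrix.conjTranspose_smul, Matrix.conjTranspose_mul,
    Matrix.conjTranspose_mul, (h.isHermitian i 0).eq, (h.isHermitian i 1).eq,
    (h.isHermitian i 2).eq]
  have : T i 2 * (T i 1 * T i 0) = -(T i 0 * T i 1 * T i 2) := by
    calc T i 2 * (T i 1 * T i 0) = (T i 2 * T i 1) * T i 0 := by noncomm_ring
      _ = -(T i 1 * (T i 2 * T i 0)) := by rw [h.anti i 2 1 (by decide)]; noncomm_ring
      _ = (T i 1 * T i 0) * T i 2 := by rw [h.anti i 2 0 (by decide)]; noncomm_ring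
      _ = _ := by rw [h.anti i 1 0 (by decide)]; noncomm_ring
  rw [this]
  simp

theorem chirality_mul_self (h : IsPauliFamily ρ M T) (i : Fin n) :
    chirality T i * chirality T i = 1 := by
  have hinv : (T i 0 * T i 1 * T i 2) * (T i 0 * T i 1 * T i 2) = -1 := by
    calc (T i 0 * T i 1 * T i 2) * (T i 0 * T i 1 * T i 2)
        = T i 0 * T i 1 * (T i 2 * T i 0) * T i 1 * T i 2 := by noncomm_ring
      _ = -(T i 0 * (T i 1 * T i 0) * (T i 2 * T i 1) * T i 2) := by
          rw [h.anti i 2 0 (by decide)]; noncomm_ring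
      _ = -((T i 0 * T i 0) * (T i 1 * T i 1) * (T i 2 * T i 2)) := by
          rw [h.anti i 1 0 (by decide), h.anti i 2 1 (by decide)]; noncomm_ring
      _ = -1 := by rw [h.sq, h.sq, h.sq]; simp
  rw [chirality, Matrix.smul_mul, Matrix.mul_smul, hinv, smul_smul]
  simp

/-- A product of three pairwise anticommuting involutions commutes with each of them: passing one
through the others costs two signs. Since the chirality is the same at all sites, one site suffices.
-/
theorem chirality_commute (h : IsPauliFamily ρ M T) (i j : Fin n) (t : Fin 3) :
    Commute (chirality T i) (T j t) := by
  rw [h.chirality_eq i j, chirality]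
  refine Commute.smul_left ?_ _
  have a01 := h.anti j 0 1 (by decide)
  have a02 := h.anti j 0 2 (by decide)
  have a10 := h.anti j 1 0 (by decide)
  have a12 := h.anti j 1 2 (by decide)
  have a20 := h.anti j 2 0 (by decide)
  have a21 := h.anti j 2 1 (by decide)
  rw [commute_iff_eq]
  have e0 : T j 0 * T j 1 * T j 2 * T j 0 = T j 0 * (T j 0 * T j 1 * T j 2) := by
    calc T j 0 * T j 1 * T j 2 * T j 0 = T j 0 * T j 1 * (T j 2 * T j 0) := by noncomm_ring
      _ = -(T j 0 * (T j 1 * T j 0) * T j 2) := by rw [a20]; noncomm_ring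
      _ = _ := by rw [a10]; noncomm_ring
  have e1 : T j 0 * T j 1 * T j 2 * T j 1 = T j 1 * (T j 0 * T j 1 * T j 2) := by
    calc T j 0 * T j 1 * T j 2 * T j 1 = T j 0 * T j 1 * (T j 2 * T j 1) := by noncomm_ring
      _ = -((T j 0 * T j 1) * T j 1 * T j 2) := by rw [a21]; noncomm_ring
      _ = T j 1 * T j 0 * T j 1 * T j 2 := by rw [a10]; noncomm_ring
      _ = _ := by noncomm_ring
  have e2 : T j 0 * T j 1 * T j 2 * T j 2 = T j 2 * (T j 0 * T j 1 * T j 2) := by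
    calc T j 0 * T j 1 * T j 2 * T j 2 = T j 0 * (T j 1 * T j 2) * T j 2 := by noncomm_ring
      _ = -((T j 0 * T j 2) * T j 1 * T j 2) := by rw [a12]; noncomm_ring
      _ = _ := by rw [a02]; noncomm_ring
  fin_cases t
  · exact e0
  · exact e1
  · exact e2

theorem chirality_commute_meas (h : IsPauliFamily ρ M T) (i : Fin n) (z : PauliInput n)
    (c : Signs n) : Commute (chirality T i) (M z c) :=
  (intertwine_of_signs (M := M z) (M' := M z) (S := fun j => T j (z j)) (S' := fun j => T j (z j))
    (L := chirality T i) (h.povm z).2 (h.povm z).2 (h.obs_mul z) (h.mul_obs z)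
    (fun j => (h.chirality_commute i j (z j)).symm.eq) c).symm

/-- The projection onto the part of chirality `(-1)^k`. -/
noncomputable def chiralProj (T : Fin n → Fin 3 → Matrix C C ℂ) (i : Fin n) (k : Fin 2) :
    Matrix C C ℂ :=
  (1 / 2 : ℂ) • (1 + ((bitSign k : ℤ) : ℂ) • chirality T i)

theorem chiralProj_isHermitian (h : IsPauliFamily ρ M T) (i : Fin n) (k : Fin 2) :
    (chiralProj T i k).IsHermitian := by
  rw [Matrix.IsHermitian, chiralProj, Matrix.conjTranspose_smul, Matrix.conjTranspose_add,
    Matrix.conjTranspose_one, Matrix.conjTranspose_smul, (h.chirality_isHermitian i).eq]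
  simp

theorem chiralProj_sum (i : Fin n) : chiralProj T i 0 + chiralProj T i 1 = 1 := by
  simp only [chiralProj, bitSign]
  push_cast
  simp
  module

theorem chiralProj_mul (h : IsPauliFamily ρ M T) (i : Fin n) (k l : Fin 2) :
    chiralProj T i k * chiralProj T i l = if k = l then chiralProj T i k else 0 := by
  have hs := h.chirality_mul_self i
  fin_cases k <;> fin_cases l <;>
  · simp only [chiralProj, bitSign, Matrix.smul_mul, Matrix.mul_smul, add_mul, mul_add, one_mul,
      mul_one, hs]
    simp
    try module

theorem chiralProj_commute_of (i : Fin n) (k : Fin 2) {X : Matrix C C ℂ}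
    (hX : Commute (chirality T i) X) : Commute (chiralProj T i k) X :=
  Commute.smul_left (Commute.add_left (Commute.one_left X) (Commute.smul_left hX _)) _

theorem chirality_commute_flip (h : IsPauliFamily ρ M T) (i : Fin n) (u : Qubits n) :
    Commute (chirality T i) (flip M u) := by
  rw [flip, signSum]
  exact Commute.sum_right _ _ _ fun c _ =>
    Commute.smul_right (h.chirality_commute_meas i _ c) _

/-- The blocks of the swap isometry. -/
noncomputable def swapBlock (M : PauliInput n → Signs n → Matrix C C ℂ)
    (T : Fin n → Fin 3 → Matrix C C ℂ) (i : Fin n) (j : Fin 2 × Qubits n) : Matrix C C ℂ :=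
  M (fun _ => 0) 1 * flip M j.2 * chiralProj T i j.1

theorem swapBlock_conjTranspose (h : IsPauliFamily ρ M T) (i : Fin n) (j : Fin 2 × Qubits n) :
    (swapBlock M T i j)ᴴ = chiralProj T i j.1 * (flip M j.2 * M (fun _ => 0) 1) := by
  rw [swapBlock, Matrix.conjTranspose_mul, Matrix.conjTranspose_mul,
    (h.chiralProj_isHermitian i _).eq, (h.flip_isHermitian _).eq, ((h.povm _).1 _).1.eq]

/-- `W_j† W_j = Q_k P_u Q_k`, where `P_u` is the Z outcome labelled by `u`: the flip `X^u` brings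
this outcome to the all-plus one. The `P_u` add up to one, and then the `Q_k` do. Hence `ψ ↦ ∑_j W_j
ψ ⊗ |j⟩` is an isometry. -/
theorem sum_swapBlock (h : IsPauliFamily ρ M T) (i : Fin n) :
    ∑ j, (swapBlock M T i j)ᴴ * swapBlock M T i j = 1 := by
  have hone : (1 : Signs n) = 1 := rfl
  have h1 : ∀ k u, (swapBlock M T i (k, u))ᴴ * swapBlock M T i (k, u) =
      chiralProj T i k * M (fun _ => 0) (fun i => bitSign (u i)) * chiralProj T i k := by
    intro k u
    rw [h.swapBlock_conjTranspose, swapBlock]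
    have hP : M (fun _ => 0) 1 * M (fun _ => 0) 1 = M (fun _ => 0) 1 := by
      rw [h.orth (fun _ => 0) 1 1, if_pos rfl]
    have hX : flip M u * flip M u = 1 := by rw [← h.flip_add, qubits_add_self, h.flip_zero]
    calc chiralProj T i k * (flip M u * M (fun _ => 0) 1) *
          (M (fun _ => 0) 1 * flip M u * chiralProj T i k)
        = chiralProj T i k * (flip M u * (M (fun _ => 0) 1 * M (fun _ => 0) 1) * flip M u) *
            chiralProj T i k := by noncomm_ring
      _ = chiralProj T i k * (flip M u * (M (fun _ => 0) 1 * flip M u)) * chiralProj T i k := by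
          rw [hP, Matrix.mul_assoc (flip M u)]
      _ = chiralProj T i k * ((flip M u * flip M u) * M (fun _ => 0) fun i => bitSign (u i)) *
            chiralProj T i k := by rw [h.ground_mul_flip, Matrix.mul_assoc (flip M u)]
      _ = _ := by rw [hX, one_mul]
  rw [Fintype.sum_prod_type]
  have h2 : ∑ u : Qubits n, M (fun _ => 0) (fun i => bitSign (u i)) = 1 := by
    rw [← (h.povm fun _ => 0).2]
    exact Fintype.sum_bijective _ bitSign_bijective _ _ fun u => rfl
  simp only [h1, ← Finset.sum_mul, ← Finset.mul_sum, h2, Matrix.mul_one, h.chiralProj_mul,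
    if_true]
  rw [Fin.sum_univ_two, chiralProj_sum]

/-- The two flips combine to `X^(u+v)`, which maps the all-plus outcome to the outcome labelled
`u+v`; these are orthogonal unless `u = v`. That the diagonal value does not depend on `u` is the
source of the maximally entangled state. -/
theorem swapBlock_mul_conjTranspose (h : IsPauliFamily ρ M T) (i : Fin n)
    (j l : Fin 2 × Qubits n) :
    swapBlock M T i j * (swapBlock M T i l)ᴴ =
      if j = l then M (fun _ => 0) 1 * chiralProj T i j.1 else 0 := by
  obtain ⟨k, u⟩ := j
  obtain ⟨k', v⟩ := l
  rw [h.swapBlock_conjTranspose, swapBlock]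
  have hQX : Commute (chiralProj T i k) (flip M (u + v)) :=
    chiralProj_commute_of i k (h.chirality_commute_flip i _)
  have hQP : Commute (chiralProj T i k) (M (fun _ => 0) 1) :=
    chiralProj_commute_of i k (h.chirality_commute_meas i _ _)
  have hQv : Commute (chiralProj T i k) (flip M v) :=
    chiralProj_commute_of i k (h.chirality_commute_flip i _)
  have h1 : M (fun _ => 0) 1 * flip M u * chiralProj T i k *
      (chiralProj T i k' * (flip M v * M (fun _ => 0) 1)) =
      M (fun _ => 0) 1 * flip M u * (chiralProj T i k * chiralProj T i k') *
        (flip M v * M (fun _ => 0) 1) := by noncomm_ring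
  dsimp only
  rw [h1, h.chiralProj_mul]
  by_cases hk : k = k'
  · rw [if_pos hk]
    have h2 : M (fun _ => 0) 1 * flip M u * chiralProj T i k * (flip M v * M (fun _ => 0) 1) =
        flip M (u + v) * (M (fun _ => 0) (fun i => bitSign ((u + v) i)) * M (fun _ => 0) 1) *
          chiralProj T i k := by
      calc _ = M (fun _ => 0) 1 * flip M u * (chiralProj T i k * flip M v) * M (fun _ => 0) 1 := by
            noncomm_ring
        _ = M (fun _ => 0) 1 * (flip M u * flip M v) * (chiralProj T i k * M (fun _ => 0) 1) := by
            rw [hQv.eq]; noncomm_ring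
        _ = (M (fun _ => 0) 1 * flip M (u + v)) * M (fun _ => 0) 1 * chiralProj T i k := by
            rw [hQP.eq, h.flip_add]; noncomm_ring
        _ = _ := by rw [h.ground_mul_flip]; noncomm_ring
    rw [h2, h.orth (fun _ => 0)]
    by_cases huv : u = v
    · subst huv
      have : (fun i => bitSign ((u + u) i)) = (1 : Signs n) := by
        funext i; rw [qubits_add_self]; rfl
      rw [this, if_pos rfl, if_pos (by rw [hk]), qubits_add_self, h.flip_zero, one_mul]
    · rw [if_neg, if_neg]
      · simp
      · simp [huv]
      · intro he
        apply huv
        have h0 : u + v = 0 := by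
          apply bitSign_bijective.1
          refine he.trans ?_
          funext i
          simp [bitSign]
        calc u = u + (v + v) := by rw [qubits_add_self, add_zero]
          _ = v := by rw [← add_assoc, h0, zero_add]
  · rw [if_neg hk, if_neg (by simp [hk])]
    simp

/-- The swap isometry turns the observables into Pauli matrices or their transposes. -/
theorem swapBlock_mul_obs (h : IsPauliFamily ρ M T) (i₀ : Fin n) (k : Fin 2) (u : Qubits n)
    (i : Fin n) (t : Fin 3) :
    swapBlock M T i₀ (k, u) * T i t = ∑ v, siteOp i (if k = 0 then pauli t else (pauli t)ᵀ) u v •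
      swapBlock M T i₀ (k, v) := by
  have hQ : ∀ j t, Commute (chiralProj T i₀ k) (T j t) := fun j t =>
    chiralProj_commute_of i₀ k (h.chirality_commute i₀ j t)
  have h0 : ∀ u, swapBlock M T i₀ (k, u) * T i 0 =
      ((bitSign (u i) : ℤ) : ℂ) • swapBlock M T i₀ (k, u) := by
    intro u
    have hc : ((bitSign (u i) : ℤ) : ℂ) * ((bitSign (u i) : ℤ) : ℂ) = 1 := by
      rcases Int.units_eq_one_or (bitSign (u i)) with h | h <;> rw [h] <;> simp
    have hz : flip M u * T i 0 = ((bitSign (u i) : ℤ) : ℂ) • (T i 0 * flip M u) := by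
      rw [h.zObs_mul_flip, smul_smul, hc, one_smul]
    have hg := h.mul_obs (fun _ => 0) i 1
    simp only [Pi.one_apply, Units.val_one, Int.cast_one, one_smul] at hg
    calc swapBlock M T i₀ (k, u) * T i 0
        = M (fun _ => 0) 1 * flip M u * (chiralProj T i₀ k * T i 0) := by
          rw [swapBlock]; noncomm_ring
      _ = M (fun _ => 0) 1 * (flip M u * T i 0) * chiralProj T i₀ k := by
          rw [(hQ i 0).eq]; noncomm_ring
      _ = ((bitSign (u i) : ℤ) : ℂ) • ((M (fun _ => 0) 1 * T i 0) * flip M u *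
            chiralProj T i₀ k) := by
          rw [hz, Matrix.mul_smul, Matrix.smul_mul]; congr 1; noncomm_ring
      _ = _ := by rw [hg, swapBlock]
  have h1 : ∀ u, swapBlock M T i₀ (k, u) * T i 1 = swapBlock M T i₀ (k, u + Pi.single i 1) := by
    intro u
    calc swapBlock M T i₀ (k, u) * T i 1
        = M (fun _ => 0) 1 * flip M u * (chiralProj T i₀ k * T i 1) := by
          rw [swapBlock]; noncomm_ring
      _ = M (fun _ => 0) 1 * (flip M u * T i 1) * chiralProj T i₀ k := by
          rw [(hQ i 1).eq]; noncomm_ring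
      _ = _ := by rw [← h.flip_single, ← h.flip_add, swapBlock]
  -- On the range of `Q_k` the chirality is the number `(-1)^k`.
  have hQk : ∀ u, swapBlock M T i₀ (k, u) * chirality T i =
      ((bitSign k : ℤ) : ℂ) • swapBlock M T i₀ (k, u) := by
    intro u
    rw [swapBlock, Matrix.mul_assoc, h.chirality_eq i i₀, ← Matrix.mul_smul]
    congr 1
    have hc : ((bitSign k : ℤ) : ℂ) * ((bitSign k : ℤ) : ℂ) = 1 := by
      rcases Int.units_eq_one_or (bitSign k) with h | h <;> rw [h] <;> simp
    simp only [chiralProj, Matrix.smul_mul, add_mul, one_mul, h.chirality_mul_self, smul_add,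
      smul_smul]
    have e : ((bitSign k : ℤ) : ℂ) * (1 / 2 * ((bitSign k : ℤ) : ℂ)) = 1 / 2 := by
      linear_combination hc / 2
    rw [e]
    module
  -- The analogue of `σ_y = i σ_x σ_z`, with the chirality as an extra sign; it reduces Y to the
  -- cases Z and X.
  have h2 : T i 2 = Complex.I • (chirality T i * (T i 1 * T i 0)) := by
    have e1 : T i 0 * T i 1 * T i 2 = T i 2 * (T i 0 * T i 1) := by
      calc T i 0 * T i 1 * T i 2 = T i 0 * (T i 1 * T i 2) := by noncomm_ring
        _ = -((T i 0 * T i 2) * T i 1) := by rw [h.anti i 1 2 (by decide)]; noncomm_ring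
        _ = _ := by rw [h.anti i 0 2 (by decide)]; noncomm_ring
    have e2 : T i 2 * (T i 0 * T i 1) * (T i 1 * T i 0) = T i 2 := by
      calc T i 2 * (T i 0 * T i 1) * (T i 1 * T i 0)
          = T i 2 * (T i 0 * (T i 1 * T i 1) * T i 0) := by noncomm_ring
        _ = T i 2 := by rw [h.sq, Matrix.mul_one, h.sq, Matrix.mul_one]
    rw [chirality, Matrix.smul_mul, smul_smul, e1, e2]
    simp
  have s0 : ∀ u, swapBlock M T i₀ (k, u) * T i 0 =
      ∑ v, siteOp i (pauli 0) u v • swapBlock M T i₀ (k, v) := by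
    intro u
    simp [h0, siteOp_pauli_zero_apply]
  have s1 : ∀ u, swapBlock M T i₀ (k, u) * T i 1 =
      ∑ v, siteOp i (pauli 1) u v • swapBlock M T i₀ (k, v) := by
    intro u
    simp [h1, siteOp_pauli_one_apply]
  have s2 : ∀ u, swapBlock M T i₀ (k, u) * T i 2 =
      ∑ v, siteOp i (((bitSign k : ℤ) : ℂ) • pauli 2) u v • swapBlock M T i₀ (k, v) := by
    intro u
    rw [h2, Matrix.mul_smul, ← Matrix.mul_assoc, hQk, Matrix.smul_mul, ← Matrix.mul_assoc, s1,
      Finset.sum_mul, pauli_two_eq, siteOp_smul, siteOp_smul, ← siteOp_mul]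
    simp only [Matrix.smul_mul, s0, Matrix.smul_apply, Matrix.mul_apply, Finset.smul_sum,
      smul_smul, smul_eq_mul, Finset.sum_smul, Finset.mul_sum]
    rw [Finset.sum_comm]
    refine Finset.sum_congr rfl fun v _ => Finset.sum_congr rfl fun w _ => ?_
    congr 1
    ring
  have t0 : (pauli 0)ᵀ = pauli 0 := by
    ext a b; fin_cases a <;> fin_cases b <;> simp [pauli]
  have t1 : (pauli 1)ᵀ = pauli 1 := by
    ext a b; fin_cases a <;> fin_cases b <;> simp [pauli]
  have t2 : (pauli 2)ᵀ = -pauli 2 := by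
    ext a b; fin_cases a <;> fin_cases b <;> simp [pauli]
  -- Transposition fixes `σ_z` and `σ_x` and negates `σ_y`, which is precisely the effect of the
  -- chirality sign.
  have hcase : (if k = 0 then pauli t else (pauli t)ᵀ) =
      if t = 2 then ((bitSign k : ℤ) : ℂ) • pauli 2 else pauli t := by
    fin_cases k <;> fin_cases t <;> simp [bitSign, t0, t1, t2]
  rw [hcase]
  fin_cases t
  · exact s0 u
  · exact s1 u
  · exact s2 u

/-- The swap isometry turns the measurements into Pauli measurements or their transposes. -/
theorem swapBlock_mul_meas (h : IsPauliFamily ρ M T) (i₀ : Fin n) (k : Fin 2) (u : Qubits n)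
    (z : PauliInput n) (c : Signs n) :
    swapBlock M T i₀ (k, u) * M z c =
      ∑ v, (if k = 0 then pauliProj z c else (pauliProj z c)ᵀ) u v • swapBlock M T i₀ (k, v) := by
  -- The blocks with fixed `k` are stacked into one operator, to which the intertwining lemma
  -- applies.
  let L : Matrix (Qubits n × C) C ℂ := Matrix.of fun p b => swapBlock M T i₀ (k, p.1) p.2 b
  have hL : ∀ X : Matrix C C ℂ, L * X = Matrix.of fun p b =>
      (swapBlock M T i₀ (k, p.1) * X) p.2 b := fun X => by
    ext p b
    simp [L, Matrix.mul_apply]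
  have hL' : ∀ S : Matrix (Qubits n) (Qubits n) ℂ, (S ⊗ₖ (1 : Matrix C C ℂ)) * L =
      Matrix.of fun p b => (∑ v, S p.1 v • swapBlock M T i₀ (k, v)) p.2 b := fun S => by
    ext p b
    simp [L, Matrix.mul_apply, Fintype.sum_prod_type, Matrix.sum_apply, Matrix.one_apply]
  have key := intertwine_of_signs (M := M z)
    (M' := fun c => (if k = 0 then pauliProj z c else (pauliProj z c)ᵀ) ⊗ₖ (1 : Matrix C C ℂ))
    (S := fun i => T i (z i))
    (S' := fun i => siteOp i (if k = 0 then pauli (z i) else (pauli (z i))ᵀ) ⊗ₖ (1 : Matrix C C ℂ))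
    (L := L) (h.povm z).2 ?_ (h.obs_mul z) ?_ ?_ c
  · rw [hL, hL'] at key
    ext a b
    exact (congrFun (congrFun key (u, a)) b).symm
  · rw [sum_kronecker]
    split_ifs
    · rw [(isPOVM_pauliProj z).2, Matrix.one_kronecker_one]
    · rw [sum_transpose_pauliProj, Matrix.one_kronecker_one]
  · intro i c
    rw [kron_one_mul_kron_one, ← Matrix.smul_kronecker]
    congr 1
    split_ifs
    · exact pauliProj_mul_siteOp z c i
    · exact transpose_pauliProj_mul_siteOp z c i
  · intro i
    rw [hL, hL']
    ext p b
    rw [Matrix.of_apply, Matrix.of_apply, h.swapBlock_mul_obs]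

/-- The swap isometry of the other party, obtained by moving the adjoint blocks. -/
theorem exists_partner (h : IsPauliFamily ρ M T) (i : Fin n) :
    ∃ R : Fin 2 × Qubits n → Matrix A A ℂ,
      ((1 : Matrix C C ℂ) ⊗ₖ (∑ j, (R j)ᴴ * R j)) * ρ = ρ ∧
      ∀ j l, (swapBlock M T i j ⊗ₖ R l) * ρ =
        if j = l then ((M (fun _ => 0) 1 * chiralProj T i j.1) ⊗ₖ (1 : Matrix A A ℂ)) * ρ else 0 := by
  have hT : ∀ i t, ∃ Y, Transfers ρ (T i t) Y := by
    intro i t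
    obtain ⟨R, hR, e⟩ := h.transfer i t
    exact ⟨R, e, by rw [(h.isHermitian i t).eq, hR.eq, e]⟩
  have hmul : ∀ X X' : Matrix C C ℂ, (∃ Y, Transfers ρ X Y) → (∃ Y, Transfers ρ X' Y) →
      ∃ Y, Transfers ρ (X * X') Y := fun X X' ⟨Y, hY⟩ ⟨Y', hY'⟩ => ⟨Y' * Y, hY.mul hY'⟩
  have hadd : ∀ X X' : Matrix C C ℂ, (∃ Y, Transfers ρ X Y) → (∃ Y, Transfers ρ X' Y) →
      ∃ Y, Transfers ρ (X + X') Y := fun X X' ⟨Y, hY⟩ ⟨Y', hY'⟩ => ⟨Y + Y', hY.add hY'⟩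
  have hsmul : ∀ (a : ℂ) (X : Matrix C C ℂ), (∃ Y, Transfers ρ X Y) →
      ∃ Y, Transfers ρ (a • X) Y := fun a X ⟨Y, hY⟩ => ⟨a • Y, hY.smul a⟩
  have hone : ∃ Y, Transfers ρ (1 : Matrix C C ℂ) Y := ⟨1, transfers_one ρ⟩
  have hmeas : ∀ z f, ∃ Y, Transfers ρ (signSum (M z) f) Y := fun z f =>
    signSum_induction (h.povm z).2 (h.orth z) (fun X => ∃ Y, Transfers ρ X Y) hone hmul hadd hsmul
      (fun i => by rw [h.obs]; exact hT i (z i)) f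
  have hchir : ∀ k, ∃ Y, Transfers ρ (chiralProj T i k) Y := fun k =>
    hsmul _ _ (hadd _ _ hone (hsmul _ _ (hsmul _ _ (hmul _ _ (hmul _ _ (hT _ _) (hT _ _))
      (hT _ _)))))
  -- The blocks are polynomials in the observables and can be moved. It is their adjoints that
  -- define Alice's operators, so that `W_j ⊗ R_l` acts like `W_j W_l†`.
  have hW : ∀ j, ∃ Y, Transfers ρ (swapBlock M T i j)ᴴ Y := by
    intro j
    have hg := hmeas (fun _ => 0) (fun d => if d = 1 then 1 else 0)
    rw [signSum_single] at hg
    obtain ⟨Y, hY⟩ := hmul _ _ (hmul _ _ hg (hmeas _ (signChar j.2))) (hchir j.1)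
    exact ⟨Yᴴ, hY.conjTranspose⟩
  choose R hR using hW
  -- Both claims follow by moving back: `R_j† R_j` becomes `W_j† W_j`, with sum 1, and `W_j ⊗ R_l`
  -- becomes `W_j W_l†`.
  refine ⟨R, ?_, fun j l => ?_⟩
  · have h1 : ∀ j, ((1 : Matrix C C ℂ) ⊗ₖ ((R j)ᴴ * R j)) * ρ =
        (((swapBlock M T i j)ᴴ * swapBlock M T i j) ⊗ₖ (1 : Matrix A A ℂ)) * ρ := by
      intro j
      have := ((hR j).mul (hR j).conjTranspose).1
      rw [Matrix.conjTranspose_conjTranspose] at this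
      exact this.symm
    rw [← kronecker_sum, Finset.sum_mul, Finset.sum_congr rfl fun j _ => h1 j, ← Finset.sum_mul,
      sum_kronecker, h.sum_swapBlock, Matrix.one_kronecker_one, Matrix.one_mul]
  · rw [← kron_one_mul_one_kron, Matrix.mul_assoc, ← (hR l).1, ← Matrix.mul_assoc,
      kron_one_mul_kron_one, h.swapBlock_mul_conjTranspose]
    split_ifs
    · rfl
    · simp

end IsPauliFamily

end DICert

namespace DICert

/-! ## The self-test of the auxiliary states -/

section SelfTest

variable {n : ℕ}

theorem onAncilla_eq_mul {C : Type} [Fintype C] [DecidableEq C]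
    (U : Matrix (C × Fin 2 × Qubits n) (C × Fin 2 × Qubits n) ℂ) :
    onAncilla U =
      U * onAncilla (1 : Matrix (C × Fin 2 × Qubits n) (C × Fin 2 × Qubits n) ℂ) := by
  ext p c
  simp [onAncilla, Matrix.mul_apply, Matrix.one_apply]

theorem onAncilla_isometry {C : Type} [Fintype C] [DecidableEq C]
    {U : Matrix (C × Fin 2 × Qubits n) (C × Fin 2 × Qubits n) ℂ}
    (hU : U ∈ Matrix.unitaryGroup (C × Fin 2 × Qubits n) ℂ) :
    (onAncilla U)ᴴ * onAncilla U = 1 := by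
  have h := Matrix.mem_unitaryGroup_iff'.mp hU
  have : (onAncilla U)ᴴ * onAncilla U =
      (star U * U).submatrix (fun c => (c, 0, 0)) (fun c => (c, 0, 0)) := rfl
  rw [this, h]
  ext i j
  simp [Matrix.one_apply]

theorem onAncilla_one_isometry {C : Type} [Fintype C] [DecidableEq C] :
    (onAncilla (1 : Matrix (C × Fin 2 × Qubits n) (C × Fin 2 × Qubits n) ℂ))ᴴ *
      onAncilla (1 : Matrix (C × Fin 2 × Qubits n) (C × Fin 2 × Qubits n) ℂ) = 1 :=
  onAncilla_isometry (one_mem _)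

/-- A projector `J Jᴴ` that fixes an effect's compression being projective commutes with it. -/
theorem mul_isometry_eq_of_compression_sq {C r : Type} [Fintype C] [DecidableEq C] [Fintype r]
    [DecidableEq r] {E : Matrix C C ℂ} (hE : E.PosSemidef) (hE' : (1 - E).PosSemidef)
    {J : Matrix C r ℂ} (hJ : Jᴴ * J = 1) (h : (Jᴴ * E * J) * (Jᴴ * E * J) = Jᴴ * E * J) :
    E * J = J * (Jᴴ * E * J) := by
  set D := E * J - J * (Jᴴ * E * J) with hD
  -- `D†D = -J†E(1-E)J` is both positive and negative semidefinite, so `D = 0`.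
  have h1 : Dᴴ * D = Jᴴ * E * E * J - Jᴴ * E * J := by
    have hDh : Dᴴ = Jᴴ * E - (Jᴴ * E * J) * Jᴴ := by
      rw [hD]
      simp only [Matrix.conjTranspose_sub, Matrix.conjTranspose_mul,
        Matrix.conjTranspose_conjTranspose, hE.1.eq, Matrix.mul_assoc]
    have e1 : (Jᴴ * E * J) * Jᴴ * (J * (Jᴴ * E * J)) = Jᴴ * E * J := by
      calc (Jᴴ * E * J) * Jᴴ * (J * (Jᴴ * E * J)) = (Jᴴ * E * J) * (Jᴴ * J) * (Jᴴ * E * J) := by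
            simp only [Matrix.mul_assoc]
        _ = _ := by rw [hJ, Matrix.mul_one, h]
    have e2 : Jᴴ * E * (J * (Jᴴ * E * J)) = Jᴴ * E * J := by
      rw [← Matrix.mul_assoc, h]
    have e3 : (Jᴴ * E * J) * Jᴴ * (E * J) = Jᴴ * E * J := by
      calc (Jᴴ * E * J) * Jᴴ * (E * J) = (Jᴴ * E * J) * (Jᴴ * E * J) := by
            simp only [Matrix.mul_assoc]
        _ = _ := h
    rw [hDh, hD, Matrix.sub_mul, Matrix.mul_sub, Matrix.mul_sub, e1, e2, e3]
    simp only [Matrix.mul_assoc]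
    abel
  have h2 : (-(Dᴴ * D)).PosSemidef := by
    have := (posSemidef_mul_of_add_eq_one hE hE' (by abel)).conjTranspose_mul_mul_same J
    rw [h1]
    convert this using 1
    rw [Matrix.mul_sub, Matrix.mul_one, Matrix.mul_sub, Matrix.sub_mul]
    simp only [Matrix.mul_assoc]
    abel
  have h3 : Dᴴ * D = 0 := by
    have p1 := (Matrix.posSemidef_conjTranspose_mul_self D).trace_nonneg
    have p2 := h2.trace_nonneg
    rw [Matrix.trace_neg, Left.nonneg_neg_iff] at p2
    exact (Matrix.posSemidef_conjTranspose_mul_self D).trace_eq_zero_iff.mp (le_antisymm p2 p1)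
  rw [Matrix.conjTranspose_mul_self_eq_zero, hD, sub_eq_zero] at h3
  exact h3

/-- Operators on the second system that agree in the Gram sense on `ρ` agree up to a unitary. -/
theorem exists_unitary_onAncilla {r A : Type} [Fintype r] [DecidableEq r] [Fintype A]
    [DecidableEq A] {ρ : Matrix (r × A) (r × A) ℂ} {V : Matrix (A × Fin 2 × Qubits n) A ℂ}
    (hV : ((1 : Matrix r r ℂ) ⊗ₖ (Vᴴ * V)) * ρ = ρ) :
    ∃ U ∈ Matrix.unitaryGroup (A × Fin 2 × Qubits n) ℂ,
      ((1 : Matrix r r ℂ) ⊗ₖ onAncilla U) * ρ = ((1 : Matrix r r ℂ) ⊗ₖ V) * ρ := by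
  -- The state reshaped with the index of `A` alone as row index. `V` is an isometry only on its
  -- range, so `V ρt` and the embedded `ρt` have equal Gram matrices and are related by a unitary.
  let ρt : Matrix A (r × (r × A)) ℂ := Matrix.of fun a p => ρ (p.1, a) p.2
  have hY : ∀ {κ : Type} (Y : Matrix κ A ℂ) (p : r × κ) (q : r × A),
      (((1 : Matrix r r ℂ) ⊗ₖ Y) * ρ) p q = (Y * ρt) p.2 (p.1, q) := by
    intro κ Y p q
    simp [Matrix.mul_apply, Fintype.sum_prod_type, ρt, Matrix.one_apply]
  have h1 : Vᴴ * V * ρt = ρt := by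
    ext a p
    rw [← hY (Vᴴ * V) (p.1, a) p.2, hV]
    rfl
  obtain ⟨U, hU, e⟩ := exists_unitary_mul_eq
    (onAncilla (1 : Matrix (A × Fin 2 × Qubits n) (A × Fin 2 × Qubits n) ℂ) * ρt) (V * ρt) (by
      rw [Matrix.conjTranspose_mul, Matrix.conjTranspose_mul, Matrix.mul_assoc,
        ← Matrix.mul_assoc (onAncilla _)ᴴ, onAncilla_one_isometry, Matrix.one_mul,
        Matrix.mul_assoc, ← Matrix.mul_assoc Vᴴ, h1])
  refine ⟨U, hU, ?_⟩
  ext p q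
  rw [hY, hY, ← e, ← Matrix.mul_assoc, ← onAncilla_eq_mul]

theorem controlledTranspose_apply (C : Type) [DecidableEq C]
    (π : Matrix (Qubits n) (Qubits n) ℂ) (p q : C × Fin 2 × Qubits n) :
    controlledTranspose C π p q = if p.1 = q.1 ∧ p.2.1 = q.2.1 then
      (if p.2.1 = 0 then π else πᵀ) p.2.2 q.2.2 else 0 := by
  obtain ⟨a, k, u⟩ := p
  obtain ⟨b, l, v⟩ := q
  by_cases hab : a = b
  · fin_cases k <;> fin_cases l <;>
      simp [controlledTranspose, hab]
  · simp [controlledTranspose, hab]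

/-- The local maps have the blocks `J W_j` and `R_j`. The image of `ρ'` is supported on equal labels
`j` of the two parties and is constant in the string part of the label, so it splits into a junk
state and a maximally entangled state. The intertwining of the blocks `W_j` carries `M` to the
controlled Pauli measurement. -/
theorem selfTestsPauli_of_family {C A r : Type} [Fintype C] [Fintype A] [DecidableEq C]
    [DecidableEq A] [Fintype r] [DecidableEq r] {ρ' : Matrix (r × A) (r × A) ℂ}
    (hρ' : IsState ρ') {J : Matrix C r ℂ} (hJ : Jᴴ * J = 1)
    {M : PauliInput n → Signs n → Matrix C C ℂ} {M' : PauliInput n → Signs n → Matrix r r ℂ}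
    (hM : ∀ z c, M z c * J = J * M' z c) {T : Fin n → Fin 3 → Matrix r r ℂ}
    (h : IsPauliFamily ρ' M' T) (i : Fin n) :
    SelfTestsPauli ((J ⊗ₖ (1 : Matrix A A ℂ)) * ρ' * (J ⊗ₖ (1 : Matrix A A ℂ))ᴴ) M := by
  obtain ⟨R, hR1, hR2⟩ := h.exists_partner i
  set W := IsPauliFamily.swapBlock M' T i with hW
  let VC : Matrix (C × Fin 2 × Qubits n) r ℂ := Matrix.of fun p a => (J * W p.2) p.1 a
  let VA : Matrix (A × Fin 2 × Qubits n) A ℂ := Matrix.of fun p b => R p.2 p.1 b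
  have hVC : VCᴴ * VC = 1 := by
    have : VCᴴ * VC = ∑ j, (J * W j)ᴴ * (J * W j) := by
      ext a b
      rw [Matrix.sum_apply]
      simp only [Matrix.mul_apply, Fintype.sum_prod_type_right, Matrix.conjTranspose_apply,
        Matrix.of_apply, VC]
    rw [this, ← h.sum_swapBlock i]
    refine Finset.sum_congr rfl fun j _ => ?_
    rw [Matrix.conjTranspose_mul, Matrix.mul_assoc, ← Matrix.mul_assoc Jᴴ, hJ, Matrix.one_mul]
  have hVA : VAᴴ * VA = ∑ j, (R j)ᴴ * R j := by
    ext a b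
    rw [Matrix.sum_apply]
    simp only [Matrix.mul_apply, Fintype.sum_prod_type_right, Matrix.conjTranspose_apply,
      Matrix.of_apply, VA]
  obtain ⟨UC, hUC, eC⟩ := exists_unitary_mul_eq
    (onAncilla (1 : Matrix (C × Fin 2 × Qubits n) (C × Fin 2 × Qubits n) ℂ) * J) VC (by
      rw [Matrix.conjTranspose_mul, Matrix.mul_assoc, ← Matrix.mul_assoc (onAncilla _)ᴴ,
        onAncilla_one_isometry, Matrix.one_mul, hJ, hVC])
  rw [← Matrix.mul_assoc, ← onAncilla_eq_mul] at eC
  obtain ⟨UA, hUA, eA⟩ := exists_unitary_onAncilla (n := n) (V := VA) (by rw [hVA]; exact hR1)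
  -- The part of the map that is left when the strings are factored out; it vanishes unless the
  -- control qubits agree.
  let B : Matrix ((C × Fin 2) × (A × Fin 2)) (r × A) ℂ := Matrix.of fun p q =>
    if p.1.2 = p.2.2 then ((J * (M' (fun _ => 0) 1 * IsPauliFamily.chiralProj T i p.1.2)) ⊗ₖ
      (1 : Matrix A A ℂ)) (p.1.1, p.2.1) q else 0
  -- The factor `2^n` is the norm squared of `∑_u |uu⟩`, by which `maxEnt` is normalised.
  let ξ : Matrix ((C × Fin 2) × (A × Fin 2)) ((C × Fin 2) × (A × Fin 2)) ℂ :=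
    (2 ^ n : ℂ) • (B * ρ' * Bᴴ)
  have hξ : ξ.PosSemidef := by
    refine (hρ'.1.mul_mul_conjTranspose_same B).smul ?_
    exact_mod_cast (by positivity : (0 : ℝ) ≤ 2 ^ n)
  have hYρ : ∀ p q, ((VC ⊗ₖ VA) * ρ') p q = if p.1.2.2 = p.2.2.2 then
      (B * ρ') ((p.1.1, p.1.2.1), (p.2.1, p.2.2.1)) q else 0 := by
    intro p q
    have h1 : ((VC ⊗ₖ VA) * ρ') p q =
        ((J ⊗ₖ (1 : Matrix A A ℂ)) * ((W p.1.2 ⊗ₖ R p.2.2) * ρ')) (p.1.1, p.2.1) q := by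
      rw [← Matrix.mul_assoc, kron_mul_kron, Matrix.one_mul]
      simp [Matrix.mul_apply, VC, VA]
    have h2 : (B * ρ') ((p.1.1, p.1.2.1), (p.2.1, p.2.2.1)) q = if p.1.2.1 = p.2.2.1 then
        (((J * (M' (fun _ => 0) 1 * IsPauliFamily.chiralProj T i p.1.2.1)) ⊗ₖ
          (1 : Matrix A A ℂ)) * ρ') (p.1.1, p.2.1) q else 0 := by
      by_cases hk : p.1.2.1 = p.2.2.1 <;> simp [Matrix.mul_apply, B, hk]
    rw [h1, hR2, h2]
    by_cases hu : p.1.2.2 = p.2.2.2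
    · by_cases hk : p.1.2.1 = p.2.2.1
      · rw [if_pos (Prod.ext hk hu), if_pos hu, if_pos hk, ← Matrix.mul_assoc, kron_mul_kron,
          Matrix.one_mul]
      · rw [if_neg (fun e => hk (congrArg Prod.fst e)), if_pos hu, if_neg hk]
        simp
    · rw [if_neg (fun e => hu (congrArg Prod.snd e)), if_neg hu]
      simp
  have hΩ : (VC ⊗ₖ VA) * ρ' * (VC ⊗ₖ VA)ᴴ = (ξ ⊗ₖ maxEnt (Qubits n)).submatrix
      (fun i => (((i.1.1, i.1.2.1), (i.2.1, i.2.2.1)), (i.1.2.2, i.2.2.2)))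
      (fun i => (((i.1.1, i.1.2.1), (i.2.1, i.2.2.1)), (i.1.2.2, i.2.2.2))) := by
    have h1 : ∀ p q, ((VC ⊗ₖ VA) * ρ' * (VC ⊗ₖ VA)ᴴ) p q = if p.1.2.2 = p.2.2.2 then
        (B * (ρ' * (VC ⊗ₖ VA)ᴴ)) ((p.1.1, p.1.2.1), (p.2.1, p.2.2.1)) q else 0 := by
      intro p q
      rw [Matrix.mul_apply]
      simp only [hYρ]
      split_ifs
      · rw [← Matrix.mul_assoc, Matrix.mul_apply]
      · simp
    have h2 : ∀ p q, (ρ' * (VC ⊗ₖ VA)ᴴ) p q = if q.1.2.2 = q.2.2.2 then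
        (ρ' * Bᴴ) p ((q.1.1, q.1.2.1), (q.2.1, q.2.2.1)) else 0 := by
      intro p q
      have e1 : ρ' * (VC ⊗ₖ VA)ᴴ = ((VC ⊗ₖ VA) * ρ')ᴴ := by
        rw [Matrix.conjTranspose_mul, hρ'.1.1.eq]
      have e2 : ρ' * Bᴴ = (B * ρ')ᴴ := by
        rw [Matrix.conjTranspose_mul, hρ'.1.1.eq]
      rw [e1, e2, Matrix.conjTranspose_apply, Matrix.conjTranspose_apply, hYρ]
      split_ifs <;> simp
    ext p q
    rw [h1, Matrix.submatrix_apply, Matrix.kroneckerMap_apply]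
    have h3 : (B * (ρ' * (VC ⊗ₖ VA)ᴴ)) ((p.1.1, p.1.2.1), (p.2.1, p.2.2.1)) q =
        if q.1.2.2 = q.2.2.2 then (B * ρ' * Bᴴ) ((p.1.1, p.1.2.1), (p.2.1, p.2.2.1))
          ((q.1.1, q.1.2.1), (q.2.1, q.2.2.1)) else 0 := by
      rw [Matrix.mul_apply]
      simp only [h2]
      split_ifs
      · rw [Matrix.mul_assoc, Matrix.mul_apply]
      · simp
    rw [h3]
    have hcard : (Fintype.card (Qubits n) : ℂ) = 2 ^ n := by simp
    have h2n : (2 ^ n : ℂ) ≠ 0 := by positivity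
    by_cases hp : p.1.2.2 = p.2.2.2 <;> by_cases hq : q.1.2.2 = q.2.2.2 <;>
      simp [hp, hq, maxEnt, ξ, h2n, mul_comm]
  have htr : ξ.trace = 1 := by
    have h1 := congrArg Matrix.trace hΩ
    have h2 : ((VC ⊗ₖ VA) * ρ' * (VC ⊗ₖ VA)ᴴ).trace = 1 := by
      rw [Matrix.trace_mul_comm, Matrix.conjTranspose_kronecker, ← Matrix.mul_assoc,
        kron_mul_kron, hVC, hVA, hR1, hρ'.2]
    have h3 : ((ξ ⊗ₖ maxEnt (Qubits n)).submatrix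
        (fun i : (C × Fin 2 × Qubits n) × (A × Fin 2 × Qubits n) =>
          (((i.1.1, i.1.2.1), (i.2.1, i.2.2.1)), (i.1.2.2, i.2.2.2)))
        (fun i => (((i.1.1, i.1.2.1), (i.2.1, i.2.2.1)), (i.1.2.2, i.2.2.2)))).trace =
        (ξ ⊗ₖ maxEnt (Qubits n)).trace := by
      let e : ((C × Fin 2 × Qubits n) × (A × Fin 2 × Qubits n)) ≃
          ((C × Fin 2) × (A × Fin 2)) × (Qubits n × Qubits n) :=
        { toFun := fun i => (((i.1.1, i.1.2.1), (i.2.1, i.2.2.1)), (i.1.2.2, i.2.2.2))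
          invFun := fun j => ((j.1.1.1, j.1.1.2, j.2.1), (j.1.2.1, j.1.2.2, j.2.2))
          left_inv := fun _ => rfl
          right_inv := fun _ => rfl }
      exact Fintype.sum_equiv e _ _ fun _ => rfl
    have h4 : (maxEnt (Qubits n)).trace = 1 := by
      simp [maxEnt, Matrix.trace, Fintype.sum_prod_type]
    rw [h2, h3, Matrix.trace_kronecker, h4, mul_one] at h1
    exact h1.symm
  have hctrl : ∀ z c, controlledTranspose C (pauliProj z c) * VC = VC * M' z c := by
    intro z c
    ext p b
    obtain ⟨a, k, u⟩ := p
    have h1 : (VC * M' z c) (a, k, u) b = (J * (W (k, u) * M' z c)) a b := by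
      rw [← Matrix.mul_assoc]
      simp only [Matrix.mul_apply, VC, Matrix.of_apply]
    rw [h1, hW, h.swapBlock_mul_meas i k u z c]
    rw [Matrix.mul_apply]
    simp only [controlledTranspose_apply, Fintype.sum_prod_type, ite_mul, zero_mul, VC,
      Matrix.of_apply]
    rw [Finset.sum_eq_single a (fun x _ hx => by simp [hx.symm]) (by simp),
      Finset.sum_eq_single k (fun x _ hx => by simp [hx.symm]) (by simp)]
    simp only [and_self, if_true, Matrix.mul_sum, Matrix.mul_smul, Matrix.sum_apply,
      Matrix.smul_apply, smul_eq_mul]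
    rfl
  refine ⟨UC, hUC, UA, hUA, ξ, ⟨hξ, htr⟩, ?_, ?_⟩
  · intro p q hpq
    simp [ξ, B, Matrix.mul_apply, hpq]
  · intro z c
    -- The unitary of Alice agrees with her block map only after application to the state.
    have key : ∀ X : Matrix (C × Fin 2 × Qubits n) r ℂ,
        (X ⊗ₖ onAncilla UA) * ρ' = (X ⊗ₖ VA) * ρ' := by
      intro X
      have e : ∀ Y : Matrix (A × Fin 2 × Qubits n) A ℂ, X ⊗ₖ Y =
          (X ⊗ₖ (1 : Matrix (A × Fin 2 × Qubits n) (A × Fin 2 × Qubits n) ℂ)) *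
            ((1 : Matrix r r ℂ) ⊗ₖ Y) := fun Y => by
        rw [kron_mul_kron, Matrix.mul_one, Matrix.one_mul]
      rw [e, Matrix.mul_assoc, eA, ← Matrix.mul_assoc, ← e]
    calc (onAncilla UC ⊗ₖ onAncilla UA) * ((M z c ⊗ₖ (1 : Matrix A A ℂ)) *
            ((J ⊗ₖ (1 : Matrix A A ℂ)) * ρ' * (J ⊗ₖ (1 : Matrix A A ℂ))ᴴ)) *
          (onAncilla UC ⊗ₖ onAncilla UA)ᴴ
        = ((onAncilla UC ⊗ₖ onAncilla UA) * ((M z c ⊗ₖ (1 : Matrix A A ℂ)) *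
            (J ⊗ₖ (1 : Matrix A A ℂ))) * ρ') * ((onAncilla UC ⊗ₖ onAncilla UA) *
              (J ⊗ₖ (1 : Matrix A A ℂ)))ᴴ := by
          rw [Matrix.conjTranspose_mul (onAncilla UC ⊗ₖ onAncilla UA)]
          simp only [Matrix.mul_assoc]
      _ = ((VC * M' z c) ⊗ₖ VA) * ρ' * (VC ⊗ₖ onAncilla UA)ᴴ := by
          rw [kron_mul_kron, kron_mul_kron, kron_mul_kron, hM, ← Matrix.mul_assoc, eC]
          simp only [Matrix.mul_one]
          rw [key]
      _ = ((VC * M' z c) ⊗ₖ VA) * (ρ' * (VC ⊗ₖ VA)ᴴ) := by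
          have e1 : ∀ Y : Matrix (A × Fin 2 × Qubits n) A ℂ,
              ρ' * (VC ⊗ₖ Y)ᴴ = ((VC ⊗ₖ Y) * ρ')ᴴ := fun Y => by
            rw [Matrix.conjTranspose_mul, hρ'.1.1.eq]
          rw [Matrix.mul_assoc, e1, e1, key]
      _ = _ := by
          rw [← hctrl, ← hΩ, ← Matrix.mul_assoc, ← Matrix.mul_assoc, ← Matrix.mul_assoc,
            kron_mul_kron, Matrix.one_mul]

/-- The self-test: maximal violation of the triple CHSH inequalities and the Bell correlations
certify Pauli measurements on maximally entangled states. -/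
theorem selfTestsPauli_of_pairSelfTest {C A : Type} [Fintype C] [Fintype A] [DecidableEq C]
    [DecidableEq A] (hn : 1 ≤ n) {ρ : Matrix (C × A) (C × A) ℂ} (hρ : IsState ρ)
    {M : PauliInput n → Signs n → Matrix C C ℂ}
    {N : (x : NodeInput n) → NodeOutput n x → Matrix A A ℂ}
    (hM : ∀ z, IsPOVM (M z)) (hN : ∀ x, IsPOVM (N x))
    (h : PairSelfTest (pairBehaviour ρ M N)) : SelfTestsPauli ρ M := by
  -- The reduced state of `C`. Everything is compressed to its support, where the state is faithful.
  set S := partialContract ρ (1 : Matrix A A ℂ) with hS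
  have hSp : S.PosSemidef := partialContract_posSemidef hρ.1 Matrix.PosSemidef.one
  obtain ⟨r, _, _, J, hJ, hJS, hunit⟩ := exists_support_isometry hSp
  have hsupp : ((J * Jᴴ) ⊗ₖ (1 : Matrix A A ℂ)) * ρ = ρ := by
    have hproj : (1 - J * Jᴴ) = (1 - J * Jᴴ)ᴴ * (1 - J * Jᴴ) := by
      have e : J * Jᴴ * (J * Jᴴ) = J * Jᴴ := by
        rw [Matrix.mul_assoc, ← Matrix.mul_assoc Jᴴ, hJ, Matrix.one_mul]
      rw [Matrix.conjTranspose_sub, Matrix.conjTranspose_one, Matrix.conjTranspose_mul,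
        Matrix.conjTranspose_conjTranspose]
      rw [sub_mul, mul_sub, mul_sub, e]
      simp
    have hp : (1 - J * Jᴴ).PosSemidef := by
      rw [hproj]; exact Matrix.posSemidef_conjTranspose_mul_self _
    have h0 := mul_eq_zero_of_trace_re_eq_zero
      (hp.kronecker (Matrix.PosSemidef.one (n := A) (R := ℂ))) hρ.1 (by
        rw [trace_kronecker_mul, ← hS, Matrix.sub_mul, hJS, Matrix.one_mul, sub_self]
        simp)
    rw [sub_kronecker, Matrix.one_kronecker_one, Matrix.sub_mul, Matrix.one_mul, sub_eq_zero] at h0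
    exact h0.symm
  set G := J ⊗ₖ (1 : Matrix A A ℂ) with hG
  have hGh : Gᴴ = Jᴴ ⊗ₖ (1 : Matrix A A ℂ) := by
    rw [hG, Matrix.conjTranspose_kronecker, Matrix.conjTranspose_one]
  have hGG : G * Gᴴ * ρ = ρ := by
    rw [hGh, hG, kron_mul_kron, Matrix.one_mul, hsupp]
  have hGG' : ρ * (G * Gᴴ) = ρ := by
    have := congrArg Matrix.conjTranspose hGG
    rwa [Matrix.conjTranspose_mul, Matrix.conjTranspose_mul, Matrix.conjTranspose_conjTranspose,
      hρ.1.1.eq] at this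
  set ρ' := Gᴴ * ρ * G with hρ'def
  have hback : G * ρ' * Gᴴ = ρ := by
    calc G * ρ' * Gᴴ = (G * Gᴴ * ρ) * (G * Gᴴ) := by rw [hρ'def]; simp only [Matrix.mul_assoc]
      _ = ρ := by rw [hGG, hGG']
  have hρ' : IsState ρ' := by
    refine ⟨hρ.1.conjTranspose_mul_mul_same G, ?_⟩
    rw [hρ'def, Matrix.trace_mul_comm, ← Matrix.mul_assoc, hGG, hρ.2]
  have htr : ∀ (Y : Matrix C C ℂ) (Z : Matrix A A ℂ),
      (((Jᴴ * Y * J) ⊗ₖ Z) * ρ').trace = ((Y ⊗ₖ Z) * ρ).trace := by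
    intro Y Z
    have e : (Jᴴ * Y * J) ⊗ₖ Z = Gᴴ * (Y ⊗ₖ Z) * G := by
      rw [hGh, hG, kron_mul_kron, kron_mul_kron, Matrix.one_mul, Matrix.mul_one]
    rw [← hback, e, Matrix.mul_assoc, Matrix.mul_assoc, Matrix.trace_mul_comm]
    simp only [Matrix.mul_assoc]
  have hf : Faithful ρ' := by
    intro X hX
    -- `J†SJ` is the reduced state of `ρ'`. With `K` the adjoint of `X J†SJ`, the squared norm `tr(K
    -- X J†SJ)` is the expectation of `KX ⊗ 1`, which is zero. Invertibility of `J†SJ` then gives `X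
    -- = 0`.
    have h1 : X * (Jᴴ * S * J) = 0 := by
      rw [← Matrix.trace_conjTranspose_mul_self_eq_zero_iff]
      set K := (X * (Jᴴ * S * J))ᴴ with hK
      have h2 : (((K * X) ⊗ₖ (1 : Matrix A A ℂ)) * ρ').trace = 0 := by
        rw [← kron_one_mul_kron_one, Matrix.mul_assoc, hX]
        simp
      have h3 : K * X = Jᴴ * (J * (K * X) * Jᴴ) * J := by
        simp only [Matrix.mul_assoc, hJ, Matrix.mul_one]
        rw [← Matrix.mul_assoc Jᴴ, hJ, Matrix.one_mul]
      rw [h3, htr, trace_kronecker_mul, ← hS] at h2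
      rw [← h2, Matrix.trace_mul_comm (J * (K * X) * Jᴴ)]
      simp only [Matrix.mul_assoc]
      rw [Matrix.trace_mul_comm S]
      simp only [Matrix.mul_assoc]
      rw [Matrix.trace_mul_comm J]
      simp only [Matrix.mul_assoc]
    obtain ⟨u, hu⟩ := hunit
    rw [← hu] at h1
    calc X = X * u.1 * (u⁻¹).1 := by rw [Matrix.mul_assoc]; simp
      _ = 0 := by rw [h1, Matrix.zero_mul]
  set M' : PauliInput n → Signs n → Matrix r r ℂ := fun z c => Jᴴ * M z c * J with hM'def
  have hM' : ∀ z, IsPOVM (M' z) := by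
    intro z
    refine ⟨fun c => ((hM z).1 c).conjTranspose_mul_mul_same J, ?_⟩
    simp only [hM'def]
    rw [← Matrix.sum_mul, ← Matrix.mul_sum, (hM z).2, Matrix.mul_one, hJ]
  have hP : pairBehaviour ρ' M' N = pairBehaviour ρ M N := by
    funext z x c a
    simp only [pairBehaviour, hM'def, htr]
  rw [← hP] at h
  have fam := isPauliFamily_of_selfTest hρ' hf hM' hN h
  -- The compressed measurement is projective, so every `M z c` preserves the support and the
  -- compression loses nothing.
  have := selfTestsPauli_of_family hρ' hJ (M := M) (M' := M') (fun z c => by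
    refine mul_isometry_eq_of_compression_sq ((hM z).1 c) ?_ hJ ?_
    · rw [← (hM z).2, ← Finset.sum_erase_add _ _ (Finset.mem_univ c), add_sub_cancel_right]
      exact (hM z).sum_posSemidef _
    · have := fam.orth z c c
      rwa [if_pos rfl] at this) fam ⟨0, hn⟩
  rwa [← hG, hback] at this

end SelfTest

end DICert

namespace DICert

/-! ## The correlations of the line network -/

section Network

variable {C A₀ A B B₀ D : Type} [Fintype C] [Fintype A₀] [Fintype A] [Fintype B] [Fintype B₀]
  [Fintype D]

/-- The effect on `A` obtained from an effect `G` on `A₀A` and an effect `M` on `C` with the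
state `ρ` of `CA₀`. -/
def nodeEffect (ρ : Matrix (C × A₀) (C × A₀) ℂ) (M : Matrix C C ℂ)
    (G : Matrix (A₀ × A) (A₀ × A) ℂ) : Matrix A A ℂ :=
  Matrix.of fun k l => ((M ⊗ₖ G.submatrix (fun i => (i, k)) (fun i => (i, l))) * ρ).trace

omit [Fintype A] in
theorem nodeEffect_apply (ρ : Matrix (C × A₀) (C × A₀) ℂ) (M : Matrix C C ℂ)
    (G : Matrix (A₀ × A) (A₀ × A) ℂ) (k l : A) :
    nodeEffect ρ M G k l = ∑ p : (C × A₀) × (C × A₀),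
      M p.1.1 p.2.1 * G (p.1.2, k) (p.2.2, l) * ρ p.2 p.1 := by
  rw [Fintype.sum_prod_type]
  simp [nodeEffect, Matrix.trace, Matrix.mul_apply]

/-- A state `σ` of `A` may be tested by the effect steered from `CA₀`, or first be absorbed into
Alice's effect `G`, leaving a two-party experiment on `CA₀`. The second view gives the marginals
and, for product states, the factorised correlations. -/
theorem trace_nodeEffect_mul (ρ : Matrix (C × A₀) (C × A₀) ℂ) (M : Matrix C C ℂ)
    (G : Matrix (A₀ × A) (A₀ × A) ℂ) (σ : Matrix A A ℂ) :
    (nodeEffect ρ M G * σ).trace = ((M ⊗ₖ partialContract G σ) * ρ).trace := by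
  have h : partialContract G σ = ∑ p : A × A, σ p.2 p.1 •
      G.submatrix (fun i => (i, p.1)) (fun i => (i, p.2)) := by
    ext i j
    simp [partialContract, Matrix.sum_apply, Fintype.sum_prod_type, mul_comm]
  rw [h, ← kronecker_sum, Finset.sum_mul, Matrix.trace_sum, Fintype.sum_prod_type]
  simp only [Matrix.trace, Matrix.diag, Matrix.mul_apply (M := nodeEffect ρ M G)]
  refine Finset.sum_congr rfl fun k _ => Finset.sum_congr rfl fun l _ => ?_
  have := Matrix.trace_smul (σ l k)
    ((M ⊗ₖ G.submatrix (fun i => (i, k)) (fun i => (i, l))) * ρ)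
  rw [Matrix.kronecker_smul, Matrix.smul_mul]
  refine Eq.trans ?_ this.symm
  rw [smul_eq_mul, mul_comm]
  rfl

omit [Fintype A] in
theorem sum_nodeEffect {O O' : Type} [Fintype O] [Fintype O'] (ρ : Matrix (C × A₀) (C × A₀) ℂ)
    (M : O → Matrix C C ℂ) (G : O' → Matrix (A₀ × A) (A₀ × A) ℂ) :
    ∑ o, ∑ o', nodeEffect ρ (M o) (G o') = nodeEffect ρ (∑ o, M o) (∑ o', G o') := by
  ext k l
  simp only [Matrix.sum_apply, nodeEffect_apply, Finset.sum_mul, Finset.mul_sum]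
  rw [Finset.sum_congr rfl fun o _ => Finset.sum_comm, Finset.sum_comm]
  exact Finset.sum_congr rfl fun p _ => Finset.sum_comm

omit [Fintype A] in
theorem nodeEffect_one [DecidableEq C] [DecidableEq A₀] [DecidableEq A]
    (ρ : Matrix (C × A₀) (C × A₀) ℂ) :
    nodeEffect ρ 1 (1 : Matrix (A₀ × A) (A₀ × A) ℂ) = ρ.trace • 1 := by
  ext k l
  by_cases h : k = l
  · subst h
    have : (1 : Matrix (A₀ × A) (A₀ × A) ℂ).submatrix (fun i => (i, k)) (fun i => (i, k)) = 1 := by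
      ext i j
      simp [Matrix.one_apply]
    simp [nodeEffect, this]
  · have : (1 : Matrix (A₀ × A) (A₀ × A) ℂ).submatrix (fun i => (i, k)) (fun i => (i, l)) = 0 := by
      ext i j
      simp [h]
    simp [nodeEffect, this, h]

/-- The correlations in terms of the effective measurements on `AB`. -/
theorem LineNetwork.behaviour_eq {n : ℕ} (N : LineNetwork n C A₀ A B B₀ D) (z : PauliInput n)
    (x y : NodeInput n) (w : PauliInput n) (c : Signs n) (a : NodeOutput n x) (b : NodeOutput n y)
    (d : Signs n) :
    N.behaviour z x y w c a b d =
      ((nodeEffect N.ρCA (N.MC z c) (N.MA x a) ⊗ₖ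
        nodeEffect (N.ρBD.submatrix Prod.swap Prod.swap) (N.MD w d)
          ((N.MB y b).submatrix Prod.swap Prod.swap)) * N.ρAB).trace.re := by
  let I := C × (A₀ × A) × (B × B₀) × D
  let X := ((A × B) × (A × B)) × ((C × A₀) × (C × A₀)) × ((D × B₀) × (D × B₀))
  let e : I × I ≃ X :=
    { toFun := fun p => (((p.1.2.1.2, p.1.2.2.1.1), (p.2.2.1.2, p.2.2.2.1.1)),
        ((p.1.1, p.1.2.1.1), (p.2.1, p.2.2.1.1)),
        ((p.1.2.2.2, p.1.2.2.1.2), (p.2.2.2.2, p.2.2.2.1.2)))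
      invFun := fun q => ((q.2.1.1.1, (q.2.1.1.2, q.1.1.1), (q.1.1.2, q.2.2.1.2), q.2.2.1.1),
        (q.2.1.2.1, (q.2.1.2.2, q.1.2.1), (q.1.2.2, q.2.2.2.2), q.2.2.2.1))
      left_inv := fun _ => rfl
      right_inv := fun _ => rfl }
  rw [LineNetwork.behaviour]
  congr 1
  have hL : ((N.MC z c ⊗ₖ (N.MA x a ⊗ₖ (N.MB y b ⊗ₖ N.MD w d))) * N.globalState).trace =
      ∑ p : I × I, N.MC z c p.1.1 p.2.1 * (N.MA x a p.1.2.1 p.2.2.1 *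
        (N.MB y b p.1.2.2.1 p.2.2.2.1 * N.MD w d p.1.2.2.2 p.2.2.2.2)) *
        N.globalState p.2 p.1 := by
    rw [Fintype.sum_prod_type]
    simp [Matrix.trace, Matrix.mul_apply, I]
  have hR : ((nodeEffect N.ρCA (N.MC z c) (N.MA x a) ⊗ₖ
        nodeEffect (N.ρBD.submatrix Prod.swap Prod.swap) (N.MD w d)
          ((N.MB y b).submatrix Prod.swap Prod.swap)) * N.ρAB).trace =
      ∑ q : ((A × B) × (A × B)) × ((C × A₀) × (C × A₀)) × ((D × B₀) × (D × B₀)), (N.MC z c q.2.1.1.1 q.2.1.2.1 * N.MA x a (q.2.1.1.2, q.1.1.1) (q.2.1.2.2, q.1.2.1) *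
        N.ρCA q.2.1.2 q.2.1.1) * (N.MD w d q.2.2.1.1 q.2.2.2.1 *
          N.MB y b (q.1.1.2, q.2.2.1.2) (q.1.2.2, q.2.2.2.2) *
          N.ρBD q.2.2.2.swap q.2.2.1.swap) * N.ρAB q.1.2 q.1.1 := by
    rw [Fintype.sum_prod_type (α₁ := (A × B) × (A × B)), Fintype.sum_prod_type (α₁ := A × B)]
    simp only [Matrix.trace, Matrix.diag, Matrix.mul_apply (N := N.ρAB), Matrix.kroneckerMap_apply]
    refine Finset.sum_congr rfl fun k _ => ?_
    refine Finset.sum_congr rfl fun l _ => ?_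
    rw [nodeEffect_apply, nodeEffect_apply, Finset.sum_mul_sum, Finset.sum_mul,
      Fintype.sum_prod_type (α₁ := (C × A₀) × (C × A₀))]
    refine Finset.sum_congr rfl fun s _ => ?_
    rw [Finset.sum_mul]
    exact Finset.sum_congr rfl fun t _ => rfl
  rw [hL, hR]
  refine Fintype.sum_equiv e _ _ fun p => ?_
  simp only [LineNetwork.globalState, Matrix.submatrix_apply, Matrix.kroneckerMap_apply, e,
    Equiv.coe_fn_mk, Prod.swap]
  ring

theorem IsState.swap {ρ : Matrix (A × B) (A × B) ℂ} (h : IsState ρ) :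
    IsState (ρ.submatrix Prod.swap Prod.swap) := by
  refine ⟨h.1.submatrix _, ?_⟩
  rw [← h.2]
  exact Fintype.sum_equiv (Equiv.prodComm B A) _ _ fun _ => rfl

theorem IsPOVM.swap [DecidableEq A] [DecidableEq B] {O : Type} [Fintype O]
    {M : O → Matrix (A × B) (A × B) ℂ} (h : IsPOVM M) :
    IsPOVM fun o => (M o).submatrix (Prod.swap : B × A → A × B) Prod.swap := by
  refine ⟨fun o => (h.1 o).submatrix _, ?_⟩
  have : ∑ o, (M o).submatrix (Prod.swap : B × A → A × B) Prod.swap =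
      (∑ o, M o).submatrix Prod.swap Prod.swap := by
    ext i j
    simp [Matrix.sum_apply]
  rw [this, h.2]
  exact Matrix.submatrix_one _ Prod.swap_injective

theorem trace_kronecker_mul_swap (X : Matrix A A ℂ) (Y : Matrix B B ℂ)
    (G : Matrix (A × B) (A × B) ℂ) :
    ((X ⊗ₖ Y) * G).trace = ((Y ⊗ₖ X) * G.submatrix Prod.swap Prod.swap).trace := by
  have h : (Y ⊗ₖ X) * G.submatrix Prod.swap Prod.swap =
      ((X ⊗ₖ Y) * G).submatrix (Prod.swap : B × A → A × B) Prod.swap := by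
    rw [← Matrix.submatrix_mul_equiv (X ⊗ₖ Y) G Prod.swap (Equiv.prodComm B A) Prod.swap]
    congr 1
    ext i j
    simp [mul_comm]
  rw [h]
  exact (Fintype.sum_equiv (Equiv.prodComm B A) _ _ fun _ => rfl).symm

theorem isPOVM_partialContract [DecidableEq A] [DecidableEq B] {O : Type} [Fintype O]
    {M : O → Matrix (A × B) (A × B) ℂ} (h : IsPOVM M) {σ : Matrix B B ℂ} (hσ : IsState σ) :
    IsPOVM fun o => partialContract (M o) σ := by
  refine ⟨fun o => partialContract_posSemidef (h.1 o) hσ.1, ?_⟩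
  rw [partialContract_sum, h.2, partialContract_one, hσ.2, one_smul]

theorem IsState.partialTrace [DecidableEq A] [DecidableEq B] {ρ : Matrix (A × B) (A × B) ℂ}
    (h : IsState ρ) : IsState (partialContract ρ (1 : Matrix B B ℂ)) := by
  refine ⟨partialContract_posSemidef h.1 Matrix.PosSemidef.one, ?_⟩
  have := trace_kronecker_mul (1 : Matrix A A ℂ) (1 : Matrix B B ℂ) ρ
  rw [Matrix.one_kronecker_one, Matrix.one_mul, Matrix.one_mul, h.2] at this
  exact this.symm

variable [DecidableEq C] [DecidableEq A₀] [DecidableEq A] [DecidableEq B] [DecidableEq B₀]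
  [DecidableEq D]

/-- The marginal of Charlie and Alice. -/
theorem LineNetwork.marginal_CA {n : ℕ} {N : LineNetwork n C A₀ A B B₀ D} (hN : N.IsQuantum)
    (y : NodeInput n) (w : PauliInput n) :
    (fun z x c a => ∑ b, ∑ d, N.behaviour z x y w c a b d) =
      pairBehaviour N.ρCA N.MC
        fun x a => partialContract (N.MA x a) (partialContract N.ρAB (1 : Matrix B B ℂ)) := by
  obtain ⟨hCA, hAB, hBD, hMC, hMA, hMB, hMD⟩ := hN
  funext z x c a
  simp only [N.behaviour_eq]
  rw [Finset.sum_comm]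
  simp only [← Complex.re_sum, ← Matrix.trace_sum, ← Finset.sum_mul, kronecker_sum]
  rw [sum_nodeEffect, (hMD w).2, (hMB y).swap.2, nodeEffect_one, hBD.swap.2, one_smul,
    trace_kronecker_mul, trace_nodeEffect_mul]
  rfl

/-- The marginal of Daisy and Bob. -/
theorem LineNetwork.marginal_DB {n : ℕ} {N : LineNetwork n C A₀ A B B₀ D} (hN : N.IsQuantum)
    (z : PauliInput n) (x : NodeInput n) :
    (fun w y d b => ∑ c, ∑ a, N.behaviour z x y w c a b d) =
      pairBehaviour (N.ρBD.submatrix Prod.swap Prod.swap) N.MD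
        fun y b => partialContract ((N.MB y b).submatrix Prod.swap Prod.swap)
          (partialContract (N.ρAB.submatrix Prod.swap Prod.swap) (1 : Matrix A A ℂ)) := by
  obtain ⟨hCA, hAB, hBD, hMC, hMA, hMB, hMD⟩ := hN
  funext w y d b
  simp only [N.behaviour_eq]
  simp only [← Complex.re_sum, ← Matrix.trace_sum, ← Finset.sum_mul, sum_kronecker]
  rw [sum_nodeEffect, (hMC z).2, (hMA x).2, nodeEffect_one, hCA.2, one_smul,
    trace_kronecker_mul_swap, trace_kronecker_mul, trace_nodeEffect_mul]
  rfl

/-- Each marginal is a two-party experiment in which the inner party's half of the state of `AB`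
counts as part of the measurement device. The inputs of the other two parties can be fixed
arbitrarily. -/
theorem LineNetwork.selfTests {n : ℕ} (hn : 1 ≤ n) {N : LineNetwork n C A₀ A B B₀ D}
    (hN : N.IsQuantum) (h : PassesSelfTest N.behaviour) :
    SelfTestsPauli N.ρCA N.MC ∧ SelfTestsPauli (N.ρBD.submatrix Prod.swap Prod.swap) N.MD := by
  have hN' := hN
  obtain ⟨hCA, hAB, hBD, hMC, hMA, hMB, hMD⟩ := hN'
  have h1 := h.1 .star fun _ => 0
  have h2 := h.2 (fun _ => 0) .star
  rw [marginal_CA hN] at h1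
  rw [marginal_DB hN] at h2
  exact ⟨selfTestsPauli_of_pairSelfTest hn hCA hMC
      (fun x => isPOVM_partialContract (hMA x) hAB.partialTrace) h1,
    selfTestsPauli_of_pairSelfTest hn hBD.swap hMD
      (fun y => isPOVM_partialContract (hMB y).swap hAB.swap.partialTrace) h2⟩

end Network

/-! ## The certification inequality -/

section Inequality

variable {n : ℕ}

theorem maxEnt_posSemidef (ι : Type) [Fintype ι] [DecidableEq ι] : (maxEnt ι).PosSemidef := by
  have : maxEnt ι = (Fintype.card ι : ℂ)⁻¹ •
      Matrix.vecMulVec (fun p : ι × ι => if p.1 = p.2 then (1 : ℂ) else 0)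
        (star fun p : ι × ι => if p.1 = p.2 then (1 : ℂ) else 0) := by
    ext p q
    by_cases hp : p.1 = p.2 <;> by_cases hq : q.1 = q.2 <;>
      simp [maxEnt, Matrix.vecMulVec_apply, hp, hq]
  rw [this]
  exact (Matrix.posSemidef_vecMulVec_self_star _).smul (by simp)

/-- Steering by self-tested Pauli measurements: up to a transposition, an effect of the other
party prepares a positive operator on `n` qubits, on which the Pauli measurement is made. -/
theorem SelfTestsPauli.exists_steered {C A : Type} [Fintype C] [Fintype A] [DecidableEq C]
    [DecidableEq A] {ρ : Matrix (C × A) (C × A) ℂ} {M : PauliInput n → Signs n → Matrix C C ℂ}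
    (h : SelfTestsPauli ρ M) {E : Matrix A A ℂ} (hE : E.PosSemidef) :
    ∃ G : Matrix (Qubits n) (Qubits n) ℂ, G.PosSemidef ∧
      ∀ z c, ((M z c ⊗ₖ E) * ρ).trace = (pauliProj z c * G).trace := by
  obtain ⟨UC, hUC, UA, hUA, ξ, hξ, -, hST⟩ := h
  set VC := onAncilla UC
  set VA := onAncilla UA
  have hVC : VCᴴ * VC = 1 := onAncilla_isometry hUC
  have hVA : VAᴴ * VA = 1 := onAncilla_isometry hUA
  set Ω := (ξ ⊗ₖ maxEnt (Qubits n)).submatrix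
    (fun i : (C × Fin 2 × Qubits n) × (A × Fin 2 × Qubits n) =>
      (((i.1.1, i.1.2.1), (i.2.1, i.2.2.1)), (i.1.2.2, i.2.2.2)))
    (fun i : (C × Fin 2 × Qubits n) × (A × Fin 2 × Qubits n) =>
      (((i.1.1, i.1.2.1), (i.2.1, i.2.2.1)), (i.1.2.2, i.2.2.2))) with hΩ
  have hmax := maxEnt_posSemidef (Qubits n)
  have hΩp : Ω.PosSemidef := (hξ.1.kronecker hmax).submatrix _
  -- The unnormalised state of Charlie's side, ancillas included, conditioned on the effect `E`.
  set Γ := partialContract Ω (VA * E * VAᴴ)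
  have hΓ : Γ.PosSemidef := partialContract_posSemidef hΩp (hE.mul_mul_conjTranspose_same VA)
  have hG : ∀ k : Fin 2, (∑ a : C, Γ.submatrix (fun u => (a, k, u)) fun u => (a, k, u)).PosSemidef :=
    fun k => Matrix.posSemidef_sum _ fun a _ => hΓ.submatrix _
  -- The part with control qubit 1 is measured with `πᵀ`; since `tr(πᵀ X) = tr(π Xᵀ)`, transposing
  -- that part of the steered operator restores `π`.
  refine ⟨_, (hG 0).add (hG 1).transpose, fun z c => ?_⟩
  have h1 : ((M z c ⊗ₖ E) * ρ).trace = (controlledTranspose C (pauliProj z c) * Γ).trace := by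
    rw [← trace_kronecker_mul]
    have h2 : (controlledTranspose C (pauliProj z c) ⊗ₖ (VA * E * VAᴴ)) * Ω =
        ((1 : Matrix (C × Fin 2 × Qubits n) (C × Fin 2 × Qubits n) ℂ) ⊗ₖ (VA * E * VAᴴ)) *
          ((VC ⊗ₖ VA) * ((M z c ⊗ₖ (1 : Matrix A A ℂ)) * ρ) * (VC ⊗ₖ VA)ᴴ) := by
      rw [hST, ← Matrix.mul_assoc, one_kron_mul_kron_one]
    have h3 : ((1 : Matrix (C × Fin 2 × Qubits n) (C × Fin 2 × Qubits n) ℂ) ⊗ₖ (VA * E * VAᴴ)) *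
        (VC ⊗ₖ VA) = (VC ⊗ₖ VA) * ((1 : Matrix C C ℂ) ⊗ₖ E) := by
      rw [kron_mul_kron, kron_mul_kron, Matrix.one_mul, Matrix.mul_one, Matrix.mul_assoc,
        hVA, Matrix.mul_one]
    have h4 : (VC ⊗ₖ VA)ᴴ * (VC ⊗ₖ VA) = 1 := by
      rw [Matrix.conjTranspose_kronecker, kron_mul_kron, hVC, hVA, Matrix.one_kronecker_one]
    rw [h2, ← Matrix.mul_assoc, ← Matrix.mul_assoc, h3, Matrix.trace_mul_comm _ (VC ⊗ₖ VA)ᴴ]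
    simp only [← Matrix.mul_assoc]
    rw [h4, Matrix.one_mul, one_kron_mul_kron_one]
  rw [h1, Matrix.mul_add, Matrix.trace_add]
  have hT : ∀ X : Matrix (Qubits n) (Qubits n) ℂ,
      (pauliProj z c * Xᵀ).trace = ((pauliProj z c)ᵀ * X).trace := by
    intro X
    rw [← Matrix.trace_transpose, Matrix.transpose_mul, Matrix.transpose_transpose,
      Matrix.trace_mul_comm]
  rw [hT, Matrix.mul_sum, Matrix.mul_sum, Matrix.trace_sum, Matrix.trace_sum,
    ← Finset.sum_add_distrib]
  have hent : ∀ a k u, (controlledTranspose C (pauliProj z c) * Γ) (a, k, u) (a, k, u) =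
      ((if k = 0 then pauliProj z c else (pauliProj z c)ᵀ) *
        Γ.submatrix (fun u => (a, k, u)) fun u => (a, k, u)) u u := by
    intro a k u
    simp only [Matrix.mul_apply, controlledTranspose_apply, Fintype.sum_prod_type, ite_mul,
      zero_mul, Matrix.submatrix_apply]
    rw [Finset.sum_eq_single a (fun x _ hx => by simp [hx.symm]) (by simp),
      Finset.sum_eq_single k (fun x _ hx => by simp [hx.symm]) (by simp)]
    simp
  simp only [Matrix.trace, Matrix.diag, Fintype.sum_prod_type, hent, Fin.sum_univ_two]
  simp

/-- Positive operators are nonnegative multiples of states. -/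
theorem exists_smul_isState {ι : Type} [Fintype ι] [Nonempty ι] {X : Matrix ι ι ℂ}
    (hX : X.PosSemidef) : ∃ (t : ℝ) (Y : Matrix ι ι ℂ), 0 ≤ t ∧ IsState Y ∧ X = (t : ℂ) • Y := by
  classical
  by_cases h0 : X.trace = 0
  · have hc : (Fintype.card ι : ℂ) ≠ 0 := by simp
    refine ⟨0, (Fintype.card ι : ℂ)⁻¹ • 1, le_rfl,
      ⟨Matrix.PosSemidef.one.smul (by simp), ?_⟩, ?_⟩
    · simp [hc]
    · rw [hX.trace_eq_zero_iff.mp h0]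
      simp
  · have hnn := Complex.le_def.mp hX.trace_nonneg
    have htr : X.trace = ((X.trace.re : ℝ) : ℂ) := Complex.ext rfl hnn.2.symm
    have hre : (X.trace.re : ℂ) ≠ 0 := by rwa [← htr]
    have hinv : (0 : ℂ) ≤ (X.trace.re : ℂ)⁻¹ := by
      have : (0 : ℝ) ≤ (X.trace.re)⁻¹ := inv_nonneg.mpr hnn.1
      exact_mod_cast this
    refine ⟨X.trace.re, (X.trace.re : ℂ)⁻¹ • X, hnn.1, ⟨hX.smul hinv, ?_⟩, ?_⟩
    · rw [Matrix.trace_smul, smul_eq_mul]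
      conv_lhs => arg 2; rw [htr]
      exact inv_mul_cancel₀ hre
    · rw [smul_smul, mul_inv_cancel₀ hre, one_smul]

theorem NonnegOnSeparable.trace_mul_kronecker_nonneg {α β : Type} [Fintype α] [Fintype β]
    [Nonempty α] [Nonempty β] {W : Matrix (α × β) (α × β) ℂ} (hW : NonnegOnSeparable W)
    {G : Matrix α α ℂ} {H : Matrix β β ℂ} (hG : G.PosSemidef) (hH : H.PosSemidef) :
    0 ≤ (W * (G ⊗ₖ H)).trace.re := by
  obtain ⟨s, X, hs, hX, rfl⟩ := exists_smul_isState hG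
  obtain ⟨t, Y, ht, hY, rfl⟩ := exists_smul_isState hH
  have hsep : IsSepState (X ⊗ₖ Y) :=
    ⟨1, fun _ => 1, fun _ => X, fun _ => Y, fun _ => zero_le_one, by simp, fun _ => hX,
      fun _ => hY, by simp⟩
  have := hW.2 _ hsep
  rw [Matrix.smul_kronecker, Matrix.kronecker_smul, smul_smul, Matrix.mul_smul, Matrix.trace_smul,
    smul_eq_mul, ← Complex.ofReal_mul, Complex.re_ofReal_mul]
  exact mul_nonneg (mul_nonneg hs ht) this

theorem witnessOp_mul_trace (ω : Coefficients n)
    (X : Matrix (Qubits n × Qubits n) (Qubits n × Qubits n) ℂ) :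
    (witnessOp ω * X).trace = ∑ z, ∑ w, ∑ c, ∑ d,
      (ω z w c d : ℂ) * ((pauliProj z c ⊗ₖ pauliProj w d) * X).trace := by
  simp only [witnessOp, Matrix.sum_mul, Matrix.trace_sum, Matrix.smul_mul, Matrix.trace_smul,
    smul_eq_mul]

/-- For each product term of the separable state the correlations factorise, and each factor is a
Pauli measurement on a steered positive operator. The unknown transpositions act inside the factors
`G i` and `H i` separately and so keep the product form on which the witness is nonnegative. -/
theorem LineNetwork.certValue_nonneg {C A₀ A B B₀ D : Type}
    [Fintype C] [Fintype A₀] [Fintype A] [Fintype B] [Fintype B₀] [Fintype D]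
    [DecidableEq C] [DecidableEq A₀] [DecidableEq A] [DecidableEq B] [DecidableEq B₀]
    [DecidableEq D] (hn : 1 ≤ n) {N : LineNetwork n C A₀ A B B₀ D}
    (hN : N.IsQuantum) (h : PassesSelfTest N.behaviour) (hsep : IsSepState N.ρAB)
    {ω : Coefficients n} (hω : NonnegOnSeparable (witnessOp ω)) :
    0 ≤ certValue ω N.behaviour := by
  obtain ⟨hC, hD⟩ := N.selfTests hn hN h
  obtain ⟨-, -, -, -, hMA, hMB, -⟩ := hN
  obtain ⟨k, p, σ, τ, hp, -, hσ, hτ, hρ⟩ := hsep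
  choose G hG hG' using fun i =>
    hC.exists_steered (partialContract_posSemidef ((hMA .star).1 (1 : ℤˣ)) (hσ i).1)
  choose H hH hH' using fun i =>
    hD.exists_steered (partialContract_posSemidef ((hMB .star).swap.1 (1 : ℤˣ)) (hτ i).1)
  have hb : ∀ z w c d, N.behaviour z .star .star w c (1 : ℤˣ) (1 : ℤˣ) d =
      ∑ i, p i * (((pauliProj z c ⊗ₖ pauliProj w d) * (G i ⊗ₖ H i)).trace).re := by
    intro z w c d
    rw [N.behaviour_eq, hρ, Finset.mul_sum, Matrix.trace_sum, Complex.re_sum]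
    refine Finset.sum_congr rfl fun i _ => ?_
    rw [Matrix.mul_smul, Matrix.trace_smul, smul_eq_mul, Complex.re_ofReal_mul, kron_mul_kron,
      kron_mul_kron, Matrix.trace_kronecker, Matrix.trace_kronecker, trace_nodeEffect_mul,
      trace_nodeEffect_mul, hG', hH']
  have hval : certValue ω N.behaviour = ∑ i, p i * ((witnessOp ω * (G i ⊗ₖ H i)).trace).re := by
    simp only [certValue, hb, witnessOp_mul_trace, Complex.re_sum, Complex.re_ofReal_mul,
      Finset.mul_sum]
    symm
    rw [Finset.sum_comm]
    refine Finset.sum_congr rfl fun z _ => ?_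
    rw [Finset.sum_comm]
    refine Finset.sum_congr rfl fun w _ => ?_
    rw [Finset.sum_comm]
    refine Finset.sum_congr rfl fun c _ => ?_
    rw [Finset.sum_comm]
    exact Finset.sum_congr rfl fun d _ => Finset.sum_congr rfl fun i _ => mul_left_comm _ _ _
  rw [hval]
  exact Finset.sum_nonneg fun i _ =>
    mul_nonneg (hp i) (hω.trace_mul_kronecker_nonneg (hG i) (hH i))

end Inequality

end DICert

namespace DICert

/-! ## The reference strategy -/

section MaximallyEntangled

variable {ι : Type} [Fintype ι] [DecidableEq ι]

theorem trace_kronecker_mul_maxEnt (X Y : Matrix ι ι ℂ) :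
    ((X ⊗ₖ Y) * maxEnt ι).trace = (Fintype.card ι : ℂ)⁻¹ * (X * Yᵀ).trace := by
  simp only [Matrix.trace, Matrix.diag, Matrix.mul_apply, Fintype.sum_prod_type, maxEnt,
    Matrix.of_apply, Matrix.kroneckerMap_apply, Matrix.transpose_apply, Finset.mul_sum]
  refine Finset.sum_congr rfl fun i _ => ?_
  rw [Finset.sum_eq_single i (fun j _ hj => by simp [hj.symm]) (by simp)]
  refine Finset.sum_congr rfl fun j _ => ?_
  rw [Finset.sum_eq_single j (fun k _ hk => by simp [hk.symm]) (by simp)]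
  simp [mul_comm]

theorem maxEnt_swap : (maxEnt ι).submatrix Prod.swap Prod.swap = maxEnt ι := by
  ext p q
  simp [maxEnt, eq_comm]

theorem isState_maxEnt [Nonempty ι] : IsState (maxEnt ι) := by
  refine ⟨maxEnt_posSemidef ι, ?_⟩
  have := trace_kronecker_mul_maxEnt (1 : Matrix ι ι ℂ) 1
  rw [Matrix.one_kronecker_one, Matrix.one_mul, Matrix.one_mul, Matrix.transpose_one,
    Matrix.trace_one] at this
  rw [this]
  exact inv_mul_cancel₀ (by simp)

theorem maxEnt_mul_self [Nonempty ι] : maxEnt ι * maxEnt ι = maxEnt ι := by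
  have h : (Fintype.card ι : ℂ) ≠ 0 := by simp
  ext p q
  simp only [Matrix.mul_apply, maxEnt, Matrix.of_apply, Fintype.sum_prod_type]
  by_cases hp : p.1 = p.2 <;> by_cases hq : q.1 = q.2 <;> simp [hp, hq, h]

theorem one_sub_posSemidef_of_mul_self {P : Matrix ι ι ℂ} (hP : P.IsHermitian)
    (h : P * P = P) : (1 - P).PosSemidef := by
  have h1 : 1 - P = (1 - P)ᴴ * (1 - P) := by
    rw [Matrix.conjTranspose_sub, Matrix.conjTranspose_one, hP.eq]
    simp [sub_mul, mul_sub, h]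
  rw [h1]
  exact Matrix.posSemidef_conjTranspose_mul_self _

/-- The effects `F`, `1 - F` with `F` the compression of a projector by an isometry. -/
theorem isPOVM_compression {κ : Type} [Fintype κ] [DecidableEq κ] {P : Matrix ι ι ℂ}
    (hP : P.PosSemidef) (h : P * P = P) {V : Matrix ι κ ℂ} (hV : Vᴴ * V = 1) :
    IsPOVM fun a : ℤˣ => if a = 1 then Vᴴ * P * V else 1 - Vᴴ * P * V := by
  refine ⟨fun a => ?_, ?_⟩
  · beta_reduce
    split_ifs
    · exact hP.conjTranspose_mul_mul_same V
    · have : 1 - Vᴴ * P * V = Vᴴ * (1 - P) * V := by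
        rw [Matrix.mul_sub, Matrix.sub_mul, Matrix.mul_one, hV]
      rw [this]
      exact (one_sub_posSemidef_of_mul_self hP.1 h).conjTranspose_mul_mul_same V
  · rw [UnitsInt.univ, Finset.sum_pair (by decide)]
    simp

end MaximallyEntangled

/-! ### Validity of the reference measurements. -/

section NodeMeasurements

variable {n : ℕ}

theorem ofReal_sqrt_two_inv_mul_self :
    ((√2 : ℝ) : ℂ)⁻¹ * ((√2 : ℝ) : ℂ)⁻¹ = 1 / 2 := by
  rw [← mul_inv, ← Complex.ofReal_mul, Real.mul_self_sqrt (by norm_num)]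
  norm_num

theorem nodeObs_isHermitian (s : Fin 6) : (nodeObs s).IsHermitian := by
  ext i j
  fin_cases s <;> fin_cases i <;> fin_cases j <;> simp [nodeObs, pauli, sub_eq_add_neg]

theorem nodeObs_mul_self (s : Fin 6) : nodeObs s * nodeObs s = 1 := by
  have h := ofReal_sqrt_two_inv_mul_self
  have hI := Complex.I_mul_I
  fin_cases s <;> ext i j <;> fin_cases i <;> fin_cases j <;>
    simp [nodeObs, pauli, Matrix.mul_apply, Fin.sum_univ_two] <;> grind

theorem isPOVM_nodeProj (x : Fin n → Fin 6) :
    IsPOVM fun a : Signs n => tensorOp fun i => signProj (nodeObs (x i)) (a i) :=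
  isPOVM_tensorOp fun i => isPOVM_signProj (nodeObs_mul_self (x i)) (nodeObs_isHermitian (x i))

theorem star_bellVec (s : Fin 4) (i j : Fin 2) : star (bellVec s i j) = bellVec s i j := by
  fin_cases s <;> fin_cases i <;> fin_cases j <;> simp [bellVec]

theorem sum_bellVec_mul (i j k l : Fin 2) :
    ∑ s, bellVec s i j * bellVec s k l = if i = k ∧ j = l then 1 else 0 := by
  have h := ofReal_sqrt_two_inv_mul_self
  rw [Fin.sum_univ_four]
  fin_cases i <;> fin_cases j <;> fin_cases k <;> fin_cases l <;> simp [bellVec] <;> grind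

theorem isPOVM_bellMeas {m : ℕ} (pair : Fin m → Fin n × Fin n) : IsPOVM (bellMeas pair) := by
  refine ⟨fun a => ?_, ?_⟩
  · let b : Qubits n → ℂ := fun u => ∏ l, bellVec (a l) (u (pair l).1) (u (pair l).2)
    -- The string of unmeasured qubits, padded by 0 at the measured ones. The projector is then `K
    -- K†`, where `K` adjoins the Bell vectors to the unmeasured qubits.
    let r : Qubits n → Qubits n := fun u k =>
      if ∀ l, k ≠ (pair l).1 ∧ k ≠ (pair l).2 then u k else 0
    let K : Matrix (Qubits n) (Qubits n) ℂ := Matrix.of fun u w => if w = r u then b u else 0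
    have hb : ∀ u, star (b u) = b u := fun u => by simp only [b, star_prod, star_bellVec]
    have hr : ∀ u v, (∀ k, (∀ l, k ≠ (pair l).1 ∧ k ≠ (pair l).2) → u k = v k) ↔ r v = r u := by
      intro u v
      simp only [r, funext_iff]
      refine forall_congr' fun k => ?_
      split_ifs with h <;> simp [h, eq_comm]
    have : bellMeas pair a = K * Kᴴ := by
      ext u v
      simp only [bellMeas, Matrix.of_apply, Matrix.mul_apply, Matrix.conjTranspose_apply, K, hr,
        Finset.prod_mul_distrib]
      rw [Finset.sum_eq_single (r u) (fun w _ hw => by simp [hw]) (by simp)]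
      by_cases h : r v = r u
      · simp only [h, if_true, mul_one, hb]; rfl
      · simp [h, Ne.symm h]
    rw [this]
    exact Matrix.posSemidef_self_mul_conjTranspose K
  · ext u v
    simp only [Matrix.sum_apply, bellMeas, Matrix.of_apply, ← Finset.sum_mul]
    have h := Finset.prod_univ_sum (fun _ : Fin m => (Finset.univ : Finset (Fin 4)))
      fun l s => bellVec s (u (pair l).1) (u (pair l).2) * bellVec s (v (pair l).1) (v (pair l).2)
    rw [Fintype.piFinset_univ] at h
    rw [← h]
    simp only [sum_bellVec_mul, Finset.prod_ite_zero, Finset.prod_const_one, Finset.mem_univ,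
      true_implies, Matrix.one_apply, mul_ite, mul_one, mul_zero, ← ite_and]
    refine if_congr ⟨fun ⟨h1, h2⟩ => funext fun k => ?_, ?_⟩ rfl rfl
    · by_cases hk : ∀ l, k ≠ (pair l).1 ∧ k ≠ (pair l).2
      · exact h1 k hk
      · push Not at hk
        obtain ⟨l, hl⟩ := hk
        by_cases hk1 : k = (pair l).1
        · rw [hk1]; exact (h2 l).1
        · rw [hl hk1]; exact (h2 l).2
    · rintro rfl
      simp

/-- The measurements of Alice in the reference strategy form quantum measurements. -/
theorem isPOVM_nodeMeas {ι : Type} [Fintype ι] [DecidableEq ι]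
    {emb : Matrix (Qubits n) (Qubits n) ℂ → Matrix ι ι ℂ} {F : Matrix ι ι ℂ}
    (hemb : ∀ {O : Type} [Fintype O] {M : O → Matrix (Qubits n) (Qubits n) ℂ}, IsPOVM M →
      IsPOVM fun o => emb (M o))
    (hF : IsPOVM fun a : ℤˣ => if a = 1 then F else 1 - F) (x : NodeInput n) :
    IsPOVM (nodeMeas emb F x) := by
  cases x with
  | vec x => exact hemb (isPOVM_nodeProj x)
  | lozenge => exact hemb (isPOVM_bellMeas (lozPair n))
  | blacklozenge => exact hemb (isPOVM_bellMeas (blackPair n))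
  | star => exact hF

theorem IsPOVM.kronecker_one {α κ O : Type} [Fintype α] [DecidableEq α] [Fintype κ] [DecidableEq κ]
    [Fintype O] {M : O → Matrix α α ℂ} (h : IsPOVM M) :
    IsPOVM fun o => M o ⊗ₖ (1 : Matrix κ κ ℂ) :=
  ⟨fun o => (h.1 o).kronecker Matrix.PosSemidef.one, by
    rw [sum_kronecker, h.2, Matrix.one_kronecker_one]⟩

theorem IsPOVM.one_kronecker {α κ O : Type} [Fintype α] [DecidableEq α] [Fintype κ] [DecidableEq κ]
    [Fintype O] {M : O → Matrix α α ℂ} (h : IsPOVM M) :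
    IsPOVM fun o => (1 : Matrix κ κ ℂ) ⊗ₖ M o :=
  ⟨fun o => Matrix.PosSemidef.one.kronecker (h.1 o), by
    rw [kronecker_sum, h.2, Matrix.one_kronecker_one]⟩

variable {α β : Type} [Fintype α] [Fintype β] [DecidableEq α] [DecidableEq β]
  {VA : Matrix (Qubits n) α ℂ} {VB : Matrix (Qubits n) β ℂ} {ρ : Matrix (α × β) (α × β) ℂ}

theorem referenceNetwork_isQuantum (hVA : VAᴴ * VA = 1) (hVB : VBᴴ * VB = 1) (hρ : IsState ρ) :
    (referenceNetwork n VA VB ρ).IsQuantum := by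
  refine ⟨isState_maxEnt, hρ, isState_maxEnt, isPOVM_pauliProj, ?_, ?_, isPOVM_pauliProj⟩
  · refine isPOVM_nodeMeas (fun h => h.kronecker_one) ?_
    refine isPOVM_compression (maxEnt_posSemidef _) maxEnt_mul_self ?_
    rw [Matrix.conjTranspose_kronecker, kron_mul_kron, hVA, Matrix.conjTranspose_one,
      Matrix.one_mul, Matrix.one_kronecker_one]
  · refine isPOVM_nodeMeas (fun h => h.one_kronecker) ?_
    refine isPOVM_compression (maxEnt_posSemidef _) maxEnt_mul_self ?_
    rw [Matrix.conjTranspose_kronecker, kron_mul_kron, hVB, Matrix.conjTranspose_one,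
      Matrix.one_mul, Matrix.one_kronecker_one]

end NodeMeasurements

end DICert

namespace DICert

/-! ### The reference strategy passes the self-test. -/

section ReferenceCorrelations

variable {n : ℕ}

/-- The products of observables at the sites in `T` for a product measurement. -/
theorem sum_signs_smul_tensorOp (S : Fin n → Matrix (Fin 2) (Fin 2) ℂ) (T : Finset (Fin n)) :
    ∑ c : Signs n, (∏ k ∈ T, ((c k : ℤ) : ℂ)) • tensorOp (fun k => signProj (S k) (c k)) =
      tensorOp fun k => if k ∈ T then S k else 1 := by
  have h1 : ∀ c : Signs n, (∏ k ∈ T, ((c k : ℤ) : ℂ)) • tensorOp (fun k => signProj (S k) (c k)) =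
      tensorOp fun k => (if k ∈ T then ((c k : ℤ) : ℂ) else 1) • signProj (S k) (c k) := by
    intro c
    rw [tensorOp_smul, Finset.prod_ite_mem, Finset.univ_inter]
  rw [Finset.sum_congr rfl fun c _ => h1 c,
    sum_tensorOp fun k (s : ℤˣ) => (if k ∈ T then ((s : ℤ) : ℂ) else 1) • signProj (S k) s]
  congr 1
  funext k
  split_ifs
  · rw [UnitsInt.univ, Finset.sum_pair (by decide), signProj, signProj]
    push_cast
    module
  · simpa using signProj_sum (S k)

theorem signObs_tensorOp (S : Fin n → Matrix (Fin 2) (Fin 2) ℂ) (i : Fin n) :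
    signObs (fun c => tensorOp fun k => signProj (S k) (c k)) i =
      tensorOp fun k => if k ∈ ({i} : Finset (Fin n)) then S k else 1 := by
  rw [← sum_signs_smul_tensorOp]
  simp [signObs, signSum]

theorem trace_tensorOp_maxEnt (f g : Fin n → Matrix (Fin 2) (Fin 2) ℂ) :
    ((tensorOp f ⊗ₖ tensorOp g) * maxEnt (Qubits n)).trace =
      ∏ k, (f k * (g k)ᵀ).trace / 2 := by
  rw [trace_kronecker_mul_maxEnt, tensorOp_transpose, tensorOp_mul, trace_tensorOp,
    Finset.prod_div_distrib, div_eq_inv_mul]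
  simp

theorem trace_tensorOp_maxEnt_of_mem (f g : Fin n → Matrix (Fin 2) (Fin 2) ℂ)
    (T : Finset (Fin n)) :
    ((tensorOp (fun k => if k ∈ T then f k else 1) ⊗ₖ
        tensorOp (fun k => if k ∈ T then g k else 1)) * maxEnt (Qubits n)).trace =
      ∏ k ∈ T, (f k * (g k)ᵀ).trace / 2 := by
  rw [trace_tensorOp_maxEnt, ← Finset.prod_subset (Finset.subset_univ T) (fun k _ hk => by
    simp [hk])]
  exact Finset.prod_congr rfl fun k hk => by simp [hk]

theorem trace_pauli_mul_transpose (t t' : Fin 3) :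
    (pauli t * (pauli t')ᵀ).trace / 2 = if t = t' then (if t = 2 then -1 else 1) else 0 := by
  rw [Matrix.trace_fin_two]
  simp only [Matrix.mul_apply, Fin.sum_univ_two, Matrix.transpose_apply]
  fin_cases t <;> fin_cases t' <;> simp [pauli]

theorem trace_pauli (t : Fin 3) : (pauli t).trace = 0 := by
  fin_cases t <;> simp [pauli, Matrix.trace, Fin.sum_univ_two]

/-- The expectation factorises over the sites, and every site other than `i` contributes `tr(1)/2 =
1`; so no term depends on the inputs there. -/
theorem avgCorr_reference (N : (x : NodeInput n) → NodeOutput n x → Matrix (Qubits n) (Qubits n) ℂ)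
    (hN : ∀ x a, N (.vec x) a = tensorOp fun i => signProj (nodeObs (x i)) (a i)) (i : Fin n)
    (t : Fin 3) (s : Fin 6) :
    avgCorr (pairBehaviour (maxEnt (Qubits n)) pauliProj N) i t s =
      ((pauli t * (nodeObs s)ᵀ).trace / 2).re := by
  have h : ∀ z x, ((signObs (pauliProj (Function.update z i t)) i ⊗ₖ
      signObs (N (.vec (Function.update x i s))) i) * maxEnt (Qubits n)).trace =
      (pauli t * (nodeObs s)ᵀ).trace / 2 := by
    intro z x
    have h1 : signObs (pauliProj (Function.update z i t)) i = _ := signObs_tensorOp _ i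
    have h2 : N (.vec (Function.update x i s)) = fun a =>
        tensorOp fun k => signProj (nodeObs (Function.update x i s k)) (a k) := funext (hN _)
    rw [h1, h2, signObs_tensorOp, trace_tensorOp_maxEnt_of_mem]
    simp
  simp only [avgCorr_pairBehaviour, h, Finset.sum_const, Finset.card_univ, nsmul_eq_mul,
    Fintype.card_fun, Fintype.card_fin]
  push_cast
  field_simp

theorem tripleCHSH_reference
    (N : (x : NodeInput n) → NodeOutput n x → Matrix (Qubits n) (Qubits n) ℂ)
    (hN : ∀ x a, N (.vec x) a = tensorOp fun i => signProj (nodeObs (x i)) (a i)) (i : Fin n) :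
    tripleCHSH (pairBehaviour (maxEnt (Qubits n)) pauliProj N) i = 6 * √2 := by
  have h0 : ∀ t t', (pauli t * (pauli t')ᵀ).trace =
      if t = t' then (if t = 2 then -2 else 2) else 0 := by
    intro t t'
    rw [(div_eq_iff two_ne_zero).mp (trace_pauli_mul_transpose t t')]
    split_ifs <;> norm_num
  -- Each of the twelve signed correlations equals `1/√2`. The YY correlation of `Φ⁺` is -1, which
  -- fixes the position of the minus signs in the last two groups of `J_i`.
  have h2 : (6 : ℝ) * √2 = 12 * (√2)⁻¹ := by
    have := Real.mul_self_sqrt (show (0 : ℝ) ≤ 2 by norm_num)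
    field_simp
    nlinarith
  simp only [tripleCHSH, avgCorr_reference N hN]
  simp [nodeObs, Matrix.transpose_add, Matrix.transpose_sub, Matrix.mul_add, Matrix.mul_sub,
    Matrix.trace_add, Matrix.trace_sub, h0, ← Complex.ofReal_inv]
  rw [h2]
  ring

theorem tensorOp_pair_apply {i j : Fin n} (hij : i ≠ j) (S : Matrix (Fin 2) (Fin 2) ℂ)
    (u v : Qubits n) :
    tensorOp (fun k => if k ∈ ({i, j} : Finset (Fin n)) then S else 1) u v =
      S (u i) (v i) * S (u j) (v j) * if ∀ k, k ≠ i ∧ k ≠ j → u k = v k then 1 else 0 := by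
  have h : ∀ k ∈ ({i, j} : Finset (Fin n))ᶜ,
      (if k ∈ ({i, j} : Finset (Fin n)) then S else 1) (u k) (v k) =
        if u k = v k then 1 else 0 := by
    intro k hk
    rw [if_neg (Finset.mem_compl.mp hk), Matrix.one_apply]
  rw [tensorOp, Matrix.of_apply, ← Finset.prod_mul_prod_compl ({i, j} : Finset (Fin n)),
    Finset.prod_congr rfl h, Finset.prod_ite_zero, Finset.prod_pair hij]
  simp

/-- The Bell projectors in terms of products of Pauli matrices. -/
theorem bellVec_mul_bellVec (s : Fin 4) (a b a' b' : Fin 2) :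
    bellVec s a b * bellVec s a' b' = 1 / 4 * ((1 : Matrix (Fin 2) (Fin 2) ℂ) a a' *
      (1 : Matrix (Fin 2) (Fin 2) ℂ) b b' +
        ∑ t, ((4 * bellTable s t : ℝ) : ℂ) * (pauli t a a' * pauli t b b')) := by
  have h := ofReal_sqrt_two_inv_mul_self
  rw [Fin.sum_univ_three]
  fin_cases s <;> fin_cases a <;> fin_cases b <;> fin_cases a' <;> fin_cases b' <;>
    simp [bellVec, bellTable, pauli] <;> grind

/-- The marginals of a Bell measurement of disjoint pairs. -/
theorem sum_bellMeas {m : ℕ} {pair : Fin m → Fin n × Fin n} (hne : ∀ l, (pair l).1 ≠ (pair l).2)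
    (hdis : ∀ l l', l' ≠ l → ((pair l').1 ≠ (pair l).1 ∧ (pair l').1 ≠ (pair l).2) ∧
      ((pair l').2 ≠ (pair l).1 ∧ (pair l').2 ≠ (pair l).2)) (l : Fin m) (s : Fin 4) :
    ∑ a : Fin m → Fin 4 with a l = s, bellMeas pair a = (1 / 4 : ℂ) • (1 + ∑ t,
      ((4 * bellTable s t : ℝ) : ℂ) • tensorOp fun k =>
        if k ∈ ({(pair l).1, (pair l).2} : Finset (Fin n)) then pauli t else 1) := by
  -- Fixing one outcome leaves a product set, so the sum becomes a product over the pairs.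
  have hf : (Finset.univ.filter fun a : Fin m → Fin 4 => a l = s) =
      Fintype.piFinset fun l' => if l' = l then {s} else Finset.univ := by
    ext a
    simp only [Finset.mem_filter, Finset.mem_univ, true_and, Fintype.mem_piFinset]
    constructor
    · rintro h l'
      split_ifs with h'
      · rw [h', h]; simp
      · simp
    · intro h
      simpa using h l
  have h1 : (1 : Matrix (Qubits n) (Qubits n) ℂ) = tensorOp fun k =>
      if k ∈ ({(pair l).1, (pair l).2} : Finset (Fin n)) then 1 else 1 := by
    simp [tensorOp_one]
  rw [h1, hf]
  ext u v
  simp only [Matrix.sum_apply, Matrix.smul_apply, Matrix.add_apply, smul_eq_mul,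
    tensorOp_pair_apply (hne l), bellMeas, Matrix.of_apply, ← Finset.sum_mul]
  have h2 := Finset.prod_univ_sum (fun l' : Fin m => if l' = l then {s} else Finset.univ)
    fun l' s => bellVec s (u (pair l').1) (u (pair l').2) *
      bellVec s (v (pair l').1) (v (pair l').2)
  rw [← h2, ← Finset.mul_prod_erase _ _ (Finset.mem_univ l)]
  have h3 : ∀ l' ∈ Finset.univ.erase l, (∑ s ∈ if l' = l then {s} else Finset.univ,
      bellVec s (u (pair l').1) (u (pair l').2) * bellVec s (v (pair l').1) (v (pair l').2)) =
      if u (pair l').1 = v (pair l').1 ∧ u (pair l').2 = v (pair l').2 then 1 else 0 := by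
    intro l' hl'
    rw [if_neg (Finset.ne_of_mem_erase hl'), sum_bellVec_mul]
  have h5 : (∏ l' ∈ Finset.univ.erase l, if u (pair l').1 = v (pair l').1 ∧
      u (pair l').2 = v (pair l').2 then (1 : ℂ) else 0) = if ∀ l' ∈ Finset.univ.erase l,
        u (pair l').1 = v (pair l').1 ∧ u (pair l').2 = v (pair l').2 then 1 else 0 := by
    rw [Finset.prod_ite_zero, Finset.prod_const_one]
    congr
  rw [Finset.prod_congr rfl h3, h5, if_pos rfl, Finset.sum_singleton, bellVec_mul_bellVec]
  -- Completeness of the Bell basis on the other pairs and the identity on the unmeasured qubits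
  -- combine to the identity off the pair `l`; disjointness of the pairs enters here.
  have h4 : (if ∀ l' ∈ Finset.univ.erase l, u (pair l').1 = v (pair l').1 ∧
      u (pair l').2 = v (pair l').2 then (1 : ℂ) else 0) *
      (if ∀ k, (∀ l, k ≠ (pair l).1 ∧ k ≠ (pair l).2) → u k = v k then 1 else 0) =
      if ∀ k, k ≠ (pair l).1 ∧ k ≠ (pair l).2 → u k = v k then 1 else 0 := by
    rw [mul_ite, mul_one, mul_zero, ← ite_and]
    refine if_congr ⟨fun ⟨h1, h2⟩ k hk => ?_, fun h => ⟨fun k hk => h k (hk l), fun l' hl' => ?_⟩⟩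
      rfl rfl
    · by_cases hk' : ∀ l, k ≠ (pair l).1 ∧ k ≠ (pair l).2
      · exact h1 k hk'
      · push Not at hk'
        obtain ⟨l', hl'⟩ := hk'
        have hll : l' ∈ Finset.univ.erase l := by
          rw [Finset.mem_erase]
          refine ⟨?_, Finset.mem_univ _⟩
          rintro rfl
          exact hk.2 (hl' hk.1)
        by_cases hk1 : k = (pair l').1
        · rw [hk1]; exact (h2 l' hll).1
        · rw [hl' hk1]; exact (h2 l' hll).2
    · have := hdis l l' (Finset.ne_of_mem_erase hl')
      exact ⟨h _ this.1, h _ this.2⟩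
  rw [mul_assoc, h4]
  simp only [Finset.mul_sum, mul_add, add_mul, Finset.sum_mul]
  congr 1
  · ring
  · exact Finset.sum_congr rfl fun t _ => by ring

theorem kronecker_sum_finset {O l m n p : Type} (s : Finset O) (A : Matrix l m ℂ)
    (f : O → Matrix n p ℂ) : ∑ o ∈ s, A ⊗ₖ f o = A ⊗ₖ (∑ o ∈ s, f o) := by
  ext i j
  simp [Matrix.sum_apply, Finset.mul_sum]

/-- `S` stands at both sites of the pair, so every term is a square and the sign from transposing
`σ_y` drops out. The cases used are `S = 1`, for the outcome probability, and `S` a Pauli matrix,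
for the correlations. -/
theorem trace_pair_maxEnt {i j : Fin n} (hij : i ≠ j) (S : Matrix (Fin 2) (Fin 2) ℂ)
    (e : Fin 3 → ℂ) :
    ((tensorOp (fun k => if k ∈ ({i, j} : Finset (Fin n)) then S else 1) ⊗ₖ
      ((1 / 4 : ℂ) • (1 + ∑ t, e t • tensorOp fun k =>
        if k ∈ ({i, j} : Finset (Fin n)) then pauli t else 1))) * maxEnt (Qubits n)).trace =
      1 / 4 * ((S.trace / 2) ^ 2 + ∑ t, e t * ((S * (pauli t)ᵀ).trace / 2) ^ 2) := by
  have h1 : (1 : Matrix (Qubits n) (Qubits n) ℂ) = tensorOp fun k =>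
      if k ∈ ({i, j} : Finset (Fin n)) then 1 else 1 := by
    simp [tensorOp_one]
  rw [h1]
  simp only [Matrix.kronecker_smul, Matrix.kronecker_add, ← kronecker_sum, Matrix.smul_mul,
    Matrix.add_mul, Finset.sum_mul, Matrix.trace_smul, Matrix.trace_add, Matrix.trace_sum,
    trace_tensorOp_maxEnt_of_mem, Finset.prod_pair hij, smul_eq_mul, Matrix.transpose_one,
    Matrix.mul_one, sq]

theorem bellCorrelations_reference {m : ℕ} {pair : Fin m → Fin n × Fin n}
    (hne : ∀ l, (pair l).1 ≠ (pair l).2)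
    (hdis : ∀ l l', l' ≠ l → ((pair l').1 ≠ (pair l).1 ∧ (pair l').1 ≠ (pair l).2) ∧
      ((pair l').2 ≠ (pair l).1 ∧ (pair l').2 ≠ (pair l).2)) :
    BellCorrelations pair fun z c a =>
      ((pauliProj z c ⊗ₖ bellMeas pair a) * maxEnt (Qubits n)).trace.re := by
  -- Used with `T` empty for the outcome probabilities and with `T` the pair itself for the
  -- correlations.
  have key : ∀ (l : Fin m) (s : Fin 4) (z : PauliInput n) (T : Finset (Fin n)),
      ∑ c : Signs n, ∑ a : Fin m → Fin 4 with a l = s, (∏ k ∈ T, ((c k : ℤ) : ℝ)) *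
        ((pauliProj z c ⊗ₖ bellMeas pair a) * maxEnt (Qubits n)).trace.re =
      ((tensorOp (fun k => if k ∈ T then pauli (z k) else 1) ⊗ₖ
        ∑ a : Fin m → Fin 4 with a l = s, bellMeas pair a) * maxEnt (Qubits n)).trace.re := by
    intro l s z T
    rw [← sum_signs_smul_tensorOp, ← sum_kronecker, Finset.sum_mul, Matrix.trace_sum,
      Complex.re_sum]
    refine Finset.sum_congr rfl fun c _ => ?_
    rw [Matrix.smul_kronecker, Matrix.smul_mul, Matrix.trace_smul, ← Finset.mul_sum]
    have : (∏ k ∈ T, ((c k : ℤ) : ℂ)) = ((∏ k ∈ T, ((c k : ℤ) : ℝ) : ℝ) : ℂ) := by push_cast; rfl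
    rw [this, smul_eq_mul, Complex.re_ofReal_mul, ← Complex.re_sum, ← Matrix.trace_sum,
      ← Finset.sum_mul, kronecker_sum_finset]
    rfl
  intro l s
  refine ⟨fun z => ?_, fun t => ?_⟩
  · have h := key l s z ∅
    simp only [Finset.prod_empty, one_mul] at h
    have h1 : (fun k => if k ∈ (∅ : Finset (Fin n)) then pauli (z k) else 1) =
        fun k => if k ∈ ({(pair l).1, (pair l).2} : Finset (Fin n)) then 1 else 1 := by
      simp
    rw [h, sum_bellMeas hne hdis, h1, trace_pair_maxEnt (hne l)]
    simp [trace_pauli, Matrix.trace_transpose]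
  · have h : ∀ z ∈ Finset.univ.filter fun z : PauliInput n => z (pair l).1 = t ∧ z (pair l).2 = t,
        ∑ c : Signs n, ∑ a : Fin m → Fin 4 with a l = s,
          (((c (pair l).1 * c (pair l).2 : ℤˣ) : ℤ) : ℝ) *
            ((pauliProj z c ⊗ₖ bellMeas pair a) * maxEnt (Qubits n)).trace.re =
        bellTable s t := by
      intro z hz
      obtain ⟨hz1, hz2⟩ := (Finset.mem_filter.mp hz).2
      have h := key l s z {(pair l).1, (pair l).2}
      have h1 : (fun k => if k ∈ ({(pair l).1, (pair l).2} : Finset (Fin n)) then pauli (z k)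
          else 1) = fun k => if k ∈ ({(pair l).1, (pair l).2} : Finset (Fin n)) then pauli t
          else 1 := by
        funext k
        by_cases hk : k = (pair l).1
        · simp [hk, hz1]
        · by_cases hk' : k = (pair l).2
          · simp [hk', hz2]
          · simp [hk, hk']
      rw [sum_bellMeas hne hdis, h1, trace_pair_maxEnt (hne l)] at h
      simp only [Finset.prod_pair (hne l)] at h
      push_cast
      rw [h, trace_pauli]
      simp only [trace_pauli_mul_transpose]
      rw [Finset.sum_eq_single t (fun t' _ ht' => by simp [ht'.symm]) (by simp), if_pos rfl]
      have : ((if t = 2 then -1 else 1 : ℂ)) ^ 2 = 1 := by split_ifs <;> norm_num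
      rw [this]
      norm_num
      ring
    rw [Finset.sum_congr rfl h, Finset.sum_const, card_filter_eq_eq (hne l), nsmul_eq_mul]
    push_cast
    field_simp

theorem pairSelfTest_reference
    (N : (x : NodeInput n) → NodeOutput n x → Matrix (Qubits n) (Qubits n) ℂ)
    (hN : ∀ x a, N (.vec x) a = tensorOp fun i => signProj (nodeObs (x i)) (a i))
    (hl : ∀ a, N .lozenge a = bellMeas (lozPair n) a)
    (hb : ∀ a, N .blacklozenge a = bellMeas (blackPair n) a) :
    PairSelfTest (pairBehaviour (maxEnt (Qubits n)) pauliProj N) := by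
  refine ⟨?_, ?_, ?_⟩
  · simp [tripleCHSH_reference N hN]
  · have h : (fun z => pairBehaviour (maxEnt (Qubits n)) pauliProj N z .lozenge) = fun z c a =>
        ((pauliProj z c ⊗ₖ bellMeas (lozPair n) a) * maxEnt (Qubits n)).trace.re := by
      funext z c a
      rw [pairBehaviour, hl]
    rw [h]
    refine bellCorrelations_reference (fun l => ?_) fun l l' h => ?_
    · simp [lozPair]
    · rw [Ne, Fin.ext_iff] at h
      simp only [lozPair, ne_eq, Fin.mk.injEq]
      omega
  · have h : (fun z => pairBehaviour (maxEnt (Qubits n)) pauliProj N z .blacklozenge) =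
        fun z c a => ((pauliProj z c ⊗ₖ bellMeas (blackPair n) a) *
          maxEnt (Qubits n)).trace.re := by
      funext z c a
      rw [pairBehaviour, hb]
    rw [h]
    refine bellCorrelations_reference (fun l => ?_) fun l l' h => ?_
    · simp [blackPair]
    · rw [Ne, Fin.ext_iff] at h
      simp only [blackPair, ne_eq, Fin.mk.injEq]
      omega

variable {α β : Type} [Fintype α] [Fintype β] [DecidableEq α] [DecidableEq β]
  {VA : Matrix (Qubits n) α ℂ} {VB : Matrix (Qubits n) β ℂ} {ρ : Matrix (α × β) (α × β) ℂ}

omit [DecidableEq β] in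
theorem partialContract_kronecker_one {ι κ : Type} [Fintype κ] [DecidableEq κ]
    (T : Matrix ι ι ℂ) {σ : Matrix κ κ ℂ} (hσ : σ.trace = 1) :
    partialContract (T ⊗ₖ (1 : Matrix κ κ ℂ)) σ = T := by
  ext i j
  have : ∑ k, σ k k = 1 := hσ
  simp [partialContract, Matrix.one_apply, ← Finset.mul_sum, this]

theorem referenceNetwork_passesSelfTest (hVA : VAᴴ * VA = 1) (hVB : VBᴴ * VB = 1)
    (hρ : IsState ρ) : PassesSelfTest (referenceNetwork n VA VB ρ).behaviour := by
  have hQ := referenceNetwork_isQuantum hVA hVB hρ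
  have hswap : ∀ T : Matrix (Qubits n) (Qubits n) ℂ,
      ((1 : Matrix β β ℂ) ⊗ₖ T).submatrix Prod.swap Prod.swap = T ⊗ₖ (1 : Matrix β β ℂ) := by
    intro T
    ext i j
    exact mul_comm _ _
  refine ⟨fun y w => ?_, fun z x => ?_⟩
  · rw [LineNetwork.marginal_CA hQ]
    have h := hρ.partialTrace.2
    exact pairSelfTest_reference _ (fun x a => partialContract_kronecker_one _ h)
      (fun a => partialContract_kronecker_one _ h) fun a => partialContract_kronecker_one _ h
  · rw [LineNetwork.marginal_DB hQ]
    have h := hρ.swap.partialTrace.2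
    have hm : (referenceNetwork n VA VB ρ).ρBD.submatrix Prod.swap Prod.swap =
      maxEnt (Qubits n) := maxEnt_swap
    rw [hm]
    have h' : ∀ T : Matrix (Qubits n) (Qubits n) ℂ,
        partialContract (((1 : Matrix β β ℂ) ⊗ₖ T).submatrix Prod.swap Prod.swap)
          (partialContract (ρ.submatrix Prod.swap Prod.swap) (1 : Matrix α α ℂ)) = T := by
      intro T
      rw [hswap, partialContract_kronecker_one _ h]
    exact pairSelfTest_reference _ (fun x a => h' _) (fun a => h' _) fun a => h' _

end ReferenceCorrelations

end DICert

namespace DICert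

/-! ### The value of the certification quantity in the reference strategy. -/

section ReferenceValue

variable {n : ℕ} {α β : Type} [Fintype α] [Fintype β] [DecidableEq α] [DecidableEq β]
  {VA : Matrix (Qubits n) α ℂ} {VB : Matrix (Qubits n) β ℂ} {ρ : Matrix (α × β) (α × β) ℂ}

omit [Fintype α] [DecidableEq α] in
/-- Entanglement swapping with the projection onto the maximally entangled state. -/
theorem nodeEffect_maxEnt {ι : Type} [Fintype ι] [DecidableEq ι] (M : Matrix ι ι ℂ)
    (V : Matrix ι α ℂ) {F : Matrix (ι × α) (ι × α) ℂ}
    (hF : ∀ i k j l, F (i, k) (j, l) = (Fintype.card ι : ℂ)⁻¹ * (star (V i k) * V j l)) :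
    nodeEffect (maxEnt ι) M F = ((Fintype.card ι : ℂ)⁻¹ ^ 2) • (Vᴴ * M * V) := by
  ext k l
  rw [nodeEffect_apply, Fintype.sum_prod_type]
  simp only [Fintype.sum_prod_type, hF, maxEnt, Matrix.of_apply, Matrix.smul_apply,
    Matrix.mul_apply, Matrix.conjTranspose_apply, smul_eq_mul, Finset.mul_sum, Finset.sum_mul]
  rw [Finset.sum_comm]
  rw [Finset.sum_comm]
  -- The state identifies Charlie's indices with those of `A₀`. One factor `1/d` comes from the
  -- state and one from the projection onto `Φ⁺`; no transposition of `M` remains.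
  have h : ∀ c i : ι, ∑ c' : ι, ∑ j : ι, M c c' * ((Fintype.card ι : ℂ)⁻¹ *
      (star (V i k) * V j l)) * (if c' = j ∧ c = i then (Fintype.card ι : ℂ)⁻¹ else 0) =
      if c = i then ∑ c', (Fintype.card ι : ℂ)⁻¹ ^ 2 * (star (V c k) * M c c' * V c' l) else 0 := by
    intro c i
    split_ifs with hc
    · subst hc
      refine Finset.sum_congr rfl fun c' _ => ?_
      rw [Finset.sum_eq_single c' (fun j _ hj => by simp [hj.symm]) (by simp)]
      simp only [and_self, if_true]
      ring
    · simp only [hc, and_false, if_false, mul_zero, Finset.sum_const_zero]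
  simp only [h, Finset.sum_ite_eq, Finset.mem_univ, if_true]
  exact Finset.sum_comm

omit [Fintype α] [DecidableEq α] in
theorem conjTranspose_one_kronecker_mul_maxEnt_apply {ι : Type} [Fintype ι] [DecidableEq ι]
    (V : Matrix ι α ℂ) (i j : ι) (k l : α) :
    (((1 : Matrix ι ι ℂ) ⊗ₖ V)ᴴ * maxEnt ι * ((1 : Matrix ι ι ℂ) ⊗ₖ V)) (i, k) (j, l) =
      (Fintype.card ι : ℂ)⁻¹ * (star (V i k) * V j l) := by
  simp only [Matrix.mul_apply, Matrix.conjTranspose_apply, Matrix.kroneckerMap_apply,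
    Fintype.sum_prod_type, maxEnt, Matrix.of_apply, Matrix.one_apply, ite_and]
  simp [apply_ite]
  ring

omit [Fintype α] [DecidableEq α] in
theorem conjTranspose_kronecker_one_mul_maxEnt_apply {ι : Type} [Fintype ι] [DecidableEq ι]
    (V : Matrix ι α ℂ) (i j : ι) (k l : α) :
    ((V ⊗ₖ (1 : Matrix ι ι ℂ))ᴴ * maxEnt ι * (V ⊗ₖ (1 : Matrix ι ι ℂ))) (k, i) (l, j) =
      (Fintype.card ι : ℂ)⁻¹ * (star (V i k) * V j l) := by
  simp only [Matrix.mul_apply, Matrix.conjTranspose_apply, Matrix.kroneckerMap_apply,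
    Fintype.sum_prod_type, maxEnt, Matrix.of_apply, Matrix.one_apply, ite_and]
  simp [apply_ite]
  ring

omit [DecidableEq α] [DecidableEq β] in
theorem embedState_posSemidef (hρ : IsState ρ) : (embedState VA VB ρ).PosSemidef :=
  hρ.1.mul_mul_conjTranspose_same _

theorem referenceNetwork_behaviour_star (hρ : IsState ρ) (z w : PauliInput n) (c d : Signs n) :
    (((referenceNetwork n VA VB ρ).behaviour z .star .star w c (1 : ℤˣ) (1 : ℤˣ) d : ℝ) : ℂ) =
      ((pauliProj z c ⊗ₖ pauliProj w d) * embedState VA VB ρ).trace / ((2 : ℂ) ^ n) ^ 4 := by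
  have hcard : (Fintype.card (Qubits n) : ℂ) = 2 ^ n := by simp
  have hA : nodeEffect (maxEnt (Qubits n)) (pauliProj z c)
      ((referenceNetwork n VA VB ρ).MA .star (1 : ℤˣ)) = _ :=
    nodeEffect_maxEnt _ VA fun i k j l => conjTranspose_one_kronecker_mul_maxEnt_apply VA i j k l
  have hB : nodeEffect (maxEnt (Qubits n)) (pauliProj w d)
      (((referenceNetwork n VA VB ρ).MB .star (1 : ℤˣ)).submatrix Prod.swap Prod.swap) = _ :=
    nodeEffect_maxEnt _ VB fun i k j l => conjTranspose_kronecker_one_mul_maxEnt_apply VB i j k l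
  have htr : ((pauliProj z c ⊗ₖ pauliProj w d) * embedState VA VB ρ).trace =
      (((VAᴴ * pauliProj z c * VA) ⊗ₖ (VBᴴ * pauliProj w d * VB)) * ρ).trace := by
    rw [embedState, ← Matrix.mul_assoc, Matrix.trace_mul_comm _ (VA ⊗ₖ VB)ᴴ,
      Matrix.conjTranspose_kronecker, ← kron_mul_kron, ← kron_mul_kron]
    simp only [Matrix.mul_assoc]
  -- The behaviour is defined as a real part; positivity shows that nothing is lost.
  have hnn := trace_mul_nonneg (((isPOVM_pauliProj z).1 c).kronecker ((isPOVM_pauliProj w).1 d))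
    (embedState_posSemidef (VA := VA) (VB := VB) hρ)
  have hre := Complex.le_def.mp hnn
  have hre' : ((((pauliProj z c ⊗ₖ pauliProj w d) * embedState VA VB ρ).trace.re : ℝ) : ℂ) =
      ((pauliProj z c ⊗ₖ pauliProj w d) * embedState VA VB ρ).trace :=
    Complex.ext rfl hre.2
  rw [LineNetwork.behaviour_eq]
  have h1 : (referenceNetwork n VA VB ρ).ρCA = maxEnt (Qubits n) := rfl
  have h2 : (referenceNetwork n VA VB ρ).ρBD.submatrix Prod.swap Prod.swap = maxEnt (Qubits n) :=
    maxEnt_swap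
  have h3 : (referenceNetwork n VA VB ρ).MC z c = pauliProj z c := rfl
  have h4 : (referenceNetwork n VA VB ρ).MD w d = pauliProj w d := rfl
  have h5 : (referenceNetwork n VA VB ρ).ρAB = ρ := rfl
  rw [h1, h2, h3, h4, h5, hA, hB, Matrix.smul_kronecker, Matrix.kronecker_smul, smul_smul,
    Matrix.smul_mul, Matrix.trace_smul, ← htr, hcard, smul_eq_mul]
  have h6 : ((2 : ℂ) ^ n)⁻¹ ^ 2 * ((2 : ℂ) ^ n)⁻¹ ^ 2 = (((((2 : ℝ) ^ n) ^ 4)⁻¹ : ℝ) : ℂ) := by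
    push_cast
    ring
  rw [h6, Complex.re_ofReal_mul, Complex.ofReal_mul, hre']
  push_cast
  rw [inv_mul_eq_div]

theorem certValue_reference (hρ : IsState ρ) (ω : Coefficients n) :
    ((certValue ω (referenceNetwork n VA VB ρ).behaviour : ℝ) : ℂ) =
      (witnessOp ω * embedState VA VB ρ).trace / ((2 : ℂ) ^ n) ^ 4 := by
  rw [witnessOp_mul_trace, certValue]
  push_cast
  simp only [referenceNetwork_behaviour_star hρ, Finset.sum_div, mul_div_assoc]

end ReferenceValue

/-! ## Decompositions in Pauli projectors -/

section Tomography

variable {n : ℕ}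

theorem exists_signProj_decomposition (M : Matrix (Fin 2) (Fin 2) ℂ) :
    ∃ x : Fin 3 × ℤˣ → ℂ, M = ∑ p, x p • signProj (pauli p.1) p.2 := by
  -- From `M = ½ (tr M · 1 + ∑_t tr(M σ_t) σ_t)` with `σ_t = π_+ - π_-`, the identity being spread
  -- evenly over the three bases `1 = π_+ + π_-`.
  refine ⟨fun p => M.trace / 6 + ((p.2 : ℤ) : ℂ) * ((M * pauli p.1).trace / 2), ?_⟩
  rw [Fintype.sum_prod_type, Fin.sum_univ_three]
  simp only [UnitsInt.univ, Finset.sum_pair (show (1 : ℤˣ) ≠ -1 by decide)]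
  have hI := Complex.I_mul_I
  ext i j
  simp only [Matrix.trace_fin_two, Matrix.mul_apply, Fin.sum_univ_two, signProj,
    Matrix.add_apply, Matrix.smul_apply, smul_eq_mul]
  fin_cases i <;> fin_cases j <;> simp [pauli] <;> grind

theorem exists_pauliProj_decomposition_tensorOp (f : Fin n → Matrix (Fin 2) (Fin 2) ℂ) :
    ∃ x : PauliInput n → Signs n → ℂ, tensorOp f = ∑ z, ∑ c, x z c • pauliProj z c := by
  choose x hx using fun i => exists_signProj_decomposition (f i)
  refine ⟨fun z c => ∏ i, x i (z i, c i), ?_⟩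
  have h : f = fun i => ∑ p, x i p • signProj (pauli p.1) p.2 := funext hx
  rw [h, ← sum_tensorOp fun i p => x i p • signProj (pauli p.1) p.2]
  simp only [tensorOp_smul]
  rw [← Fintype.sum_prod_type' fun (z : PauliInput n) (c : Signs n) =>
    (∏ i, x i (z i, c i)) • pauliProj z c]
  exact Fintype.sum_equiv (Equiv.arrowProdEquivProdArrow (Fin n) (fun _ => Fin 3) fun _ => ℤˣ) _ _ fun _ => rfl

theorem tensorOp_single (u v : Qubits n) :
    tensorOp (fun i => Matrix.single (u i) (v i) (1 : ℂ)) = Matrix.single u v 1 := by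
  ext a b
  simp only [tensorOp, Matrix.of_apply, Matrix.single_apply]
  rw [Finset.prod_ite_zero]
  simp [funext_iff, forall_and]

/-- Every operator on `n + n` qubits is a complex combination of products of Pauli projectors. -/
theorem exists_complex_decomposition (W : Matrix (Qubits n × Qubits n) (Qubits n × Qubits n) ℂ) :
    ∃ x : PauliInput n → PauliInput n → Signs n → Signs n → ℂ,
      W = ∑ z, ∑ w, ∑ c, ∑ d, x z w c d • (pauliProj z c ⊗ₖ pauliProj w d) := by
  choose x hx using fun u v : Qubits n =>
    exists_pauliProj_decomposition_tensorOp fun i => Matrix.single (u i) (v i) (1 : ℂ)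
  simp only [tensorOp_single] at hx
  let v : (PauliInput n × PauliInput n) × (Signs n × Signs n) →
      Matrix (Qubits n × Qubits n) (Qubits n × Qubits n) ℂ :=
    fun k => pauliProj k.1.1 k.2.1 ⊗ₖ pauliProj k.1.2 k.2.2
  have hmem : W ∈ Submodule.span ℂ (Set.range v) := by
    rw [Matrix.matrix_eq_sum_single W]
    refine Submodule.sum_mem _ fun p _ => Submodule.sum_mem _ fun q _ => ?_
    have h : Matrix.single p q (W p q) = W p q •
        (Matrix.single p.1 q.1 (1 : ℂ) ⊗ₖ Matrix.single p.2 q.2 (1 : ℂ)) := by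
      rw [Matrix.single_kronecker_single, Matrix.smul_single]
      simp
    rw [h, hx p.1 q.1, hx p.2 q.2]
    simp only [← sum_kronecker, ← kronecker_sum, Matrix.smul_kronecker, Matrix.kronecker_smul]
    refine Submodule.smul_mem _ _ ?_
    repeat'
      first
      | exact Submodule.subset_span ⟨((_, _), (_, _)), rfl⟩
      | refine Submodule.sum_mem _ fun _ _ => ?_
      | refine Submodule.smul_mem _ _ ?_
  obtain ⟨y, hy⟩ := (Submodule.mem_span_range_iff_exists_fun ℂ).mp hmem
  refine ⟨fun z w c d => y ((z, w), (c, d)), ?_⟩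
  rw [← hy]
  simp only [Fintype.sum_prod_type, v]

/-- Every Hermitian operator on `n + n` qubits has a decomposition in Pauli projectors with real
coefficients. -/
theorem exists_witnessOp_eq {W : Matrix (Qubits n × Qubits n) (Qubits n × Qubits n) ℂ}
    (hW : W.IsHermitian) : ∃ ω : Coefficients n, witnessOp ω = W := by
  obtain ⟨x, hx⟩ := exists_complex_decomposition W
  refine ⟨fun z w c d => (x z w c d).re, ?_⟩
  have hπ : ∀ z w c d, (pauliProj (n := n) z c ⊗ₖ pauliProj (n := n) w d)ᴴ =
      pauliProj z c ⊗ₖ pauliProj w d := fun z w c d =>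
    (((isPOVM_pauliProj z).1 c).kronecker ((isPOVM_pauliProj w).1 d)).1
  -- The conjugate coefficients represent `W† = W` as well, so their average with the original ones,
  -- the real parts, also represents `W`.
  have h1 : W = ∑ z, ∑ w, ∑ c, ∑ d, star (x z w c d) • (pauliProj z c ⊗ₖ pauliProj w d) := by
    rw [← hW.eq]
    conv_lhs => rw [hx]
    simp only [Matrix.conjTranspose_sum, Matrix.conjTranspose_smul, hπ]
  have h2 : W = (1 / 2 : ℂ) • (W + W) := by module
  rw [h2]
  conv_rhs => arg 2; arg 1; rw [hx]
  conv_rhs => arg 2; arg 2; rw [h1]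
  simp only [← Finset.sum_add_distrib, Finset.smul_sum, ← add_smul, smul_smul, witnessOp]
  refine Finset.sum_congr rfl fun z _ => Finset.sum_congr rfl fun w _ => Finset.sum_congr rfl
    fun c _ => Finset.sum_congr rfl fun d _ => ?_
  congr 1
  rw [Complex.re_eq_add_conj, div_eq_mul_inv, mul_comm, one_div]
  rfl

end Tomography

end DICert

namespace DICert

/-! ## Entanglement witnesses -/

section Convexity

/-- In finite dimension the convex hull of a compact set is compact. -/
theorem isCompact_convexHull {E : Type} [NormedAddCommGroup E] [NormedSpace ℝ E]
    [FiniteDimensional ℝ E] {K : Set E} (hK : IsCompact K) : IsCompact (convexHull ℝ K) := by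
  have h : convexHull ℝ K = ⋃ m : Fin (Module.finrank ℝ E + 2),
      (fun q : (Fin m → ℝ) × (Fin m → E) => ∑ i, q.1 i • q.2 i) ''
        (stdSimplex ℝ (Fin m) ×ˢ Set.pi Set.univ fun _ => K) := by
    apply Set.Subset.antisymm
    · intro x hx
      -- Carathéodory: affinely independent points number at most the dimension plus one, so the
      -- hull is a finite union of continuous images of compact sets.
      obtain ⟨ι, _, z, w, hz, hind, hw, hw1, rfl⟩ := eq_pos_convex_span_of_mem_convexHull hx
      have hcard : Fintype.card ι < Module.finrank ℝ E + 2 :=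
        Nat.lt_succ_of_le (hind.card_le_finrank_succ.trans
          (Nat.succ_le_succ (Submodule.finrank_le _)))
      let e := (Fintype.equivFin ι).symm
      refine Set.mem_iUnion.mpr ⟨⟨Fintype.card ι, hcard⟩, (w ∘ e, z ∘ e), ⟨⟨?_, ?_⟩, ?_⟩, ?_⟩
      · exact fun i => (hw _).le
      · rw [← hw1]
        exact e.sum_comp w
      · exact fun i _ => hz ⟨_, rfl⟩
      · exact e.sum_comp fun i => w i • z i
    · refine Set.iUnion_subset fun m => ?_
      rintro _ ⟨⟨w, z⟩, ⟨hw, hz⟩, rfl⟩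
      exact (convex_convexHull ℝ K).sum_mem (fun i _ => hw.1 i) hw.2
        fun i _ => subset_convexHull ℝ K (hz i trivial)
  rw [h]
  refine isCompact_iUnion fun m => ?_
  refine ((isCompact_stdSimplex ℝ _).prod (isCompact_univ_pi fun _ => hK)).image ?_
  fun_prop

end Convexity

section Witnesses

attribute [local instance] Matrix.normedAddCommGroup Matrix.normedSpace

variable {ι κ : Type} [Fintype ι] [Fintype κ]

/-- States are the image of the unit sphere under `B ↦ B†B`, because `tr B†B` is the squared
Euclidean norm of the entries. -/
theorem isCompact_setOf_isState : IsCompact {ρ : Matrix ι ι ℂ | IsState ρ} := by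
  have h : {ρ : Matrix ι ι ℂ | IsState ρ} =
      (fun x : EuclideanSpace ℂ (ι × ι) => (Matrix.of fun i j => x (i, j))ᴴ *
        (Matrix.of fun i j => x (i, j) : Matrix ι ι ℂ)) '' Metric.sphere 0 1 := by
    have htr : ∀ x : EuclideanSpace ℂ (ι × ι), ((Matrix.of fun i j => x (i, j))ᴴ *
        (Matrix.of fun i j => x (i, j) : Matrix ι ι ℂ)).trace = ((‖x‖ ^ 2 : ℝ) : ℂ) := by
      intro x
      rw [EuclideanSpace.norm_sq_eq, Fintype.sum_prod_type, Finset.sum_comm]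
      simp [Matrix.trace, Matrix.mul_apply, ← Complex.normSq_eq_conj_mul_self,
        Complex.normSq_eq_norm_sq]
    ext ρ
    simp only [Set.mem_ofPred_eq, Set.mem_image, mem_sphere_zero_iff_norm]
    constructor
    · rintro ⟨hρ, h1⟩
      obtain ⟨B, rfl⟩ := exists_conjTranspose_mul_self hρ
      refine ⟨WithLp.toLp 2 fun p => B p.1 p.2, ?_, rfl⟩
      have h2 := htr (WithLp.toLp 2 fun p => B p.1 p.2)
      have h3 : ‖(WithLp.toLp 2 fun p : ι × ι => B p.1 p.2 : EuclideanSpace ℂ (ι × ι))‖ ^ 2 = 1 := by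
        have : ((‖(WithLp.toLp 2 fun p : ι × ι => B p.1 p.2 :
          EuclideanSpace ℂ (ι × ι))‖ ^ 2 : ℝ) : ℂ) = 1 := by rw [← h2]; exact h1
        exact_mod_cast this
      exact (pow_eq_one_iff_of_nonneg (norm_nonneg _) two_ne_zero).mp h3
    · rintro ⟨x, hx, rfl⟩
      refine ⟨Matrix.posSemidef_conjTranspose_mul_self _, ?_⟩
      rw [htr, hx]
      norm_num
  rw [h]
  refine (isCompact_sphere _ _).image ?_
  fun_prop

theorem exists_trace_re_eq [DecidableEq ι] (f : Matrix ι ι ℂ →ₗ[ℝ] ℝ) :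
    ∃ W : Matrix ι ι ℂ, ∀ X : Matrix ι ι ℂ, (W * X).trace.re = f X := by
  -- The entry is read off from `f` on a matrix unit and on `i` times it; the minus sign comes from
  -- `Re(w i) = -Im w`.
  refine ⟨Matrix.of fun j i => ⟨f (Matrix.single i j 1), -f (Matrix.single i j Complex.I)⟩,
    fun X => ?_⟩
  have h : X = ∑ i, ∑ j, ((X i j).re • Matrix.single i j (1 : ℂ) +
      (X i j).im • Matrix.single i j Complex.I) := by
    conv_lhs => rw [Matrix.matrix_eq_sum_single X]
    refine Finset.sum_congr rfl fun i _ => Finset.sum_congr rfl fun j _ => ?_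
    rw [Matrix.smul_single, Matrix.smul_single, ← Matrix.single_add]
    congr 1
    simp [Complex.re_add_im]
  conv_rhs => rw [h]
  simp only [map_sum, map_add, map_smul, Matrix.trace, Matrix.diag, Matrix.mul_apply,
    Matrix.of_apply, Complex.re_sum, Complex.mul_re, smul_eq_mul]
  rw [Finset.sum_comm]
  refine Finset.sum_congr rfl fun i _ => Finset.sum_congr rfl fun j _ => ?_
  ring

theorem mem_convexHull_product_isSepState {ρ : Matrix (ι × κ) (ι × κ) ℂ}
    (h : ρ ∈ convexHull ℝ ((fun q : Matrix ι ι ℂ × Matrix κ κ ℂ => q.1 ⊗ₖ q.2) ''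
      ({σ | IsState σ} ×ˢ {τ | IsState τ}))) : IsSepState ρ := by
  obtain ⟨J, _, w, z, hw, hw1, hz, rfl⟩ := mem_convexHull_iff_exists_fintype.mp h
  choose q hq hqz using hz
  let e := (Fintype.equivFin J).symm
  refine ⟨Fintype.card J, w ∘ e, fun i => (q (e i)).1, fun i => (q (e i)).2, fun i => hw _, ?_,
    fun i => (hq _).1, fun i => (hq _).2, ?_⟩
  · rw [← hw1]
    exact e.sum_comp w
  · rw [← e.sum_comp]
    refine Finset.sum_congr rfl fun i _ => ?_
    rw [← hqz]
    ext a b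
    simp

/-- Every entangled state has an entanglement witness. -/
theorem IsEntangled.exists_isWitnessFor {ρ : Matrix (ι × κ) (ι × κ) ℂ} (hρ : IsEntangled ρ) :
    ∃ W : Matrix (ι × κ) (ι × κ) ℂ, IsWitnessFor W ρ := by
  classical
  set P := (fun q : Matrix ι ι ℂ × Matrix κ κ ℂ => q.1 ⊗ₖ q.2) ''
      ({σ | IsState σ} ×ˢ {τ | IsState τ}) with hP
  have hPc : IsCompact P := by
    refine (isCompact_setOf_isState.prod isCompact_setOf_isState).image ?_
    refine continuous_matrix fun i j => ?_
    simp only [Matrix.kroneckerMap_apply]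
    fun_prop
  -- The separating functional satisfies `f ρ < u < f` on all product states.
  obtain ⟨f, u, hfρ, hf⟩ := geometric_hahn_banach_point_closed (convex_convexHull ℝ P)
    (isCompact_convexHull hPc).isClosed fun h => hρ.2 (mem_convexHull_product_isSepState h)
  obtain ⟨W, hW⟩ := exists_trace_re_eq (f : Matrix (ι × κ) (ι × κ) ℂ →ₗ[ℝ] ℝ)
  -- The Hermitian part has the same real expectation on states, and subtracting `u · 1` moves the
  -- threshold to 0, since states have trace one.
  have hval : ∀ X : Matrix (ι × κ) (ι × κ) ℂ, IsState X →
      (((1 / 2 : ℂ) • (W + Wᴴ) - (u : ℂ) • 1) * X).trace.re = f X - u := by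
    intro X hX
    have h1 : (Wᴴ * X).trace.re = (W * X).trace.re := by
      have : (Wᴴ * X) = (X * W)ᴴ := by rw [Matrix.conjTranspose_mul, hX.1.1.eq]
      rw [this, Matrix.trace_conjTranspose, Matrix.trace_mul_comm X]
      simp
    rw [Matrix.sub_mul, Matrix.smul_mul, Matrix.smul_mul, Matrix.one_mul, Matrix.add_mul,
      Matrix.trace_sub, Matrix.trace_smul, Matrix.trace_smul, hX.2, Matrix.trace_add,
      Complex.sub_re]
    have h2 : (1 / 2 : ℂ) = ((1 / 2 : ℝ) : ℂ) := by norm_num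
    rw [h2, smul_eq_mul, smul_eq_mul, Complex.re_ofReal_mul, Complex.add_re, h1, hW]
    simp
    ring
  refine ⟨(1 / 2 : ℂ) • (W + Wᴴ) - (u : ℂ) • 1, ⟨?_, ?_⟩, ?_⟩
  · rw [Matrix.IsHermitian, Matrix.conjTranspose_sub, Matrix.conjTranspose_smul,
      Matrix.conjTranspose_add, Matrix.conjTranspose_conjTranspose, Matrix.conjTranspose_smul,
      Matrix.conjTranspose_one, add_comm]
    simp
  · rintro _ ⟨k, p, σ, τ, hp, hp1, hσ, hτ, rfl⟩
    rw [Finset.mul_sum, Matrix.trace_sum, Complex.re_sum]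
    refine Finset.sum_nonneg fun i _ => ?_
    rw [Matrix.mul_smul, Matrix.trace_smul, smul_eq_mul, Complex.re_ofReal_mul]
    refine mul_nonneg (hp i) ?_
    have hst : IsState (σ i ⊗ₖ τ i) := ⟨(hσ i).1.kronecker (hτ i).1, by
      rw [Matrix.trace_kronecker, (hσ i).2, (hτ i).2, one_mul]⟩
    rw [hval _ hst]
    have := hf (σ i ⊗ₖ τ i) (subset_convexHull ℝ P ⟨(σ i, τ i), ⟨hσ i, hτ i⟩, rfl⟩)
    linarith
  · rw [hval _ hρ.1]
    linarith

end Witnesses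

end DICert

namespace DICert

/-! ## Certification of entangled states -/

section Certification

variable {n : ℕ} {α β : Type} [Fintype α] [Fintype β]

theorem IsState.nonempty {ι : Type} [Fintype ι] {ρ : Matrix ι ι ℂ} (h : IsState ρ) : Nonempty ι := by
  by_contra hι
  rw [not_nonempty_iff] at hι
  simpa [Matrix.trace] using h.2

/-- States which are sums of products of positive operators are separable. -/
theorem isSepState_of_sum_kronecker {ρ : Matrix (α × β) (α × β) ℂ} (hρ : IsState ρ) {k : ℕ}
    {G : Fin k → Matrix α α ℂ} {H : Fin k → Matrix β β ℂ} (hG : ∀ i, (G i).PosSemidef)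
    (hH : ∀ i, (H i).PosSemidef) (h : ρ = ∑ i, G i ⊗ₖ H i) : IsSepState ρ := by
  obtain ⟨a, b⟩ := hρ.nonempty.some
  have : Nonempty α := ⟨a⟩
  have : Nonempty β := ⟨b⟩
  choose s X hs hX hGX using fun i => exists_smul_isState (hG i)
  choose t Y ht hY hHY using fun i => exists_smul_isState (hH i)
  have hsum : ρ = ∑ i, ((s i * t i : ℝ) : ℂ) • (X i ⊗ₖ Y i) := by
    rw [h]
    refine Finset.sum_congr rfl fun i _ => ?_
    conv_lhs => rw [hGX i, hHY i]
    rw [Matrix.smul_kronecker, Matrix.kronecker_smul, smul_smul, Complex.ofReal_mul]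
  refine ⟨k, fun i => s i * t i, X, Y, fun i => mul_nonneg (hs i) (ht i), ?_, hX, hY, hsum⟩
  have htr := hρ.2
  rw [hsum, Matrix.trace_sum] at htr
  simp only [Matrix.trace_smul, Matrix.trace_kronecker, (hX _).2, (hY _).2, smul_eq_mul,
    mul_one] at htr
  exact_mod_cast htr

variable [DecidableEq α] [DecidableEq β] {VA : Matrix (Qubits n) α ℂ}
  {VB : Matrix (Qubits n) β ℂ} {ρ : Matrix (α × β) (α × β) ℂ}

theorem conjTranspose_mul_embedState_mul (hVA : VAᴴ * VA = 1) (hVB : VBᴴ * VB = 1) :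
    (VA ⊗ₖ VB)ᴴ * embedState VA VB ρ * (VA ⊗ₖ VB) = ρ := by
  have h : (VA ⊗ₖ VB)ᴴ * (VA ⊗ₖ VB) = 1 := by
    rw [Matrix.conjTranspose_kronecker, kron_mul_kron, hVA, hVB, Matrix.one_kronecker_one]
  rw [embedState, Matrix.mul_assoc, Matrix.mul_assoc, Matrix.mul_assoc, h, Matrix.mul_one,
    ← Matrix.mul_assoc, h, Matrix.one_mul]

/-- Local isometries preserve entanglement. -/
theorem IsEntangled.embedState (hVA : VAᴴ * VA = 1) (hVB : VBᴴ * VB = 1) (h : IsEntangled ρ) :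
    IsEntangled (embedState VA VB ρ) := by
  refine ⟨⟨embedState_posSemidef h.1, ?_⟩, ?_⟩
  · rw [DICert.embedState, Matrix.trace_mul_comm, ← Matrix.mul_assoc,
      Matrix.conjTranspose_kronecker, kron_mul_kron, hVA, hVB, Matrix.one_kronecker_one,
      Matrix.one_mul, h.1.2]
  · rintro ⟨k, p, σ, τ, hp, -, hσ, hτ, hsum⟩
    -- Compressing a separable decomposition by the isometries returns to `ρ`; the compressed
    -- factors are positive but no longer normalised.
    refine h.2 (isSepState_of_sum_kronecker h.1
      (G := fun i => (p i : ℂ) • (VAᴴ * σ i * VA)) (H := fun i => VBᴴ * τ i * VB)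
      (fun i => ((hσ i).1.conjTranspose_mul_mul_same VA).smul (by exact_mod_cast hp i))
      (fun i => (hτ i).1.conjTranspose_mul_mul_same VB) ?_)
    conv_lhs => rw [← conjTranspose_mul_embedState_mul (ρ := ρ) hVA hVB, hsum]
    rw [Matrix.mul_sum, Matrix.sum_mul]
    refine Finset.sum_congr rfl fun i _ => ?_
    rw [Matrix.mul_smul, Matrix.smul_mul, Matrix.conjTranspose_kronecker, kron_mul_kron,
      kron_mul_kron, Matrix.smul_kronecker]

theorem exists_certValue_neg (hVA : VAᴴ * VA = 1) (hVB : VBᴴ * VB = 1) (h : IsEntangled ρ) :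
    ∃ ω : Coefficients n, IsWitnessFor (witnessOp ω) (embedState VA VB ρ) ∧
      certValue ω (referenceNetwork n VA VB ρ).behaviour < 0 := by
  obtain ⟨W, hW⟩ := (h.embedState hVA hVB).exists_isWitnessFor
  obtain ⟨ω, rfl⟩ := exists_witnessOp_eq hW.1.1
  refine ⟨ω, hW, ?_⟩
  have h1 := congrArg Complex.re (certValue_reference (VA := VA) (VB := VB) h.1 ω)
  have h2 : ((2 : ℂ) ^ n) ^ 4 = ((((2 : ℝ) ^ n) ^ 4 : ℝ) : ℂ) := by push_cast; rfl
  rw [Complex.ofReal_re, h2, Complex.div_ofReal_re] at h1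
  rw [h1]
  exact div_neg_of_neg_of_pos hW.2 (by positivity)

theorem notFromSeparable_of_certValue_neg (hn : 1 ≤ n) {p : Behaviour n} (hp : PassesSelfTest p)
    {ω : Coefficients n} (hω : NonnegOnSeparable (witnessOp ω)) (h : certValue ω p < 0) :
    NotFromSeparable p := by
  intro C A₀ A B B₀ D _ _ _ _ _ _ _ _ _ _ _ _ N hN hsep hNp
  subst hNp
  exact absurd (N.certValue_nonneg hn hN hp hsep hω) (not_le.mpr h)

theorem referenceNetwork_notFromSeparable (hn : 1 ≤ n) (hVA : VAᴴ * VA = 1) (hVB : VBᴴ * VB = 1)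
    (h : IsEntangled ρ) : NotFromSeparable (referenceNetwork n VA VB ρ).behaviour := by
  obtain ⟨ω, hω, hneg⟩ := exists_certValue_neg hVA hVB h
  exact notFromSeparable_of_certValue_neg hn (referenceNetwork_passesSelfTest hVA hVB h.1) hω.1 hneg

theorem exists_isometry_of_card_le (hα : Fintype.card α ≤ 2 ^ n) :
    ∃ V : Matrix (Qubits n) α ℂ, Vᴴ * V = 1 := by
  have hc : Fintype.card α ≤ Fintype.card (Qubits n) := by simpa using hα
  obtain ⟨e⟩ := Function.Embedding.nonempty_of_card_le hc
  refine ⟨Matrix.of fun u a => if u = e a then 1 else 0, ?_⟩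
  ext a b
  simp [Matrix.mul_apply, Matrix.one_apply, e.injective.eq_iff, eq_comm]

theorem IsEntangled.diCertifiable (h : IsEntangled ρ) : DICertifiable ρ := by
  -- Any `n ≥ 1` with `2^n` at least both dimensions would do; the summand 1 ensures `n ≥ 1`.
  set n := Fintype.card α + Fintype.card β + 1 with hn
  have h2 : n < 2 ^ n := Nat.lt_two_pow_self
  obtain ⟨VA, hVA⟩ := exists_isometry_of_card_le (n := n) (α := α) (by omega)
  obtain ⟨VB, hVB⟩ := exists_isometry_of_card_le (n := n) (α := β) (by omega)
  exact ⟨n, Qubits n, Qubits n, Qubits n, Qubits n, inferInstance, inferInstance, inferInstance,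
    inferInstance, inferInstance, inferInstance, inferInstance, inferInstance,
    referenceNetwork n VA VB ρ, by omega, referenceNetwork_isQuantum hVA hVB h.1, rfl,
    referenceNetwork_notFromSeparable (by omega) hVA hVB h⟩

end Certification

end DICert

theorem mainTheorem4 :
    (∀ n : ℕ, 1 ≤ n →
      -- every Hermitian operator on n + n qubits has a decomposition in Pauli projectors
      (∀ W : Matrix (Qubits n × Qubits n) (Qubits n × Qubits n) ℂ, W.IsHermitian →
        ∃ ω : Coefficients n, witnessOp ω = W) ∧
      -- in every quantum experiment in the network that passes the self-test:
      (∀ (C A₀ A B B₀ D : Type)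
        [Fintype C] [Fintype A₀] [Fintype A] [Fintype B] [Fintype B₀] [Fintype D]
        [DecidableEq C] [DecidableEq A₀] [DecidableEq A] [DecidableEq B] [DecidableEq B₀]
        [DecidableEq D] (N : LineNetwork n C A₀ A B B₀ D),
        N.IsQuantum → PassesSelfTest N.behaviour →
          -- the auxiliary states and the measurements of Charlie and Daisy are self-tested
          SelfTestsPauli N.ρCA N.MC ∧
          SelfTestsPauli (N.ρBD.submatrix Prod.swap Prod.swap) N.MD ∧
          -- the inequality holds if the state shared by Alice and Bob is separable
          (IsSepState N.ρAB → ∀ ω : Coefficients n, NonnegOnSeparable (witnessOp ω) →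
            0 ≤ certValue ω N.behaviour)) ∧
      -- for each state, embedded in n + n qubits, the reference strategy passes the self-test,
      -- attains the value tr[W ρ]/d⁴ with d = 2^n, and certifies the state if it is entangled
      (∀ (α β : Type) [Fintype α] [Fintype β] [DecidableEq α] [DecidableEq β]
        (VA : Matrix (Qubits n) α ℂ) (VB : Matrix (Qubits n) β ℂ)
        (ρ : Matrix (α × β) (α × β) ℂ),
        VAᴴ * VA = 1 → VBᴴ * VB = 1 → IsState ρ →
          (referenceNetwork n VA VB ρ).IsQuantum ∧
          PassesSelfTest (referenceNetwork n VA VB ρ).behaviour ∧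
          (∀ ω : Coefficients n,
            ((certValue ω (referenceNetwork n VA VB ρ).behaviour : ℝ) : ℂ) =
              (witnessOp ω * embedState VA VB ρ).trace / ((2 : ℂ) ^ n) ^ 4) ∧
          (IsEntangled ρ →
            (∃ ω : Coefficients n, IsWitnessFor (witnessOp ω) (embedState VA VB ρ) ∧
              certValue ω (referenceNetwork n VA VB ρ).behaviour < 0) ∧
            NotFromSeparable (referenceNetwork n VA VB ρ).behaviour))) ∧
    -- every bipartite entangled state, of any dimensions, is certified device-independently
    (∀ (α β : Type) [Fintype α] [Fintype β] [DecidableEq α] [DecidableEq β]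
      (ρ : Matrix (α × β) (α × β) ℂ), IsEntangled ρ → DICertifiable ρ) := by
  refine ⟨fun n hn => ⟨fun W hW => exists_witnessOp_eq hW, ?_, ?_⟩, ?_⟩
  · intro C A₀ A B B₀ D _ _ _ _ _ _ _ _ _ _ _ _ N hN h
    obtain ⟨hC, hD⟩ := N.selfTests hn hN h
    exact ⟨hC, hD, fun hsep ω hω => N.certValue_nonneg hn hN h hsep hω⟩
  · intro α β _ _ _ _ VA VB ρ hVA hVB hρ
    exact ⟨referenceNetwork_isQuantum hVA hVB hρ, referenceNetwork_passesSelfTest hVA hVB hρ,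
      certValue_reference hρ, fun h =>
        ⟨exists_certValue_neg hVA hVB h, referenceNetwork_notFromSeparable hn hVA hVB h⟩⟩
  · intro α β _ _ _ _ ρ h
    exact h.diCertifiable
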